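/- Let $F$ be a continuous distribution function on $\mathbb{R}$ with $F(0)=0$ that has a density $f$ equal to its Maclaurin series on the positive half-line, that is, $$f(x)=\sum_{q=0}^{\infty}\frac{f^{(q)}(0)}{q!}\,x^{q}\qquad\text{for all } x>0,$$ where $f^{(q)}(0)$ denotes the $q$-th right derivative at $0$. Let $k,n$ be fixed integers with $1<k\le n$, and let $X_1,\dots,X_n$ be independent random variables with distribution function $F$. For $1\le j\le m\le n$ let $X_{(j;m)}$ denote the $j$-th smallest of $X_1,\dots,X_m$. If $$X_{(k-1;n-1)}+\frac1n X_n\overset{d}{=}X_{(k;n)},$$ then $F$ is an exponential distribution: there is $\lambda>0$ such that $F(x)=1-e^{-\lambda x}$ for all $x\ge 0$. -/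

import Mathlib

open MeasureTheory ProbabilityTheory

/-- `f` equals its Maclaurin series at every `x > 0`; the derivatives at `0` are taken from the
right, since a density of a distribution on `[0, ∞)` need not be smooth across `0`. -/
def HasMaclaurinExpansion (f : ℝ → ℝ) : Prop :=
  ∀ x : ℝ, 0 < x →
    HasSum (fun q : ℕ => iteratedDerivWithin q f (Set.Ici 0) 0 / (q.factorial : ℝ) * x ^ q) (f x)

/-- The class `𝓕`: the distribution function `F` of `ν` is continuous, `F 0 = 0`, and `ν` has a
density that equals its Maclaurin series for all `x > 0`. -/
structure InClassF (ν : Measure ℝ) : Prop where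
  continuous_cdf : Continuous (cdf ν)
  cdf_zero : cdf ν 0 = 0
  exists_density : ∃ f : ℝ → ℝ, Measurable f ∧ (∀ x, 0 ≤ f x) ∧
    ν = volume.withDensity (fun x => ENNReal.ofReal (f x)) ∧ HasMaclaurinExpansion f

/-- The `k`-th smallest (counted from `1`) of the `n` values `x 0, …, x (n - 1)`. -/
noncomputable def orderStat {n : ℕ} (x : Fin n → ℝ) (k : ℕ) (hk : 1 ≤ k) (hkn : k ≤ n) : ℝ :=
  x (Tuple.sort x ⟨k - 1, by omega⟩)

/-! Write `r = k - 1`, `l = n - 1`, and let `P` be the power series of the distribution function at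
`0`. By Watson's lemma the Laplace transforms of the two sides have asymptotic expansions in powers
of `w = 1 / s`, so the identity in law becomes an algebraic equation `laplaceDefect r l P = 0`
between formal power series. Let `e Xᵐ` be the leading term of `P`.

If `m = 1`, the equation determines `P` from `e`, up to one free parameter when `r = l`, and the
series of `e (1 - exp (-a x)) / a` are solutions; a distribution function among them belongs to an
exponential law.

If `m ≥ 2`, the linearized equation is nonsingular in every degree, so by homogeneity `P` is a
series in `Xᵐ`, and the recursion bounds its Laplace coefficients geometrically. Hence the Laplace
transform is analytic in `1 / s` near `0`, and even when `m = 2`. For `m ≥ 3` the law of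
`X ^ (m / 2)` has the regraded expansion, whose Laplace transform is even and analytic in all of
`1 / s`; its characteristic function is then even, contrary to positivity. For `m = 2` the even
extension of the tail has a Fourier transform of compact support, and the equation for the
characteristic functions fails at the edge of that support.
-/

/-! ### The formal power series equation -/

section

open PowerSeries (rescale coeff constantCoeff)
open scoped PowerSeries Polynomial Nat

section LeadingTerm

variable {R : Type*} [CommRing R] {P Q F F' : R⟦X⟧} {i j m d k : ℕ} {a b e δ : R}

/-- `P = c Xⁱ + ⋯`: the series `P` has no term of degree below `i`, and its coefficient of degree
`i` is `c`, which may vanish. -/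
def HasLeadingTerm (P : R⟦X⟧) (i : ℕ) (c : R) : Prop :=
  PowerSeries.X ^ i ∣ P ∧ coeff i P = c

theorem constantCoeff_aeval (hF : constantCoeff F = 0) (p : R[X]) :
    constantCoeff (Polynomial.aeval F p) = p.coeff 0 := by
  rw [Polynomial.aeval_def, Polynomial.hom_eval₂, hF]
  simp [Polynomial.eval₂_at_zero]

namespace HasLeadingTerm

theorem add (hP : HasLeadingTerm P i a) (hQ : HasLeadingTerm Q i b) :
    HasLeadingTerm (P + Q) i (a + b) :=
  ⟨dvd_add hP.1 hQ.1, by rw [map_add, hP.2, hQ.2]⟩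

theorem sub (hP : HasLeadingTerm P i a) (hQ : HasLeadingTerm Q i b) :
    HasLeadingTerm (P - Q) i (a - b) :=
  ⟨dvd_sub hP.1 hQ.1, by rw [map_sub, hP.2, hQ.2]⟩

theorem add_of_X_pow_dvd (hP : HasLeadingTerm P i a) (hij : i < j) (hQ : PowerSeries.X ^ j ∣ Q) :
    HasLeadingTerm (P + Q) i a :=
  ⟨dvd_add hP.1 ((pow_dvd_pow _ hij.le).trans hQ), by
    rw [map_add, hP.2, PowerSeries.X_pow_dvd_iff.mp hQ i hij, add_zero]⟩

theorem of_constantCoeff (P : R⟦X⟧) : HasLeadingTerm P 0 (constantCoeff P) :=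
  ⟨by simp, by simp⟩

theorem mul (hP : HasLeadingTerm P i a) (hQ : HasLeadingTerm Q j b) :
    HasLeadingTerm (P * Q) (i + j) (a * b) := by
  obtain ⟨⟨U, rfl⟩, rfl⟩ := hP
  obtain ⟨⟨V, rfl⟩, rfl⟩ := hQ
  have h : PowerSeries.X ^ i * U * (PowerSeries.X ^ j * V) = PowerSeries.X ^ (i + j) * (U * V) := by
    ring
  exact ⟨⟨_, h⟩, by simp [h, PowerSeries.coeff_X_pow_mul']⟩

theorem pow (hP : HasLeadingTerm P i a) : ∀ k : ℕ, HasLeadingTerm (P ^ k) (i * k) (a ^ k)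
  | 0 => by simpa using of_constantCoeff (1 : R⟦X⟧)
  | k + 1 => by simpa only [pow_succ, mul_add_one] using (hP.pow k).mul hP

theorem rescale (hP : HasLeadingTerm P i a) (c : R) :
    HasLeadingTerm (PowerSeries.rescale c P) i (c ^ i * a) := by
  refine ⟨PowerSeries.X_pow_dvd_iff.mpr fun j hj => ?_, by simp [PowerSeries.coeff_rescale, hP.2]⟩
  rw [PowerSeries.coeff_rescale, PowerSeries.X_pow_dvd_iff.mp hP.1 j hj, mul_zero]

theorem of_sub (hF : HasLeadingTerm F m e) (hd : 0 < d)
    (hFF : PowerSeries.X ^ (m + d) ∣ F' - F) : HasLeadingTerm F' m e := by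
  simpa using hF.add_of_X_pow_dvd (by omega) hFF

theorem pow_sub_pow (hF : HasLeadingTerm F m e) (hd : 0 < d)
    (hFF : HasLeadingTerm (F' - F) (m + d) δ) :
    ∀ k : ℕ, HasLeadingTerm (F' ^ k - F ^ k) (m * k + d) (k * e ^ (k - 1) * δ)
  | 0 => by simp [HasLeadingTerm]
  | k + 1 => by
    have h₁ := ((hF.of_sub hd hFF.1).pow k).mul hFF
    have h₂ := (pow_sub_pow hF hd hFF k).mul hF
    rw [show m * k + d + m = m * k + (m + d) by ring] at h₂
    convert h₁.add h₂ using 1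
    · ring
    · ring
    · cases k with
      | zero => simp
      | succ k => rw [Nat.add_sub_cancel]; push_cast; ring

theorem constantCoeff_eq_zero (hF : HasLeadingTerm F m e) (hm : 0 < m) : constantCoeff F = 0 := by
  simpa using PowerSeries.X_pow_dvd_iff.mp hF.1 0 hm

theorem aeval (hF : HasLeadingTerm F m e) (hm : 0 < m) {p : R[X]} (hp : Polynomial.X ^ k ∣ p) :
    HasLeadingTerm (Polynomial.aeval F p) (m * k) (p.coeff k * e ^ k) := by
  obtain ⟨q, rfl⟩ := hp
  have hq := constantCoeff_aeval (hF.constantCoeff_eq_zero hm) q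
  simpa [hq, mul_comm, Polynomial.coeff_mul_X_pow'] using
    (hF.pow k).mul (of_constantCoeff (Polynomial.aeval F q))

theorem aeval_sub_aeval (hF : HasLeadingTerm F m e) (hm : 0 < m) (hd : 0 < d)
    (hFF : HasLeadingTerm (F' - F) (m + d) δ) {p : R[X]} (hp : Polynomial.X ^ k ∣ p) :
    HasLeadingTerm (Polynomial.aeval F' p - Polynomial.aeval F p) (m * k + d)
      (p.coeff k * (k * e ^ (k - 1) * δ)) := by
  obtain ⟨q, rfl⟩ := hp
  have hF' := hF.of_sub hd hFF.1
  have hq := constantCoeff_aeval (hF'.constantCoeff_eq_zero hm) q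
  have h₁ := (hF.pow_sub_pow hd hFF k).mul (of_constantCoeff (Polynomial.aeval F' q))
  have h₂ : PowerSeries.X ^ (m * k + (m + d)) ∣
      F ^ k * (Polynomial.aeval F' q - Polynomial.aeval F q) := by
    rw [pow_add]
    refine mul_dvd_mul (hF.pow k).1 (hFF.1.trans ?_)
    simpa only [Polynomial.eval_map_algebraMap] using
      Polynomial.sub_dvd_eval_sub F' F (q.map (algebraMap R R⟦X⟧))
  convert h₁.add_of_X_pow_dvd (by omega) h₂ using 1
  · simp only [map_mul, map_pow, Polynomial.aeval_X]
    ring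
  · rfl
  · simp [hq, mul_comm, Polynomial.coeff_mul_X_pow']

end HasLeadingTerm

end LeadingTerm

section FormalEquation

/-- The probability, as a polynomial in `u`, that at least `k` of `n` independent events of
probability `u` occur. -/
noncomputable def binomTail (R : Type*) [CommRing R] (k n : ℕ) : R[X] :=
  ∑ j ∈ Finset.Icc k n, bernsteinPolynomial R n j

/-- The formal Laplace transform `∑ pᵢ xⁱ ↦ ∑ i! pᵢ wⁱ`: termwise, `w` times it is the Laplace
transform at `1 / w`. -/
noncomputable def formalLaplace (R : Type*) [CommRing R] : R⟦X⟧ →ₗ[R] R⟦X⟧ where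
  toFun P := .mk fun i => i ! * coeff i P
  map_add' P Q := by ext; simp [mul_add]
  map_smul' c P := by ext; simp; ring

/-- The defect of the identity `E e^{-s X_(r;n-1)} · E e^{-s X_n / n} = E e^{-s X_(r+1;n)}`,
`n = l + 1`, in powers of `w = 1 / s`, when the common distribution function has the power series
`F` at `0`. -/
noncomputable def laplaceDefect {R : Type*} [CommRing R] (r l : ℕ) (F : R⟦X⟧) : R⟦X⟧ :=
  formalLaplace R (Polynomial.aeval F (binomTail R r l)) *
      rescale (l + 1 : R) (formalLaplace R F) -
    formalLaplace R (Polynomial.aeval F (binomTail R (r + 1) (l + 1)))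

variable {R : Type*} [CommRing R] {r l m d : ℕ} {F F' P : R⟦X⟧} {e δ : R}

@[simp]
theorem coeff_formalLaplace (P : R⟦X⟧) (i : ℕ) : coeff i (formalLaplace R P) = i ! * coeff i P :=
  PowerSeries.coeff_mk i fun i => (i ! * coeff i P : R)

theorem HasLeadingTerm.formalLaplace {i : ℕ} (hP : HasLeadingTerm P i e) :
    HasLeadingTerm (formalLaplace R P) i (i ! * e) := by
  refine ⟨PowerSeries.X_pow_dvd_iff.mpr fun j hj => ?_, by rw [coeff_formalLaplace, hP.2]⟩
  rw [coeff_formalLaplace, PowerSeries.X_pow_dvd_iff.mp hP.1 j hj, mul_zero]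

theorem X_pow_dvd_bernsteinPolynomial (n j : ℕ) :
    (Polynomial.X : R[X]) ^ j ∣ bernsteinPolynomial R n j :=
  ⟨(n.choose j : R[X]) * (1 - Polynomial.X) ^ (n - j), by rw [bernsteinPolynomial]; ring⟩

theorem X_pow_dvd_binomTail (k n : ℕ) : (Polynomial.X : R[X]) ^ k ∣ binomTail R k n :=
  Finset.dvd_sum fun j hj => (pow_dvd_pow _ (Finset.mem_Icc.mp hj).1).trans
    (X_pow_dvd_bernsteinPolynomial n j)

theorem natDegree_binomTail_le (k n : ℕ) : (binomTail R k n).natDegree ≤ n := by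
  refine Polynomial.natDegree_sum_le_of_forall_le _ _ fun j hj => ?_
  rw [bernsteinPolynomial]
  compute_degree
  have := (Finset.mem_Icc.mp hj).2
  omega

theorem binomTail_eq_add {k n : ℕ} (hkn : k ≤ n) :
    binomTail R k n = bernsteinPolynomial R n k + binomTail R (k + 1) n := by
  rw [binomTail, ← Finset.add_sum_Ioc_eq_sum_Icc hkn, ← Finset.Icc_add_one_left_eq_Ioc, binomTail]

theorem coeff_self_binomTail {k n : ℕ} : (binomTail R k n).coeff k = n.choose k := by
  rcases le_or_gt k n with hkn | hkn
  · rw [binomTail_eq_add hkn, Polynomial.coeff_add,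
      Polynomial.X_pow_dvd_iff.mp (X_pow_dvd_binomTail (k + 1) n) k k.lt_succ_self,
      bernsteinPolynomial, mul_right_comm, Polynomial.coeff_mul_X_pow', if_pos le_rfl]
    simp [Polynomial.coeff_zero_eq_eval_zero]
  · simp [binomTail, Finset.Icc_eq_empty_of_lt hkn, Nat.choose_eq_zero_of_lt hkn]

theorem map_binomTail {S : Type*} [CommRing S] (f : R →+* S) (k n : ℕ) :
    (binomTail R k n).map f = binomTail S k n := by
  simp [binomTail, Polynomial.map_sum, bernsteinPolynomial.map]

theorem hasLeadingTerm_laplaceDefect (hF : HasLeadingTerm F m e) (hm : 0 < m) (r l : ℕ) :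
    HasLeadingTerm (laplaceDefect r l F) (m * (r + 1))
      (l.choose r * e ^ (r + 1) * ((m * r)! * m ! * (l + 1) ^ m) -
        (l + 1).choose (r + 1) * e ^ (r + 1) * (m * (r + 1))!) := by
  have hG := (hF.aeval hm (X_pow_dvd_binomTail r l)).formalLaplace
  have hH := (hF.aeval hm (X_pow_dvd_binomTail (r + 1) (l + 1))).formalLaplace
  have h := (hG.mul (hF.formalLaplace.rescale (l + 1 : R))).sub hH
  rw [← mul_add_one, coeff_self_binomTail, coeff_self_binomTail] at h
  convert h using 1
  · rfl
  · ring

/-- The factor by which the linearization of `laplaceDefect` at a series of order `m` multiplies a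
perturbation of degree `m + d`. -/
def linearizationFactor (r l m d : ℕ) : ℤ :=
  (m * r)! * (m + d)! * (l + 1) ^ (m + d) + r * ((m * r + d)! * m ! * (l + 1) ^ m) -
    (l + 1) * (m * (r + 1) + d)!

theorem hasLeadingTerm_laplaceDefect_sub (hF : HasLeadingTerm F m e) (hm : 0 < m) (hd : 0 < d)
    (hFF : HasLeadingTerm (F' - F) (m + d) δ) (hr : 0 < r) :
    HasLeadingTerm (laplaceDefect r l F' - laplaceDefect r l F) (m * (r + 1) + d)
      (l.choose r * e ^ r * δ * linearizationFactor r l m d) := by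
  have hF' := hF.of_sub hd hFF.1
  have hG := (hF.aeval hm (X_pow_dvd_binomTail r l)).formalLaplace
  have hGG := (hF.aeval_sub_aeval hm hd hFF (X_pow_dvd_binomTail r l)).formalLaplace
  have hHH := (hF.aeval_sub_aeval hm hd hFF
    (X_pow_dvd_binomTail (r + 1) (l + 1))).formalLaplace
  have h₁ := hGG.mul (hF'.formalLaplace.rescale (l + 1 : R))
  have h₂ := hG.mul (hFF.formalLaplace.rescale (l + 1 : R))
  rw [show m * r + d + m = m * (r + 1) + d by ring] at h₁
  rw [show m * r + (m + d) = m * (r + 1) + d by ring] at h₂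
  convert (h₁.add h₂).sub hHH using 1
  · simp only [laplaceDefect, map_sub]
    ring
  · have hchoose := congrArg (Nat.cast (R := R)) (Nat.add_one_mul_choose_eq l r)
    obtain ⟨r, rfl⟩ := Nat.exists_eq_add_of_lt hr
    simp only [coeff_self_binomTail, linearizationFactor, zero_add, Nat.add_sub_cancel] at hchoose ⊢
    push_cast at hchoose ⊢
    linear_combination (-(m * (r + 1 + 1) + d)! * e ^ (r + 1) * δ : R) * hchoose

theorem laplaceDefect_rescale (c : R) (F : R⟦X⟧) :
    laplaceDefect r l (rescale c F) = rescale c (laplaceDefect r l F) := by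
  have hL (P : R⟦X⟧) : formalLaplace R (rescale c P) = rescale c (formalLaplace R P) := by
    ext i
    simp only [coeff_formalLaplace, PowerSeries.coeff_rescale]
    ring
  have hA (p : R[X]) : Polynomial.aeval (rescale c F) p = rescale c (Polynomial.aeval F p) := by
    simp only [← PowerSeries.coe_rescaleAlgHom, RingHom.coe_coe, Polynomial.aeval_algHom_apply]
  simp only [laplaceDefect, hA, hL, map_sub, map_mul, PowerSeries.rescale_rescale,
    mul_comm (l + 1 : R)]

theorem laplaceDefect_map {S : Type*} [CommRing S] (f : R →+* S) (F : R⟦X⟧) :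
    laplaceDefect r l (F.map f) = (laplaceDefect r l F).map f := by
  have hL (P : R⟦X⟧) : formalLaplace S (P.map f) = (formalLaplace R P).map f := by
    ext; simp
  have hA (k n : ℕ) : Polynomial.aeval (F.map f) (binomTail S k n) =
      (Polynomial.aeval F (binomTail R k n)).map f := by
    rw [← map_binomTail f, Polynomial.aeval_def, Polynomial.aeval_def, Polynomial.eval₂_map,
      Polynomial.hom_eval₂]
    congr 1
    ext : 1
    simp
  have hR (P : R⟦X⟧) : rescale (l + 1 : S) (P.map f) = (rescale (l + 1 : R) P).map f := by
    ext; simp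
  simp only [laplaceDefect, hA, hL, hR, map_sub, map_mul]

end FormalEquation

section Uniqueness

variable {K : Type*} [Field K] [CharZero K] {r l m : ℕ} {F F' : K⟦X⟧} {e : K}

theorem factorial_eq_of_laplaceDefect_eq_zero (hm : 0 < m) (hrl : r ≤ l)
    (hF : HasLeadingTerm F m e) (he : e ≠ 0) (h : laplaceDefect r l F = 0) :
    (r + 1) * ((m * r)! * m ! * (l + 1) ^ m) = (l + 1) * (m * (r + 1))! := by
  have h₀ := (hasLeadingTerm_laplaceDefect hF hm r l).2
  rw [h, map_zero] at h₀
  have hchoose := congrArg (Nat.cast (R := K)) (Nat.add_one_mul_choose_eq l r)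
  have hne : (l.choose r : K) * e ^ (r + 1) ≠ 0 :=
    mul_ne_zero (mod_cast (Nat.choose_pos hrl).ne') (pow_ne_zero _ he)
  rw [← Nat.cast_inj (R := K)]
  refine mul_left_cancel₀ hne ?_
  push_cast at hchoose ⊢
  linear_combination (-(r + 1) : K) * h₀ - (m * (r + 1))! * e ^ (r + 1) * hchoose

theorem eq_of_laplaceDefect_eq_zero (hm : 0 < m) (hr : 0 < r) (hrl : r ≤ l)
    (hF : HasLeadingTerm F m e) (he : e ≠ 0) (hF' : HasLeadingTerm F' m e)
    (h : laplaceDefect r l F = 0) (h' : laplaceDefect r l F' = 0)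
    (hd : ∀ d, 0 < d → linearizationFactor r l m d ≠ 0 ∨ coeff (m + d) F' = coeff (m + d) F) :
    F' = F := by
  suffices hdvd : ∀ j, PowerSeries.X ^ j ∣ F' - F by
    ext j
    simpa [sub_eq_zero] using PowerSeries.X_pow_dvd_iff.mp (hdvd (j + 1)) j j.lt_succ_self
  intro j
  induction j with
  | zero => simp
  | succ j ih =>
    rw [PowerSeries.X_pow_dvd_iff] at ih ⊢
    intro i hi
    rcases Nat.lt_succ_iff_lt_or_eq.mp hi with hi | rfl
    · exact ih i hi
    rcases lt_trichotomy i m with him | rfl | him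
    · rw [map_sub, PowerSeries.X_pow_dvd_iff.mp hF'.1 i him,
        PowerSeries.X_pow_dvd_iff.mp hF.1 i him, sub_zero]
    · rw [map_sub, hF'.2, hF.2, sub_self]
    obtain ⟨d, rfl⟩ := Nat.exists_eq_add_of_lt him
    rw [add_assoc m d 1] at ih ⊢
    rcases hd (d + 1) d.succ_pos with hd | hd
    · have hlead := (hasLeadingTerm_laplaceDefect_sub hF hm d.succ_pos
        ⟨PowerSeries.X_pow_dvd_iff.mpr ih, rfl⟩ hr (l := l)).2
      have hchoose : (l.choose r : K) ≠ 0 := mod_cast (Nat.choose_pos hrl).ne'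
      have hfac : (linearizationFactor r l m (d + 1) : K) ≠ 0 := mod_cast hd
      simpa [h, h', hchoose, he, hfac] using hlead.symm
    · rw [map_sub, hd, sub_self]

end Uniqueness

section Arithmetic

variable {r l m d : ℕ}

theorem two_mul_add_one_pow_mul_factorial_le (r q : ℕ) :
    (2 * r + 1) ^ q * q ! ≤ ((q + 1) * r + 1).ascFactorial q := by
  -- Pairing the factors `(q + 1) r + a` and `(q + 1) r + b` with `a + b = q + 1` gives the square.
  refine (Nat.pow_le_pow_iff_left two_ne_zero).mp ?_
  have hfac : ((q ! ^ 2 : ℕ)) = ∏ i ∈ Finset.range q, ((i + 1) * (q - i)) := by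
    rw [sq, Finset.prod_mul_distrib, Finset.prod_range_add_one_eq_factorial,
      ← Finset.prod_range_reflect, ← Finset.prod_range_add_one_eq_factorial]
    congr 1
    refine Finset.prod_congr rfl fun i hi => ?_
    have := Finset.mem_range.mp hi
    omega
  have hasc : ((q + 1) * r + 1).ascFactorial q ^ 2 =
      ∏ i ∈ Finset.range q, (((q + 1) * r + 1 + i) * ((q + 1) * r + 1 + (q - 1 - i))) := by
    rw [sq, Finset.prod_mul_distrib, Nat.ascFactorial_eq_prod_range,
      Finset.prod_range_reflect (fun i => (q + 1) * r + 1 + i) q]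
  rw [mul_pow, hfac, hasc, ← pow_mul, mul_comm q, pow_mul, ← Finset.card_range q,
    ← Finset.prod_const, Finset.card_range, ← Finset.prod_mul_distrib]
  refine Finset.prod_le_prod' fun i hi => ?_
  obtain ⟨j, rfl⟩ := Nat.exists_eq_add_of_lt (Finset.mem_range.mp hi)
  rw [show i + j + 1 - i = j + 1 by omega, show i + j + 1 - 1 - i = j by omega]
  zify
  nlinarith [mul_nonneg (mul_nonneg (Nat.cast_nonneg (α := ℤ) r) (by positivity : (0 : ℤ) ≤ r + 1))
    (sq_nonneg ((i : ℤ) - j))]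

theorem two_mul_le_of_factorial_eq (hm : 2 ≤ m)
    (h : (r + 1) * ((m * r)! * m ! * (l + 1) ^ m) = (l + 1) * (m * (r + 1))!) : 2 * r ≤ l := by
  obtain ⟨q, rfl⟩ := Nat.exists_eq_add_of_le' (show 1 ≤ m by omega)
  have hasc : (l + 1) ^ q * q ! = ((q + 1) * r + 1).ascFactorial q := by
    have hfac : ((q + 1) * (r + 1))! = ((q + 1) * (r + 1)) *
        (((q + 1) * r)! * ((q + 1) * r + 1).ascFactorial q) := by
      rw [Nat.factorial_mul_ascFactorial, show (q + 1) * (r + 1) = (q + 1) * r + q + 1 by ring,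
        Nat.factorial_succ]
    rw [hfac, Nat.factorial_succ, pow_succ] at h
    refine Nat.eq_of_mul_eq_mul_left
      (show 0 < (l + 1) * (r + 1) * (q + 1) * ((q + 1) * r)! by positivity) ?_
    linarith
  have hpow : (2 * r + 1) ^ q ≤ (l + 1) ^ q :=
    Nat.le_of_mul_le_mul_right (hasc ▸ two_mul_add_one_pow_mul_factorial_le r q) q.factorial_pos
  have := (Nat.pow_le_pow_iff_left (by omega)).mp hpow
  omega

theorem add_one_mul_ascFactorial_lt (hr : 0 < r) (hl : 2 * r ≤ l) (m d : ℕ) :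
    (r + 1) * (m * (r + 1) + 1).ascFactorial (d + 1) <
      r * (m * r + 1).ascFactorial (d + 1) + (l + 1) ^ (d + 1) * (m + 1).ascFactorial (d + 1) := by
  have hab (d : ℕ) : (m * r + 1).ascFactorial d ≤ (l + 1) ^ d * (m + 1).ascFactorial d := by
    rw [Nat.ascFactorial_eq_prod_range, Nat.ascFactorial_eq_prod_range,
      Finset.pow_eq_prod_const, ← Finset.prod_mul_distrib]
    exact Finset.prod_le_prod' fun i _ => by nlinarith
  have step (d : ℕ) (h : (r + 1) * (m * (r + 1) + 1).ascFactorial d ≤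
      r * (m * r + 1).ascFactorial d + (l + 1) ^ d * (m + 1).ascFactorial d) :
      (r + 1) * (m * (r + 1) + 1).ascFactorial (d + 1) <
        r * (m * r + 1).ascFactorial (d + 1) +
          (l + 1) ^ (d + 1) * (m + 1).ascFactorial (d + 1) := by
    have hpos : 0 < (l + 1) ^ d * (m + 1).ascFactorial d := by positivity
    have hcoef : m * (r + 1) + 1 + d + r * m < (l + 1) * (m + 1 + d) := by nlinarith
    simp only [Nat.ascFactorial_succ, pow_succ]
    nlinarith [Nat.mul_le_mul_right (m * (r + 1) + 1 + d) h, Nat.mul_le_mul_right (r * m) (hab d),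
      Nat.mul_lt_mul_of_pos_left hcoef hpos]
  induction d with
  | zero => exact step 0 (by simp)
  | succ d ih => exact step (d + 1) ih.le

theorem linearizationFactor_pos (hr : 0 < r) (hl : 2 * r ≤ l) (hd : 0 < d)
    (h : (r + 1) * ((m * r)! * m ! * (l + 1) ^ m) = (l + 1) * (m * (r + 1))!) :
    0 < linearizationFactor r l m d := by
  obtain ⟨d, rfl⟩ := Nat.exists_eq_add_of_lt hd
  have hlt := add_one_mul_ascFactorial_lt hr hl m d
  zify at h hlt
  rw [linearizationFactor, zero_add, ← Nat.factorial_mul_ascFactorial m,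
    ← Nat.factorial_mul_ascFactorial (m * r), ← Nat.factorial_mul_ascFactorial (m * (r + 1)),
    pow_add]
  push_cast
  have hpos : (0 : ℤ) < (m * r)! * m ! * (l + 1) ^ m := by positivity
  nlinarith [mul_lt_mul_of_pos_left hlt hpos]

theorem factorial_add_le (hrl : r ≤ l) : ∀ d, (r + d)! ≤ r ! * d ! * (l + 1) ^ d
  | 0 => by simp
  | d + 1 => by
    have hcoef : r + d + 1 ≤ (d + 1) * (l + 1) := by nlinarith
    calc (r + (d + 1))! = (r + d + 1) * (r + d)! := Nat.factorial_succ _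
      _ ≤ (d + 1) * (l + 1) * (r ! * d ! * (l + 1) ^ d) :=
        Nat.mul_le_mul hcoef (factorial_add_le hrl d)
      _ = r ! * (d + 1)! * (l + 1) ^ (d + 1) := by rw [Nat.factorial_succ]; ring

theorem linearizationFactor_one_pos (hr : 0 < r) (hrl : r ≤ l) (hd : 0 < d) (h : r < l ∨ 1 < d) :
    0 < linearizationFactor r l 1 d := by
  have hlt : (r + d)! < r ! * d ! * (l + 1) ^ d := by
    obtain ⟨d, rfl⟩ := Nat.exists_eq_add_of_lt hd
    have hcoef : r + d + 1 < (d + 1) * (l + 1) := by rcases h with h | h <;> nlinarith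
    calc (r + (0 + d + 1))! = (r + d + 1) * (r + d)! := by rw [zero_add]; exact Nat.factorial_succ _
      _ < (d + 1) * (l + 1) * (r ! * d ! * (l + 1) ^ d) :=
        Nat.mul_lt_mul_of_lt_of_le hcoef (factorial_add_le hrl d) (by positivity)
      _ = r ! * (0 + d + 1)! * (l + 1) ^ (0 + d + 1) := by
        rw [zero_add, Nat.factorial_succ]; ring
  have heq : linearizationFactor r l 1 d =
      (l + 1) * (d + 1) * (r ! * d ! * (l + 1) ^ d - (r + d)!) := by
    rw [linearizationFactor, one_mul, one_mul, show r + 1 + d = (r + d) + 1 by ring, add_comm 1 d,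
      Nat.factorial_succ d, Nat.factorial_succ (r + d)]
    push_cast
    ring
  zify at hlt
  rw [heq]
  exact mul_pos (by positivity) (sub_pos.mpr hlt)

end Arithmetic

section BinomTail

variable {R : Type*} [CommRing R] {k n : ℕ}

theorem binomTail_self (n : ℕ) : binomTail R n n = Polynomial.X ^ n := by
  simp [binomTail, bernsteinPolynomial]

theorem bernsteinPolynomial_succ_succ (hkn : k < n) :
    bernsteinPolynomial R (n + 1) (k + 1) = Polynomial.X * bernsteinPolynomial R n k +
      (1 - Polynomial.X) * bernsteinPolynomial R n (k + 1) := by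
  obtain ⟨d, rfl⟩ := Nat.exists_eq_add_of_lt hkn
  simp only [bernsteinPolynomial, Nat.choose_succ_succ' (k + d + 1),
    show k + d + 1 + 1 - (k + 1) = d + 1 by omega, show k + d + 1 - k = d + 1 by omega,
    show k + d + 1 - (k + 1) = d by omega]
  push_cast
  ring

theorem binomTail_sub_binomTail_succ_succ (hkn : k ≤ n) :
    binomTail R k n - binomTail R (k + 1) (n + 1) =
      (1 - Polynomial.X) * bernsteinPolynomial R n k := by
  induction hkn using Nat.decreasingInduction with
  | self => simp [binomTail_self, bernsteinPolynomial]; ring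
  | of_succ k hk ih =>
    rw [binomTail_eq_add hk.le, binomTail_eq_add (show k + 1 ≤ n + 1 by omega),
      bernsteinPolynomial_succ_succ hk]
    linear_combination ih

theorem derivative_binomTail_succ_succ (hkn : k ≤ n) :
    Polynomial.derivative (binomTail R (k + 1) (n + 1)) =
      (n + 1 : R[X]) * bernsteinPolynomial R n k := by
  induction hkn using Nat.decreasingInduction with
  | self => simp [binomTail_self, bernsteinPolynomial]
  | of_succ k hk ih =>
    rw [binomTail_eq_add (show k + 1 ≤ n + 1 by omega), Polynomial.derivative_add, ih,
      bernsteinPolynomial.derivative_succ]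
    push_cast
    ring

theorem derivative_binomTail_succ_succ_mul {r l : ℕ} (hrl : r ≤ l) {c a : R}
    (h : r < l → a = c) :
    Polynomial.derivative (binomTail R (r + 1) (l + 1)) *
        (Polynomial.C c - Polynomial.C a * Polynomial.X) =
      (l + 1 : R[X]) * (Polynomial.C c * binomTail R r l -
        Polynomial.C a * binomTail R (r + 1) (l + 1)) := by
  rw [derivative_binomTail_succ_succ hrl]
  rcases hrl.eq_or_lt with rfl | hrl'
  · simp [binomTail_self, bernsteinPolynomial]
    ring
  · rw [h hrl', ← mul_sub, binomTail_sub_binomTail_succ_succ hrl]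
    ring

end BinomTail

section ExponentialSolution

variable {K : Type*} [Field K] {r l : ℕ} {c a : K}

/-- The Maclaurin series of `c (1 - e^{-a x}) / a`, which is `c x` when `a = 0`. -/
noncomputable def expSeries (c a : K) : K⟦X⟧ :=
  PowerSeries.X * .mk fun i => c * (-a) ^ i / (i + 1)!

theorem coeff_expSeries_succ (c a : K) (i : ℕ) :
    coeff (i + 1) (expSeries c a) = c * (-a) ^ i / (i + 1)! := by
  rw [expSeries, PowerSeries.coeff_succ_X_mul, PowerSeries.coeff_mk]

theorem hasLeadingTerm_expSeries (c a : K) : HasLeadingTerm (expSeries c a) 1 c :=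
  ⟨by rw [pow_one]; exact dvd_mul_right _ _, by simp [coeff_expSeries_succ c a 0]⟩

theorem derivative_expSeries [CharZero K] (c a : K) :
    PowerSeries.derivative K (expSeries c a) =
      PowerSeries.C c - PowerSeries.C a * expSeries c a := by
  ext i
  rw [PowerSeries.coeff_derivative, coeff_expSeries_succ, Nat.factorial_succ]
  have hi : (i + 1 : K) ≠ 0 := i.cast_add_one_ne_zero
  cases i with
  | zero => simp [(hasLeadingTerm_expSeries c a).constantCoeff_eq_zero one_pos]
  | succ i =>
    have := Nat.cast_ne_zero (R := K).mpr (i + 1).factorial_ne_zero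
    simp only [map_sub, PowerSeries.coeff_C_mul, coeff_expSeries_succ, PowerSeries.coeff_C,
      Nat.add_one_ne_zero, if_false]
    push_cast at hi ⊢
    field_simp
    ring

theorem X_mul_formalLaplace_derivative {R : Type*} [CommRing R] {P : R⟦X⟧}
    (hP : constantCoeff P = 0) :
    PowerSeries.X * formalLaplace R (PowerSeries.derivative R P) = formalLaplace R P := by
  ext i
  cases i with
  | zero => simp [hP]
  | succ i =>
    rw [PowerSeries.coeff_succ_X_mul, coeff_formalLaplace, coeff_formalLaplace,
      PowerSeries.coeff_derivative, Nat.factorial_succ]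
    push_cast
    ring

theorem formalLaplace_C_mul {R : Type*} [CommRing R] (c : R) (P : R⟦X⟧) :
    formalLaplace R (PowerSeries.C c * P) = PowerSeries.C c * formalLaplace R P := by
  rw [← PowerSeries.smul_eq_C_mul, map_smul, PowerSeries.smul_eq_C_mul]

theorem laplaceDefect_expSeries [CharZero K] (hrl : r ≤ l) (h : r < l → a = c) :
    laplaceDefect r l (expSeries c a) = 0 := by
  have hE₀ := (hasLeadingTerm_expSeries c a).constantCoeff_eq_zero one_pos
  have hE := derivative_expSeries c a
  have hpoly := congrArg (Polynomial.aeval (expSeries c a))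
    (derivative_binomTail_succ_succ_mul hrl h)
  rw [laplaceDefect]
  generalize expSeries c a = E at hE₀ hE hpoly ⊢
  set G := Polynomial.aeval E (binomTail K r l)
  set H := Polynomial.aeval E (binomTail K (r + 1) (l + 1)) with hH
  have hH₀ : constantCoeff H = 0 := by
    rw [hH, constantCoeff_aeval hE₀]
    exact Polynomial.X_pow_dvd_iff.mp (X_pow_dvd_binomTail (r + 1) (l + 1)) 0 r.succ_pos
  have hH' : PowerSeries.derivative K H =
      PowerSeries.C (l + 1 : K) * (PowerSeries.C c * G - PowerSeries.C a * H) := by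
    rw [hH, Derivation.map_aeval, hE, smul_eq_mul, ← hH]
    simpa [PowerSeries.algebraMap_apply] using hpoly
  have hEw := X_mul_formalLaplace_derivative hE₀
  have hHw := X_mul_formalLaplace_derivative hH₀
  rw [hE, map_sub, formalLaplace_C_mul] at hEw
  rw [hH', formalLaplace_C_mul, map_sub, formalLaplace_C_mul, formalLaplace_C_mul] at hHw
  have hC : formalLaplace K (PowerSeries.C c) = PowerSeries.C c := by
    ext i
    cases i <;> simp [PowerSeries.coeff_C]
  have hR (b : K) : rescale (l + 1 : K) (PowerSeries.C b) = PowerSeries.C b := by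
    ext i
    cases i <;> simp [PowerSeries.coeff_C]
  have hEn := congrArg (rescale (l + 1 : K)) hEw
  simp only [hC, map_mul, map_sub, PowerSeries.rescale_X, hR] at hEn
  set w := PowerSeries.X (R := K)
  have hunit : 1 + PowerSeries.C (l + 1 : K) * PowerSeries.C a * w ≠ 0 := fun h₀ => by
    simpa [w] using congrArg constantCoeff h₀
  refine (mul_eq_zero.mp ?_).resolve_left hunit
  linear_combination hHw - formalLaplace K G * hEn

theorem exists_eq_expSeries_of_laplaceDefect_eq_zero [CharZero K] {F : K⟦X⟧} (hr : 0 < r)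
    (hrl : r ≤ l) (hF : HasLeadingTerm F 1 c) (hc : c ≠ 0) (h : laplaceDefect r l F = 0) :
    ∃ a, F = expSeries c a := by
  rcases hrl.eq_or_lt with hrl' | hrl'
  · have hcoeff : coeff 2 F = coeff 2 (expSeries c (-2 * coeff 2 F / c)) := by
      rw [coeff_expSeries_succ]
      field_simp
      simp
    refine ⟨-2 * coeff 2 F / c, eq_of_laplaceDefect_eq_zero one_pos hr hrl
      (hasLeadingTerm_expSeries c _) hc hF (laplaceDefect_expSeries hrl (by omega)) h
      fun d hd => ?_⟩
    rcases Nat.lt_or_ge 1 d with hd' | hd'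
    · exact .inl (linearizationFactor_one_pos hr hrl hd (.inr hd')).ne'
    · obtain rfl : d = 1 := by omega
      exact .inr hcoeff
  · exact ⟨c, eq_of_laplaceDefect_eq_zero one_pos hr hrl (hasLeadingTerm_expSeries c c) hc hF
      (laplaceDefect_expSeries hrl fun _ => rfl) h
      fun d hd => .inl (linearizationFactor_one_pos hr hrl hd (.inl hrl')).ne'⟩

end ExponentialSolution

theorem coeff_eq_zero_of_laplaceDefect_eq_zero {r l m i : ℕ} {F : ℝ⟦X⟧} {e : ℝ} (hr : 0 < r)
    (hrl : r ≤ l) (hm : 2 ≤ m) (hF : HasLeadingTerm F m e) (he : e ≠ 0)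
    (h : laplaceDefect r l F = 0) (hi : ¬m ∣ i) : coeff i F = 0 := by
  have hζ := Complex.isPrimitiveRoot_exp m (by omega)
  set ζ := Complex.exp (2 * Real.pi * Complex.I / m)
  have hFℂ : HasLeadingTerm (F.map Complex.ofRealHom) m (e : ℂ) :=
    ⟨PowerSeries.X_pow_dvd_iff.mpr fun j hj => by
      simp [PowerSeries.X_pow_dvd_iff.mp hF.1 j hj], by simp [hF.2]⟩
  have h₀ : laplaceDefect r l (F.map Complex.ofRealHom) = 0 := by
    rw [laplaceDefect_map, h, map_zero]
  have hfac := factorial_eq_of_laplaceDefect_eq_zero (by omega) hrl hF he h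
  have hinv : rescale ζ (F.map Complex.ofRealHom) = F.map Complex.ofRealHom :=
    eq_of_laplaceDefect_eq_zero (by omega) hr hrl hFℂ (mod_cast he)
      (by simpa [hζ.pow_eq_one] using hFℂ.rescale ζ) h₀
      (by rw [laplaceDefect_rescale, h₀, map_zero])
      fun d hd => .inl (linearizationFactor_pos hr (two_mul_le_of_factorial_eq hm hfac) hd hfac).ne'
  have hcoeff := congrArg (coeff i) hinv
  simp only [PowerSeries.coeff_rescale, PowerSeries.coeff_map, Complex.ofRealHom_eq_coe] at hcoeff
  by_contra hne
  exact hi (hζ.dvd_of_pow_eq_one i (mul_eq_right₀ (mod_cast hne) |>.mp hcoeff))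

/-! ### Growth of the Laplace coefficients -/

open Finset.HasAntidiagonal (antidiagonal)

section Growth

theorem abs_coeff_mul_le {P P' Q Q' : ℝ⟦X⟧} (hP : ∀ i, |coeff i P| ≤ coeff i P')
    (hQ : ∀ i, |coeff i Q| ≤ coeff i Q') (i : ℕ) : |coeff i (P * Q)| ≤ coeff i (P' * Q') := by
  simp only [PowerSeries.coeff_mul]
  refine (Finset.abs_sum_le_sum_abs _ _).trans (Finset.sum_le_sum fun p _ => ?_)
  rw [abs_mul]
  exact mul_le_mul (hP _) (hQ _) (abs_nonneg _) ((abs_nonneg _).trans (hP _))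

theorem abs_coeff_pow_le {P P' : ℝ⟦X⟧} (hP : ∀ i, |coeff i P| ≤ coeff i P') :
    ∀ j i : ℕ, |coeff i (P ^ j)| ≤ coeff i (P' ^ j)
  | 0, i => by
    rw [pow_zero, pow_zero, PowerSeries.coeff_one]
    split_ifs <;> simp
  | j + 1, i => by
    rw [pow_succ, pow_succ]
    exact abs_coeff_mul_le (abs_coeff_pow_le hP j) hP i

theorem exists_natCast_pow_mul_pow_le (q : ℕ) {b B : ℝ} (hb : 0 ≤ b) (hB : b < B) :
    ∃ C, 0 ≤ C ∧ ∀ i : ℕ, (i : ℝ) ^ q * b ^ i ≤ C * B ^ i := by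
  have hB₀ : 0 < B := hb.trans_lt hB
  have hlim := tendsto_pow_const_mul_const_pow_of_abs_lt_one q (r := b / B)
    (by rw [abs_of_nonneg (by positivity)]; exact (div_lt_one hB₀).mpr hB)
  obtain ⟨C, hC⟩ := hlim.bddAbove_range
  have hC' (i : ℕ) : (i : ℝ) ^ q * (b / B) ^ i ≤ C := hC ⟨i, rfl⟩
  refine ⟨C, (by positivity : (0 : ℝ) ≤ (0 : ℕ) ^ q * (b / B) ^ 0).trans (hC' 0), fun i => ?_⟩
  rw [← div_le_iff₀ (by positivity), mul_div_assoc, ← div_pow]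
  exact hC' i

theorem coeff_exp_pow (u i : ℕ) :
    coeff i (formalLaplace ℝ (PowerSeries.exp ℝ ^ u)) = (u : ℝ) ^ i := by
  rw [coeff_formalLaplace, PowerSeries.exp_pow_eq_rescale_exp, PowerSeries.coeff_rescale,
    PowerSeries.coeff_exp]
  simp [field]

theorem exists_coeff_X_pow_mul_exp_pow_le (v u : ℕ) {B : ℝ} (hB : max (u : ℝ) 1 < B) :
    ∃ C, 0 ≤ C ∧ ∀ i,
      coeff i (formalLaplace ℝ (PowerSeries.X ^ v * PowerSeries.exp ℝ ^ u)) ≤ C * B ^ i := by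
  obtain ⟨C, hC, h⟩ := exists_natCast_pow_mul_pow_le v (by positivity) hB
  refine ⟨C, hC, fun i => ?_⟩
  have hB₀ : 0 < B := lt_of_lt_of_le (by positivity) hB.le
  rcases lt_or_ge i v with hi | hi
  · rw [coeff_formalLaplace, PowerSeries.coeff_X_pow_mul', if_neg hi.not_ge, mul_zero]
    positivity
  · obtain ⟨i, rfl⟩ := Nat.exists_eq_add_of_le' hi
    refine le_trans ?_ (h _)
    have hfact : (((i + v)! : ℕ) : ℝ) ≤ (i + v : ℕ) ^ v * i ! := by
      rw [← Nat.factorial_mul_descFactorial hi, Nat.add_sub_cancel, mul_comm, Nat.cast_mul]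
      gcongr
      exact mod_cast Nat.descFactorial_le_pow _ _
    have hcoeff : 0 ≤ coeff i (PowerSeries.exp ℝ ^ u) := by
      rw [PowerSeries.exp_pow_eq_rescale_exp, PowerSeries.coeff_rescale, PowerSeries.coeff_exp]
      positivity
    calc coeff (i + v) (formalLaplace ℝ (PowerSeries.X ^ v * PowerSeries.exp ℝ ^ u))
        = (i + v)! * coeff i (PowerSeries.exp ℝ ^ u) := by
          rw [coeff_formalLaplace, PowerSeries.coeff_X_pow_mul]
      _ ≤ (i + v : ℕ) ^ v * i ! * coeff i (PowerSeries.exp ℝ ^ u) := by gcongr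
      _ = (i + v : ℕ) ^ v * (u : ℝ) ^ i := by
          rw [mul_assoc, ← coeff_formalLaplace, coeff_exp_pow]
      _ ≤ (i + v : ℕ) ^ v * max (u : ℝ) 1 ^ (i + v) := by
          gcongr
          exact (pow_le_pow_left₀ (by positivity) (le_max_left _ _) _).trans
            (pow_le_pow_right₀ (le_max_right _ _) (by omega))

theorem exists_coeff_X_pow_mul_exp_pow_le_natCast (m : ℕ) {j u D : ℕ} (hjD : j ≤ D) (huj : u ≤ j)
    (hu : 2 ≤ u) :
    ∃ C : ℝ, 0 ≤ C ∧ ∀ i, coeff i (formalLaplace ℝ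
      (PowerSeries.X ^ (m * (j - u)) * PowerSeries.exp ℝ ^ u)) ≤ C * D ^ i := by
  rcases huj.lt_or_eq with huj | rfl
  · exact exists_coeff_X_pow_mul_exp_pow_le _ _ (max_lt (mod_cast huj.trans_le hjD)
      (mod_cast hu.trans (huj.le.trans hjD)))
  · refine ⟨1, zero_le_one, fun i => ?_⟩
    rw [Nat.sub_self, mul_zero, pow_zero, one_mul, coeff_exp_pow, one_mul]
    gcongr

theorem exists_pow_mul_coeff_X_pow_mul_exp_pow_le (m : ℕ) {k j u D : ℕ} (hkj : k ≤ j)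
    (hjD : j ≤ D) (huj : u ≤ j) {B : ℝ} (hB : 1 < B) :
    ∃ C, 0 ≤ C ∧ ∀ a η : ℝ, 0 ≤ a → a ≤ η → η ≤ 1 → ∀ i, m * k < i →
      a ^ j * η ^ u * coeff i (formalLaplace ℝ
        (PowerSeries.X ^ (m * (j - u)) * PowerSeries.exp ℝ ^ u)) ≤
      C * a ^ k * (η * B ^ i + η ^ 2 * D ^ i) := by
  have : 0 < B := one_pos.trans hB
  have hpow {a η : ℝ} (ha : 0 ≤ a) (haη : a ≤ η) (hη : η ≤ 1) : a ^ j ≤ a ^ k :=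
    pow_le_pow_of_le_one ha (haη.trans hη) hkj
  rcases Nat.lt_or_ge u 2 with hu | hu
  · obtain ⟨C, hC, h⟩ := exists_coeff_X_pow_mul_exp_pow_le (m * (j - u)) u (B := B)
      (max_lt (hB.trans_le' (mod_cast Nat.le_of_lt_succ hu)) hB)
    refine ⟨C, hC, fun a η ha haη hη i hi => ?_⟩
    have hη₀ := ha.trans haη
    suffices a ^ j * η ^ u * coeff i (formalLaplace ℝ
        (PowerSeries.X ^ (m * (j - u)) * PowerSeries.exp ℝ ^ u)) ≤ a ^ k * η * (C * B ^ i) by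
      have : 0 ≤ C * a ^ k * (η ^ 2 * D ^ i) := by positivity
      linarith
    by_cases hjk : u = 0 ∧ j = k
    · obtain ⟨rfl, rfl⟩ := hjk
      have hi' : ¬ i = m * j := hi.ne'
      simp only [Nat.sub_zero, pow_zero, mul_one, coeff_formalLaplace, PowerSeries.coeff_X_pow,
        if_neg hi', mul_zero]
      positivity
    · refine mul_le_mul_of_nonneg ?_ (h i) (by positivity) (by positivity)
      rcases Nat.eq_zero_or_pos u with rfl | hu₀
      · calc a ^ j * η ^ 0 ≤ a ^ (k + 1) := by
              rw [pow_zero, mul_one]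
              exact pow_le_pow_of_le_one ha (haη.trans hη) (by omega)
          _ ≤ a ^ k * η := by rw [pow_succ]; gcongr
      · obtain rfl : u = 1 := by omega
        rw [pow_one]
        exact mul_le_mul_of_nonneg_right (hpow ha haη hη) hη₀
  · obtain ⟨C, hC, h⟩ := exists_coeff_X_pow_mul_exp_pow_le_natCast m hjD huj hu
    refine ⟨C, hC, fun a η ha haη hη i _ => ?_⟩
    have hη₀ := ha.trans haη
    calc _ ≤ a ^ k * η ^ 2 * (C * D ^ i) := by
          refine mul_le_mul_of_nonneg ?_ (h i) (by positivity) (by positivity)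
          gcongr ?_ * ?_
          · exact hpow ha haη hη
          · exact pow_le_pow_of_le_one hη₀ hη hu
      _ ≤ _ := by
        have : 0 ≤ C * a ^ k * (η * B ^ i) := by positivity
        linarith

/-- The coefficients of `formalLaplace ℝ F` start with `a > 0` at degree `m` and are bounded
by `a η` afterwards. The condition `a ≤ η` makes higher powers of `F` negligible. -/
structure IsTame (m : ℕ) (a η : ℝ) (F : ℝ⟦X⟧) : Prop where
  pos : 0 < a
  le : a ≤ η
  le_one : η ≤ 1
  leading : HasLeadingTerm F m (a / m !)
  abs_le : ∀ i, 0 < i → |coeff (m + i) (formalLaplace ℝ F)| ≤ a * η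

namespace IsTame

variable {m : ℕ} {a η : ℝ} {F : ℝ⟦X⟧}

theorem abs_coeff_le (h : IsTame m a η F) (i : ℕ) :
    |coeff i F| ≤ coeff i (a • (PowerSeries.X ^ m + η • PowerSeries.exp ℝ)) := by
  have ha := h.pos
  have hη := ha.trans_le h.le
  simp only [map_smul, map_add, PowerSeries.coeff_X_pow, PowerSeries.coeff_exp, smul_eq_mul]
  rcases lt_trichotomy i m with hi | rfl | hi
  · rw [PowerSeries.X_pow_dvd_iff.mp h.leading.1 i hi, abs_zero]
    positivity
  · rw [h.leading.2, abs_of_pos (by positivity), if_pos rfl]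
    calc a / i ! ≤ a := div_le_self ha.le (mod_cast Nat.one_le_iff_ne_zero.mpr i.factorial_ne_zero)
      _ ≤ a * (1 + η * _) := le_mul_of_one_le_right ha.le (le_add_of_nonneg_right (by positivity))
  · obtain ⟨d, rfl⟩ := Nat.exists_eq_add_of_lt hi
    have hle := h.abs_le (d + 1) d.succ_pos
    rw [coeff_formalLaplace, abs_mul, Nat.abs_cast, ← le_div_iff₀' (by positivity)] at hle
    exact hle.trans_eq (by rw [if_neg (by omega)]; simp [add_assoc, field])

theorem exists_abs_coeff_pow_le (m : ℕ) {k j D : ℕ} (hkj : k ≤ j) (hjD : j ≤ D) {B : ℝ}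
    (hB : 1 < B) :
    ∃ C, 0 ≤ C ∧ ∀ a η F, IsTame m a η F → ∀ i, m * k < i →
      |coeff i (formalLaplace ℝ (F ^ j))| ≤ C * a ^ k * (η * B ^ i + η ^ 2 * D ^ i) := by
  choose! C hC h using fun u (hu : u ∈ Finset.range (j + 1)) =>
    exists_pow_mul_coeff_X_pow_mul_exp_pow_le m hkj hjD (Finset.mem_range_succ_iff.mp hu) hB
  refine ⟨∑ u ∈ Finset.range (j + 1), j.choose u * C u, Finset.sum_nonneg fun u hu =>
    mul_nonneg (by positivity) (hC u hu), fun a η F hF i hi => ?_⟩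
  rw [coeff_formalLaplace, abs_mul, Nat.abs_cast]
  calc (i ! : ℝ) * |coeff i (F ^ j)|
      ≤ i ! * coeff i ((a • (PowerSeries.X ^ m + η • PowerSeries.exp ℝ)) ^ j) := by
        gcongr
        exact abs_coeff_pow_le hF.abs_coeff_le j i
    _ = ∑ u ∈ Finset.range (j + 1), j.choose u * (a ^ j * η ^ u * coeff i (formalLaplace ℝ
        (PowerSeries.X ^ (m * (j - u)) * PowerSeries.exp ℝ ^ u))) := by
        rw [smul_pow, add_comm (PowerSeries.X ^ m), add_pow, ← coeff_formalLaplace, map_smul,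
          map_sum, map_smul, map_sum, Finset.smul_sum]
        refine Finset.sum_congr rfl fun u _ => ?_
        rw [smul_pow, ← pow_mul, smul_mul_assoc, smul_mul_assoc, map_smul, map_smul,
          mul_comm (PowerSeries.exp ℝ ^ u), mul_comm _ (j.choose u : ℝ⟦X⟧), ← nsmul_eq_mul,
          map_nsmul, map_nsmul]
        simp only [smul_eq_mul, nsmul_eq_mul]
        ring
    _ ≤ ∑ u ∈ Finset.range (j + 1), j.choose u * (C u * a ^ k * (η * B ^ i + η ^ 2 * D ^ i)) :=
        Finset.sum_le_sum fun u hu => mul_le_mul_of_nonneg_left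
          (h u hu a η hF.pos.le hF.le hF.le_one i hi) (by positivity)
    _ = _ := by
        simp only [Finset.sum_mul, mul_assoc]

theorem exists_abs_coeff_aeval_le (m : ℕ) {k D : ℕ} {p : ℝ[X]} (hk : Polynomial.X ^ k ∣ p)
    (hD : p.natDegree ≤ D) {B : ℝ} (hB : 1 < B) :
    ∃ C, 0 ≤ C ∧ ∀ a η F, IsTame m a η F → ∀ i, m * k < i →
      |coeff i (formalLaplace ℝ (Polynomial.aeval F p))| ≤
        C * a ^ k * (η * B ^ i + η ^ 2 * D ^ i) := by
  choose! C hC h using fun j (hj : j ∈ Finset.Icc k D) =>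
    exists_abs_coeff_pow_le m (Finset.mem_Icc.mp hj).1 (Finset.mem_Icc.mp hj).2 hB
  refine ⟨∑ j ∈ Finset.Icc k D, |p.coeff j| * C j, Finset.sum_nonneg fun j hj =>
    mul_nonneg (abs_nonneg _) (hC j hj), fun a η F hF i hi => ?_⟩
  have hp : Polynomial.aeval F p = ∑ j ∈ Finset.Icc k D, p.coeff j • F ^ j := by
    rw [Polynomial.aeval_eq_sum_range' (Nat.lt_succ_of_le hD)]
    refine (Finset.sum_subset (fun j hj => ?_) fun j hj hj' => ?_).symm
    · exact Finset.mem_range_succ_iff.mpr (Finset.mem_Icc.mp hj).2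
    · rw [Polynomial.X_pow_dvd_iff.mp hk j (by simp at hj hj'; omega), zero_smul]
  rw [hp, map_sum, map_sum, Finset.sum_mul, Finset.sum_mul]
  refine (Finset.abs_sum_le_sum_abs _ _).trans (Finset.sum_le_sum fun j hj => ?_)
  rw [map_smul, map_smul, smul_eq_mul, abs_mul, mul_assoc, mul_assoc, ← mul_assoc (C j)]
  gcongr
  exact h j hj a η F hF i hi

end IsTame

theorem coeff_mul_of_X_pow_dvd {R : Type*} [CommRing R] {P Q : R⟦X⟧} {M N : ℕ}
    (hP : PowerSeries.X ^ M ∣ P) (hQ : PowerSeries.X ^ N ∣ Q) (d : ℕ) :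
    coeff (M + N + d) (P * Q) =
      ∑ p ∈ antidiagonal d, coeff (M + p.1) P * coeff (N + p.2) Q := by
  obtain ⟨U, rfl⟩ := hP
  obtain ⟨V, rfl⟩ := hQ
  rw [show PowerSeries.X ^ M * U * (PowerSeries.X ^ N * V) = PowerSeries.X ^ (M + N) * (U * V) by
    ring, add_comm _ d, PowerSeries.coeff_X_pow_mul, PowerSeries.coeff_mul]
  simp only [add_comm M, add_comm N, PowerSeries.coeff_X_pow_mul]

theorem sum_antidiagonal_pow_mul_pow_le {B n : ℝ} (hB : 0 ≤ B) (hn : B < n) (d : ℕ) :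
    ∑ p ∈ antidiagonal d, B ^ p.1 * n ^ p.2 ≤ n / (n - B) * n ^ d := by
  have hgeom := geom_sum₂_mul B n (d + 1)
  rw [Finset.Nat.sum_antidiagonal_eq_sum_range_succ fun i j => B ^ i * n ^ j]
  rw [div_mul_eq_mul_div, le_div_iff₀ (sub_pos.mpr hn)]
  have := pow_nonneg hB (d + 1)
  simp only [Nat.add_sub_cancel, Nat.succ_eq_add_one, pow_succ] at hgeom this ⊢
  linarith

theorem eventually_le_linearizationFactor (r m : ℕ) {l : ℕ} (hl : 0 < l) :
    ∀ᶠ d : ℕ in Filter.atTop,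
      ((m + d)! * (l + 1) ^ d / 2 : ℝ) ≤ linearizationFactor r l m d := by
  have hn : (1 : ℝ) < l + 1 := by simpa using hl
  have hlim := (tendsto_pow_const_div_const_pow_of_one_lt (m * r) hn).comp
    (Filter.tendsto_add_atTop_nat (m * (r + 1)))
  have hpos : (0 : ℝ) < 1 / (2 * (l + 1) * (l + 1) ^ (m * (r + 1))) := by positivity
  filter_upwards [hlim.eventually_le_const hpos] with d hd
  have hpow : (l + 1 : ℝ) * (d + m * (r + 1) : ℕ) ^ (m * r) ≤ (l + 1) ^ d / 2 := by
    rw [Function.comp_apply, div_le_iff₀ (by positivity), pow_add] at hd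
    calc _ ≤ (l + 1 : ℝ) * (1 / (2 * (l + 1) * (l + 1) ^ (m * (r + 1))) *
          ((l + 1) ^ d * (l + 1) ^ (m * (r + 1)))) := by gcongr
      _ = _ := by field_simp
  have hfact : ((m * (r + 1) + d)! : ℝ) ≤ (m + d)! * (d + m * (r + 1) : ℕ) ^ (m * r) := by
    rw [show m * (r + 1) + d = m + d + m * r by ring, ← Nat.factorial_mul_ascFactorial]
    have := Nat.ascFactorial_le_pow_add (m + d) (m * r)
    rw [show m + d + m * r = d + m * (r + 1) by ring] at this
    exact mod_cast Nat.mul_le_mul_left _ this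
  have hmain : ((m + d)! * (l + 1) ^ d : ℝ) ≤ (m * r)! * (m + d)! * (l + 1) ^ (m + d) := by
    have h₁ : (1 : ℝ) ≤ (m * r)! := mod_cast Nat.succ_le_of_lt (Nat.factorial_pos _)
    have h₂ : (l + 1 : ℝ) ^ d ≤ (l + 1) ^ (m + d) := pow_le_pow_right₀ hn.le (by omega)
    calc ((m + d)! * (l + 1) ^ d : ℝ) ≤ 1 * (m + d)! * (l + 1) ^ (m + d) := by
          rw [one_mul]; gcongr
      _ ≤ _ := by gcongr
  have hmid : (0 : ℝ) ≤ r * ((m * r + d)! * m ! * (l + 1) ^ m) := by positivity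
  have hsub := mul_le_mul_of_nonneg_left hpow (Nat.cast_nonneg (α := ℝ) (m + d)!)
  have hsub' := mul_le_mul_of_nonneg_left hfact (zero_lt_one.trans hn).le
  rw [linearizationFactor]
  push_cast at hsub hsub' ⊢
  linarith

namespace IsTame

theorem exists_abs_coeff_mul_add_aeval_le (m : ℕ) {k D : ℕ} {p : ℝ[X]} (hk : Polynomial.X ^ k ∣ p)
    (hD : p.natDegree ≤ D) {B : ℝ} (hB : 1 < B) (hDB : D ≤ B) :
    ∃ C, 0 ≤ C ∧ ∀ a η F, IsTame m a η F → ∀ i, 0 < i →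
      |coeff (m * k + i) (formalLaplace ℝ (Polynomial.aeval F p))| ≤ C * a ^ k * (η * B ^ i) := by
  have := one_pos.trans hB
  obtain ⟨C, hC, h⟩ := exists_abs_coeff_aeval_le m hk hD hB
  refine ⟨2 * C * B ^ (m * k), by positivity, fun a η F hF i hi => ?_⟩
  have ha := hF.pos
  have hη := ha.trans_le hF.le
  calc _ ≤ C * a ^ k * (η * B ^ (m * k + i) + η ^ 2 * D ^ (m * k + i)) :=
        h a η F hF _ (Nat.lt_add_of_pos_right hi)
    _ ≤ C * a ^ k * (η * B ^ (m * k + i) + η * B ^ (m * k + i)) := by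
        have := pow_le_of_le_one hη.le hF.le_one two_ne_zero
        gcongr
    _ = 2 * C * B ^ (m * k) * a ^ k * (η * B ^ i) := by ring

theorem abs_coeff_add_le {m : ℕ} {a η : ℝ} {F : ℝ⟦X⟧} (h : IsTame m a η F) (i : ℕ) :
    |coeff (m + i) (formalLaplace ℝ F)| ≤ a * (η + if i = 0 then 1 else 0) := by
  have ha := h.pos
  rcases Nat.eq_zero_or_pos i with rfl | hi
  · have hm : (m ! : ℝ) ≠ 0 := by positivity
    rw [if_pos rfl, add_zero, coeff_formalLaplace, h.leading.2, mul_div_cancel₀ _ hm,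
      abs_of_pos ha]
    exact le_mul_of_one_le_right ha.le (le_add_of_nonneg_left (ha.le.trans h.le))
  · rw [if_neg hi.ne', add_zero]
    exact h.abs_le i hi

theorem abs_coeff_mul_coeff_rescale_le {m k N d : ℕ} {a η C B n : ℝ} {F G : ℝ⟦X⟧}
    (hF : IsTame m a η F) (hC : 0 ≤ C) (hB : 0 < B) (hn : 0 < n)
    (hG : ∀ i, 0 < i → |coeff (N + i) G| ≤ C * a ^ k * (η * B ^ i)) (hd : coeff (m + d) F = 0)
    {q : ℕ × ℕ} (hq : q ∈ antidiagonal d) :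
    |coeff (N + q.1) G * coeff (m + q.2) (rescale n (formalLaplace ℝ F))| ≤
      C * n ^ m * a ^ (k + 1) *
        (η ^ 2 * (B ^ q.1 * n ^ q.2) + if q = (d, 0) then η * B ^ d else 0) := by
  have ha := hF.pos
  have hη := ha.trans_le hF.le
  obtain rfl := Finset.HasAntidiagonal.mem_antidiagonal.mp hq
  rcases Nat.eq_zero_or_pos q.1 with hq₁ | hq₁
  · rw [hq₁, zero_add] at hd
    rw [PowerSeries.coeff_rescale, coeff_formalLaplace F, hd, mul_zero, mul_zero, mul_zero,
      abs_zero]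
    split_ifs <;> positivity
  · rw [abs_mul, PowerSeries.coeff_rescale, abs_mul, abs_of_pos (pow_pos hn _)]
    calc _ ≤ C * a ^ k * (η * B ^ q.1) * (n ^ (m + q.2) * _) :=
          mul_le_mul_of_nonneg_right (hG q.1 hq₁) (by positivity)
      _ ≤ C * a ^ k * (η * B ^ q.1) *
          (n ^ (m + q.2) * (a * (η + if q.2 = 0 then 1 else 0))) := by
        gcongr
        exact hF.abs_coeff_add_le q.2
      _ = _ := by
        rcases Nat.eq_zero_or_pos q.2 with hq₂ | hq₂
        · rw [if_pos hq₂, if_pos (by ext <;> simp [hq₂]), hq₂]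
          ring
        · rw [if_neg hq₂.ne', if_neg fun hq' => hq₂.ne' (congrArg Prod.snd hq')]
          ring

theorem exists_abs_coeff_mul_rescale_le {m k D : ℕ} (hm : 0 < m) {p : ℝ[X]}
    (hk : Polynomial.X ^ k ∣ p) (hD : p.natDegree ≤ D) {B n : ℝ} (hB : 1 < B) (hDB : D ≤ B)
    (hn : B < n) :
    ∃ C, 0 ≤ C ∧ ∀ a η F, IsTame m a η F → ∀ d, coeff (m + d) F = 0 →
      |coeff (m * (k + 1) + d)
        (formalLaplace ℝ (Polynomial.aeval F p) * rescale n (formalLaplace ℝ F))| ≤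
        C * a ^ (k + 1) * (η * B ^ d + η ^ 2 * n ^ d) := by
  have hB₀ := one_pos.trans hB
  have hn₀ := hB₀.trans hn
  have := sub_pos.mpr hn
  obtain ⟨C, hC, h⟩ := exists_abs_coeff_mul_add_aeval_le m hk hD hB hDB
  refine ⟨C * n ^ m * (1 + n / (n - B)), by positivity, fun a η F hF d hd => ?_⟩
  have ha := hF.pos
  have hη := ha.trans_le hF.le
  have hG := (hF.leading.aeval hm hk).formalLaplace.1
  have hterm (q : ℕ × ℕ) (hq : q ∈ antidiagonal d) :=
    hF.abs_coeff_mul_coeff_rescale_le hC hB₀ hn₀ (h a η F hF) hd hq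
  have hgeom := sum_antidiagonal_pow_mul_pow_le hB₀.le hn d
  rw [mul_add_one, coeff_mul_of_X_pow_dvd hG (hF.leading.formalLaplace.rescale n).1]
  calc _ ≤ _ := Finset.abs_sum_le_sum_abs _ _
    _ ≤ _ := Finset.sum_le_sum hterm
    _ ≤ C * n ^ m * a ^ (k + 1) * (η ^ 2 * (n / (n - B) * n ^ d) + η * B ^ d) := by
      rw [← Finset.mul_sum, Finset.sum_add_distrib, ← Finset.mul_sum, Finset.sum_ite_eq',
        if_pos (by simp)]
      gcongr
    _ ≤ _ := by
      have : 0 ≤ C * n ^ m * a ^ (k + 1) * (η ^ 2 * n ^ d + n / (n - B) * (η * B ^ d)) := by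
        positivity
      linarith

theorem exists_abs_coeff_laplaceDefect_le {m r l : ℕ} (hm : 0 < m) (hl : 0 < l) {B : ℝ}
    (hB : 1 < B) (hlB : l ≤ B) (hBl : B < l + 1) :
    ∃ C, 0 ≤ C ∧ ∀ a η F, IsTame m a η F → ∀ d, 0 < d → coeff (m + d) F = 0 →
      |coeff (m * (r + 1) + d) (laplaceDefect r l F)| ≤
        C * a ^ (r + 1) * (η * B ^ d + η ^ 2 * (l + 1 : ℝ) ^ d) := by
  have : (0 : ℝ) < l + 1 := by positivity
  obtain ⟨C, hC, h⟩ := exists_abs_coeff_mul_rescale_le hm (X_pow_dvd_binomTail (R := ℝ) r l)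
    (natDegree_binomTail_le r l) hB hlB hBl
  obtain ⟨C', hC', h'⟩ := exists_abs_coeff_aeval_le m
    (X_pow_dvd_binomTail (R := ℝ) (r + 1) (l + 1)) (natDegree_binomTail_le (r + 1) (l + 1)) hB
  have : B ≤ l + 1 := hBl.le
  refine ⟨C + C' * (l + 1) ^ (m * (r + 1)), by positivity, fun a η F hF d hd hcoeff => ?_⟩
  have ha := hF.pos
  have hη := ha.trans_le hF.le
  have h₁ := h a η F hF d hcoeff
  have h₂ := h' a η F hF (m * (r + 1) + d) (Nat.lt_add_of_pos_right hd)
  have h₃ : η * B ^ (m * (r + 1) + d) + η ^ 2 * (l + 1 : ℕ) ^ (m * (r + 1) + d) ≤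
      (l + 1) ^ (m * (r + 1)) * (η * B ^ d + η ^ 2 * (l + 1 : ℝ) ^ d) := by
    have : B ^ (m * (r + 1)) ≤ (l + 1) ^ (m * (r + 1)) := by gcongr
    have := mul_le_mul_of_nonneg_left this (show 0 ≤ η * B ^ d by positivity)
    push_cast
    simp only [pow_add]
    linarith
  rw [laplaceDefect, map_sub]
  calc _ ≤ _ := abs_sub _ _
    _ ≤ C * a ^ (r + 1) * (η * B ^ d + η ^ 2 * (l + 1 : ℝ) ^ d) + C' * a ^ (r + 1) *
        ((l + 1) ^ (m * (r + 1)) * (η * B ^ d + η ^ 2 * (l + 1 : ℝ) ^ d)) :=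
      add_le_add h₁ (h₂.trans (by gcongr))
    _ = _ := by ring

theorem trunc {F : ℝ⟦X⟧} {m d : ℕ} {a η : ℝ} (ha : 0 < a) (haη : a ≤ η) (hη : η ≤ 1)
    (hF : HasLeadingTerm F m (a / m !)) (hd : 0 < d)
    (h : ∀ i, 0 < i → i < d → |coeff (m + i) (formalLaplace ℝ F)| ≤ a * η) :
    IsTame m a η (F.trunc (m + d) : ℝ⟦X⟧) where
  pos := ha
  le := haη
  le_one := hη
  leading := by
    refine ⟨PowerSeries.X_pow_dvd_iff.mpr fun i hi => ?_, ?_⟩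
    · rw [Polynomial.coeff_coe, PowerSeries.coeff_trunc, if_pos (by omega),
        PowerSeries.X_pow_dvd_iff.mp hF.1 i hi]
    · rw [Polynomial.coeff_coe, PowerSeries.coeff_trunc, if_pos (by omega), hF.2]
  abs_le i hi := by
    rw [coeff_formalLaplace, Polynomial.coeff_coe, PowerSeries.coeff_trunc]
    split_ifs with hid
    · rw [← coeff_formalLaplace]
      exact h i hi (by omega)
    · rw [mul_zero, abs_zero]
      exact mul_nonneg ha.le (ha.le.trans haη)

end IsTame

theorem hasLeadingTerm_sub_trunc {R : Type*} [CommRing R] (F : R⟦X⟧) (N : ℕ) :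
    HasLeadingTerm (F - (F.trunc N : R⟦X⟧)) N (coeff N F) := by
  refine ⟨PowerSeries.X_pow_dvd_iff.mpr fun i hi => ?_, ?_⟩ <;>
    rw [map_sub, Polynomial.coeff_coe, PowerSeries.coeff_trunc]
  · rw [if_pos hi, sub_self]
  · rw [if_neg N.lt_irrefl, sub_zero]

theorem exists_abs_coeff_le_of_trunc {m r l : ℕ} (hm : 0 < m) (hr : 0 < r) (hrl : r ≤ l) {B : ℝ}
    (hB : 1 < B) (hlB : l ≤ B) (hBl : B < l + 1) :
    ∃ C, 0 ≤ C ∧ ∀ᶠ d : ℕ in Filter.atTop, ∀ (a η : ℝ) (F : ℝ⟦X⟧), 0 < a → a ≤ η → η ≤ 1 →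
      HasLeadingTerm F m (a / m !) → laplaceDefect r l F = 0 →
      (∀ i, 0 < i → i < d → |coeff (m + i) (formalLaplace ℝ F)| ≤ a * η) →
      |coeff (m + d) (formalLaplace ℝ F)| ≤ C * a * (η * (B / (l + 1)) ^ d + η ^ 2) := by
  have hl := hr.trans_le hrl
  obtain ⟨C, hC, h⟩ := IsTame.exists_abs_coeff_laplaceDefect_le hm (r := r) hl hB hlB hBl
  refine ⟨2 * C * m ! ^ r, by positivity, ?_⟩
  filter_upwards [eventually_le_linearizationFactor r m hl, Filter.eventually_gt_atTop 0]
    with d hΛ hd a η F ha haη hη hF hdef hbound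
  have htame := IsTame.trunc ha haη hη hF hd hbound
  have hle := h a η _ htame d hd (by
    rw [Polynomial.coeff_coe, PowerSeries.coeff_trunc, if_neg (lt_irrefl _)])
  have hlead := (hasLeadingTerm_laplaceDefect_sub htame.leading hm hd
    (hasLeadingTerm_sub_trunc F (m + d)) hr (l := l)).2
  rw [hdef, zero_sub, map_neg, neg_eq_iff_eq_neg] at hlead
  have hchoose : (1 : ℝ) ≤ l.choose r := mod_cast Nat.choose_pos hrl
  have hΛ₀ := hΛ.trans' (by positivity)
  rw [hlead, abs_neg, abs_mul, abs_mul, abs_of_nonneg hΛ₀, abs_of_pos (by positivity)] at hle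
  rw [coeff_formalLaplace, abs_mul, Nat.abs_cast]
  set δ := |coeff (m + d) F|
  have hδ : (a / m !) ^ r * δ * ((m + d)! * (l + 1) ^ d / 2) ≤
      C * a ^ (r + 1) * (η * B ^ d + η ^ 2 * (l + 1 : ℝ) ^ d) := by
    refine hle.trans' ?_
    gcongr
    exact le_mul_of_one_le_left (by positivity) hchoose
  rw [div_pow] at hδ
  rw [div_pow]
  rw [← mul_le_mul_iff_right₀ (show 0 < a ^ r * (l + 1 : ℝ) ^ d / (2 * m ! ^ r) by positivity)]
  refine (Eq.le ?_).trans (hδ.trans_eq ?_)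
  · ring
  · field_simp
    ring

theorem IsTame.abs_coeff_le_one {m : ℕ} {a η : ℝ} {F : ℝ⟦X⟧} (h : IsTame m a η F) (i : ℕ) :
    |coeff i (formalLaplace ℝ F)| ≤ 1 := by
  have ha₁ := h.le.trans h.le_one
  rcases lt_trichotomy i m with hi | rfl | hi
  · rw [PowerSeries.X_pow_dvd_iff.mp h.leading.formalLaplace.1 i hi, abs_zero]
    exact zero_le_one
  · rwa [h.leading.formalLaplace.2, mul_div_cancel₀ _ (by positivity), abs_of_pos h.pos]
  · obtain ⟨d, rfl⟩ := Nat.exists_eq_add_of_lt hi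
    exact (h.abs_le _ d.succ_pos).trans (mul_le_one₀ ha₁ (h.pos.le.trans h.le) h.le_one)

theorem exists_pow_mul_le {m : ℕ} (hm : 0 < m) (x : ℝ) (c : ℕ → ℝ) {ε δ : ℝ} (hε : 0 < ε)
    (hδ : 0 < δ) (d : ℕ) :
    ∃ t > (0 : ℝ), t ^ m * x ≤ ε ∧ ∀ i ∈ Finset.Ioo 0 d, t ^ i * c i ≤ δ := by
  have hlim {i : ℕ} (hi : 0 < i) (x : ℝ) :
      Filter.Tendsto (fun t : ℝ => t ^ i * x) (nhdsWithin 0 (Set.Ioi 0)) (nhds 0) := by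
    have : Continuous fun t : ℝ => t ^ i * x := by fun_prop
    simpa [hi.ne'] using (this.tendsto 0).mono_left nhdsWithin_le_nhds
  exact (eventually_mem_nhdsWithin.and (((hlim hm x).eventually_le_const hε).and
    ((Finset.eventually_all _).mpr fun i hi =>
      (hlim (Finset.mem_Ioo.mp hi).1 (c i)).eventually_le_const hδ))).exists

theorem exists_isTame_rescale {F : ℝ⟦X⟧} {m r l : ℕ} {e : ℝ} (hm : 0 < m) (hr : 0 < r)
    (hrl : r ≤ l) (hF : HasLeadingTerm F m e) (he : 0 < e) (hdef : laplaceDefect r l F = 0) :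
    ∃ t > 0, ∃ a η, IsTame m a η (rescale t F) := by
  have hl : (1 : ℝ) ≤ l := mod_cast hr.trans_le hrl
  obtain ⟨C, hC, hC'⟩ := exists_abs_coeff_le_of_trunc hm hr hrl (B := l + 1 / 2)
    (by linarith) (by linarith) (by linarith)
  have hratio : Filter.Tendsto (fun d : ℕ => C * ((l + 1 / 2) / (l + 1) : ℝ) ^ d) Filter.atTop
      (nhds 0) := by
    simpa using (tendsto_pow_atTop_nhds_zero_of_lt_one (by positivity)
      (by rw [div_lt_one (by positivity)]; linarith)).const_mul C
  obtain ⟨d₀, hd₀⟩ := (hC'.and (hratio.eventually_le_const one_half_pos)).exists_forall_of_atTop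
  set η : ℝ := 1 / (2 * (C + 1)) with hη
  have hη₀ : 0 < η := by positivity
  have hη₁ : η ≤ 1 := (div_le_one (by positivity)).mpr (by linarith)
  have hCη : C * η ≤ 1 / 2 := by
    rw [hη, mul_one_div, div_le_div_iff₀ (by positivity) two_pos]
    linarith
  obtain ⟨t, ht, hta, htη⟩ := exists_pow_mul_le hm (m ! * e)
    (fun i => |coeff (m + i) (formalLaplace ℝ F)|) hη₀ (show 0 < m ! * e * η by positivity) d₀
  have hlead : HasLeadingTerm (rescale t F) m (t ^ m * (m ! * e) / m !) := by
    convert hF.rescale t using 1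
    field_simp
  refine ⟨t, ht, t ^ m * (m ! * e), η, by positivity, hta, hη₁, hlead, fun i => ?_⟩
  induction i using Nat.strong_induction_on with
  | _ i ih =>
    intro hi
    rcases lt_or_ge i d₀ with hid | hid
    · have hti := mul_le_mul_of_nonneg_left (htη i (Finset.mem_Ioo.mpr ⟨hi, hid⟩))
        (pow_pos ht m).le
      rw [coeff_formalLaplace, PowerSeries.coeff_rescale, mul_left_comm, ← coeff_formalLaplace,
        abs_mul, abs_of_pos (by positivity), pow_add]
      linarith
    · obtain ⟨hstep, hdecay⟩ := hd₀ i hid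
      refine (hstep _ η _ (by positivity) hta hη₁ hlead
        (by rw [laplaceDefect_rescale, hdef, map_zero]) fun j hj hji => ih j hji hj).trans ?_
      have hmain := mul_le_mul_of_nonneg_left (add_le_add hdecay hCη)
        (show 0 ≤ t ^ m * (m ! * e) * η by positivity)
      linarith

theorem exists_abs_coeff_formalLaplace_le {F : ℝ⟦X⟧} {m r l : ℕ} {e : ℝ} (hm : 0 < m) (hr : 0 < r)
    (hrl : r ≤ l) (hF : HasLeadingTerm F m e) (he : 0 < e) (hdef : laplaceDefect r l F = 0) :
    ∃ A > 0, ∀ i, |coeff i (formalLaplace ℝ F)| ≤ A ^ i := by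
  obtain ⟨t, ht, a, η, h⟩ := exists_isTame_rescale hm hr hrl hF he hdef
  refine ⟨t⁻¹, inv_pos.mpr ht, fun i => ?_⟩
  have hi := h.abs_coeff_le_one i
  rw [coeff_formalLaplace, PowerSeries.coeff_rescale, mul_left_comm, ← coeff_formalLaplace,
    abs_mul, abs_of_pos (pow_pos ht i)] at hi
  rwa [inv_pow, ← one_div, le_div_iff₀' (pow_pos ht i)]

end Growth

/-! ### Laplace transforms and Watson's lemma -/

section LaplaceTransform

variable {ρ : Measure ℝ} [IsProbabilityMeasure ρ]

theorem measureReal_Ioi_eq_one_sub_cdf (ρ : Measure ℝ) [IsProbabilityMeasure ρ] (x : ℝ) :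
    ρ.real (Set.Ioi x) = 1 - cdf ρ x := by
  rw [cdf_eq_real, ← Set.compl_Iic, probReal_compl_eq_one_sub measurableSet_Iic]

theorem abs_cdf_le_one (ρ : Measure ℝ) (x : ℝ) : |cdf ρ x| ≤ 1 := by
  rw [abs_of_nonneg (cdf_nonneg ρ x)]
  exact cdf_le_one ρ x

theorem ae_pos_of_cdf_zero (h : cdf ρ 0 = 0) : ∀ᵐ x ∂ρ, 0 < x := by
  rw [cdf_eq_real, measureReal_eq_zero_iff] at h
  filter_upwards [measure_eq_zero_iff_ae_notMem.mp h] with x hx using not_le.mp hx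

theorem integral_sub_eq_integral_one_sub_cdf_smul {E : Type*} [NormedAddCommGroup E]
    [NormedSpace ℝ E] [CompleteSpace E] (h : cdf ρ 0 = 0) {g g' : ℝ → E}
    (hg : ∀ x, HasDerivAt g (g' x) x) (hg' : Continuous g')
    (hInt : IntegrableOn (fun x => (1 - cdf ρ x) • g' x) (Set.Ioi 0)) :
    ∫ x, (g x - g 0) ∂ρ = ∫ x in Set.Ioi 0, (1 - cdf ρ x) • g' x := by
  have hinner (t : ℝ) (e : E) : ∫ x, (Set.Ioi t).indicator (fun _ => e) x ∂ρ =
      (1 - cdf ρ t) • e := by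
    rw [integral_indicator measurableSet_Ioi, setIntegral_const, measureReal_Ioi_eq_one_sub_cdf]
  have hmeas : AEStronglyMeasurable (Function.uncurry fun t x : ℝ =>
      (Set.Ioi t).indicator (fun _ => g' t) x) ((volume.restrict (Set.Ioi 0)).prod ρ) := by
    have : (Function.uncurry fun t x : ℝ => (Set.Ioi t).indicator (fun _ => g' t) x) =
        {p : ℝ × ℝ | p.1 < p.2}.indicator fun p => g' p.1 := by
      ext p; simp [Set.indicator_apply, Function.uncurry]
    rw [this]
    exact ((hg'.comp continuous_fst).stronglyMeasurable.indicator
      (measurableSet_lt measurable_fst measurable_snd)).aestronglyMeasurable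
  have hprod : Integrable (Function.uncurry fun t x : ℝ => (Set.Ioi t).indicator (fun _ => g' t) x)
      ((volume.restrict (Set.Ioi 0)).prod ρ) := by
    rw [integrable_prod_iff hmeas]
    refine ⟨.of_forall fun t => (integrable_const (g' t)).indicator measurableSet_Ioi,
      hInt.norm.congr (.of_forall fun t => ?_)⟩
    have := integral_indicator_const (μ := ρ) ‖g' t‖ (measurableSet_Ioi (a := t))
    rw [measureReal_Ioi_eq_one_sub_cdf] at this
    simp only [Function.uncurry, norm_indicator_eq_indicator_norm, norm_smul, this,
      Real.norm_of_nonneg (sub_nonneg.mpr (cdf_le_one ρ t)), smul_eq_mul]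
  simp only [← hinner]
  rw [integral_integral_swap hprod]
  refine integral_congr_ae ?_
  filter_upwards [ae_pos_of_cdf_zero h] with x hx
  rw [← intervalIntegral.integral_eq_sub_of_hasDerivAt (fun y _ => hg y)
    (hg'.intervalIntegrable 0 x), intervalIntegral.integral_of_le hx.le,
    integral_Ioc_eq_integral_Ioo, ← Set.Ioi_inter_Iio, ← setIntegral_indicator measurableSet_Iio]
  simp only [Set.indicator_apply, Set.mem_Iio, Set.mem_Ioi]

theorem integral_exp_neg_mul_Ioi {s : ℝ} (hs : 0 < s) :
    ∫ x in Set.Ioi 0, s * Real.exp (-s * x) = 1 := by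
  rw [integral_const_mul, integral_exp_mul_Ioi (neg_lt_zero.mpr hs)]
  simp [hs.ne']

theorem integrable_exp_neg_mul (h : cdf ρ 0 = 0) {s : ℝ} (hs : 0 ≤ s) :
    Integrable (fun x => Real.exp (-s * x)) ρ := by
  refine .of_bound (by fun_prop) 1 ?_
  filter_upwards [ae_pos_of_cdf_zero h] with x hx
  rw [Real.norm_of_nonneg (Real.exp_nonneg _), Real.exp_le_one_iff]
  nlinarith

theorem integrableOn_exp_neg_mul_cdf (ρ : Measure ℝ) {s : ℝ} (hs : 0 < s) :
    IntegrableOn (fun x => s * Real.exp (-s * x) * cdf ρ x) (Set.Ioi 0) :=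
  ((integrableOn_exp_mul_Ioi (neg_lt_zero.mpr hs) 0).const_mul s).mul_bdd (c := 1)
    (monotone_cdf ρ).measurable.aestronglyMeasurable (.of_forall (abs_cdf_le_one ρ))

theorem mgf_neg_eq_integral_cdf (h : cdf ρ 0 = 0) {s : ℝ} (hs : 0 < s) :
    mgf id ρ (-s) = ∫ x in Set.Ioi 0, s * Real.exp (-s * x) * cdf ρ x := by
  have hderiv (x : ℝ) : HasDerivAt (fun x => Real.exp (-s * x)) (-(s * Real.exp (-s * x))) x := by
    simpa [mul_comm] using ((hasDerivAt_id x).const_mul (-s)).exp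
  have hexp : IntegrableOn (fun x => s * Real.exp (-s * x)) (Set.Ioi 0) :=
    (integrableOn_exp_mul_Ioi (neg_lt_zero.mpr hs) 0).const_mul s
  have hcdf := integrableOn_exp_neg_mul_cdf ρ hs
  have hdiff (x : ℝ) : (1 - cdf ρ x) • -(s * Real.exp (-s * x)) =
      s * Real.exp (-s * x) * cdf ρ x - s * Real.exp (-s * x) := by
    rw [smul_eq_mul]; ring
  have hparts := integral_sub_eq_integral_one_sub_cdf_smul h hderiv (by fun_prop)
    (by simpa only [hdiff] using! hcdf.sub hexp)
  simp only [hdiff] at hparts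
  rw [integral_sub hcdf hexp, integral_exp_neg_mul_Ioi hs,
    integral_sub (integrable_exp_neg_mul h hs.le) (by simp)] at hparts
  simpa [mgf] using hparts

end LaplaceTransform

open Filter Asymptotics
open scoped Topology

/-- `g` is the sum of the power series `P` on the positive half-line. -/
def HasExpansion (g : ℝ → ℝ) (P : ℝ⟦X⟧) : Prop :=
  ∀ x, 0 < x → HasSum (fun i => coeff i P * x ^ i) (g x)

namespace HasExpansion

variable {f g : ℝ → ℝ} {P Q : ℝ⟦X⟧}

theorem const (a : ℝ) : HasExpansion (fun _ => a) (PowerSeries.C a) := fun x _ => by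
  convert hasSum_single (f := fun i => coeff i (PowerSeries.C a) * x ^ i) 0 fun i hi => ?_
  · simp
  · rw [PowerSeries.coeff_C, if_neg hi, zero_mul]

theorem add (hf : HasExpansion f P) (hg : HasExpansion g Q) :
    HasExpansion (fun x => f x + g x) (P + Q) := fun x hx => by
  simpa only [map_add, add_mul] using (hf x hx).add (hg x hx)

theorem mul (hf : HasExpansion f P) (hg : HasExpansion g Q) :
    HasExpansion (fun x => f x * g x) (P * Q) := fun x hx => by
  have hterm (i : ℕ) : coeff i (P * Q) * x ^ i =
      ∑ q ∈ antidiagonal i, coeff q.1 P * x ^ q.1 * (coeff q.2 Q * x ^ q.2) := by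
    rw [PowerSeries.coeff_mul, Finset.sum_mul]
    refine Finset.sum_congr rfl fun q hq => ?_
    rw [← Finset.HasAntidiagonal.mem_antidiagonal.mp hq, pow_add]
    ring
  simp only [hterm]
  rw [← (hf x hx).tsum_eq, ← (hg x hx).tsum_eq,
    tsum_mul_tsum_eq_tsum_sum_antidiagonal_of_summable_norm
      (hf x hx).summable.norm (hg x hx).summable.norm]
  exact (summable_norm_sum_mul_antidiagonal_of_summable_norm (hf x hx).summable.norm
    (hg x hx).summable.norm).of_norm.hasSum

theorem aeval (hf : HasExpansion f P) (p : ℝ[X]) :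
    HasExpansion (fun x => p.eval (f x)) (Polynomial.aeval P p) := by
  induction p using Polynomial.induction_on with
  | C a => simpa using! const a
  | add p q hp hq => simpa using hp.add hq
  | monomial n a h => simpa [pow_succ, mul_assoc] using h.mul hf

theorem exists_abs_sub_le (hf : HasExpansion f P) (hf₁ : ∀ x, |f x| ≤ 1) (N : ℕ) :
    ∃ K, ∀ x, 0 < x → |f x - (P.trunc N).eval x| ≤ K * x ^ N := by
  have hsum := (hf 1 one_pos).summable.norm
  simp only [one_pow, mul_one] at hsum
  have hnonneg (i : ℕ) : 0 ≤ ‖coeff i P‖ := norm_nonneg _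
  refine ⟨1 + ∑' i, ‖coeff i P‖, fun x hx => ?_⟩
  have htrunc : (P.trunc N).eval x = ∑ i ∈ Finset.range N, coeff i P * x ^ i :=
    PowerSeries.eval₂_trunc_eq_sum_range x (RingHom.id ℝ) N P
  have htail := (hasSum_nat_add_iff' N).mpr (hf x hx)
  rcases le_total x 1 with hx₁ | hx₁
  · rw [htrunc, ← Real.norm_eq_abs, ← htail.tsum_eq]
    calc ‖∑' i, coeff (i + N) P * x ^ (i + N)‖ ≤ ∑' i, ‖coeff (i + N) P * x ^ (i + N)‖ :=
          norm_tsum_le_tsum_norm htail.summable.norm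
      _ ≤ ∑' i, ‖coeff (i + N) P‖ * x ^ N := by
          refine htail.summable.norm.tsum_le_tsum (fun i => ?_)
            (((summable_nat_add_iff N).mpr hsum).mul_right _)
          rw [norm_mul, norm_pow, Real.norm_of_nonneg hx.le]
          gcongr ?_ * ?_
          exact pow_le_pow_of_le_one hx.le hx₁ (Nat.le_add_left N i)
      _ = (∑' i, ‖coeff (i + N) P‖) * x ^ N := tsum_mul_right
      _ ≤ (1 + ∑' i, ‖coeff i P‖) * x ^ N := by
          gcongr
          have := hsum.sum_add_tsum_nat_add N
          linarith [Finset.sum_nonneg fun i (_ : i ∈ Finset.range N) => hnonneg i]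
  · rw [htrunc]
    calc _ ≤ |f x| + |∑ i ∈ Finset.range N, coeff i P * x ^ i| := abs_sub _ _
      _ ≤ 1 * x ^ N + ∑ i ∈ Finset.range N, ‖coeff i P‖ * x ^ N := by
          refine add_le_add ((hf₁ x).trans (by simpa using one_le_pow₀ hx₁))
            ((Finset.abs_sum_le_sum_abs _ _).trans (Finset.sum_le_sum fun i hi => ?_))
          rw [abs_mul, abs_pow, abs_of_pos hx, Real.norm_eq_abs]
          gcongr
          exact (Finset.mem_range.mp hi).le
      _ ≤ _ := by
          rw [← Finset.sum_mul, ← add_mul]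
          gcongr
          exact hsum.sum_le_tsum _ fun i _ => hnonneg i

end HasExpansion

/-- `P` is an asymptotic power series of `g` at `0` from the right. -/
def HasAsymptoticSeries (g : ℝ → ℝ) (P : ℝ⟦X⟧) : Prop :=
  ∀ N : ℕ, ∃ p : ℝ[X], PowerSeries.X ^ N ∣ P - (p : ℝ⟦X⟧) ∧
    (fun w => g w - p.eval w) =O[𝓝[>] 0] fun w => w ^ N

namespace HasAsymptoticSeries

variable {f g : ℝ → ℝ} {P Q : ℝ⟦X⟧}

theorem sub (hf : HasAsymptoticSeries f P) (hg : HasAsymptoticSeries g Q) :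
    HasAsymptoticSeries (fun w => f w - g w) (P - Q) := fun N => by
  obtain ⟨p, hp, hfp⟩ := hf N
  obtain ⟨q, hq, hgq⟩ := hg N
  refine ⟨p - q, ?_, (hfp.sub hgq).congr_left fun w => ?_⟩
  · convert dvd_sub hp hq using 1
    push_cast
    ring
  · rw [Polynomial.eval_sub]
    ring

theorem mul (hf : HasAsymptoticSeries f P) (hg : HasAsymptoticSeries g Q) :
    HasAsymptoticSeries (fun w => f w * g w) (P * Q) := fun N => by
  obtain ⟨p, hp, hfp⟩ := hf N
  obtain ⟨q, hq, hgq⟩ := hg N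
  have hone (p : ℝ[X]) : (fun w => p.eval w) =O[𝓝[>] 0] fun _ => (1 : ℝ) :=
    (p.continuous.tendsto 0).isBigO_one ℝ |>.mono nhdsWithin_le_nhds
  have hpow : (fun w : ℝ => w ^ N) =O[𝓝[>] 0] fun _ => (1 : ℝ) := by
    simpa using hone (Polynomial.X ^ N)
  have hf₁ : f =O[𝓝[>] 0] fun _ => (1 : ℝ) := by
    simpa using (hfp.trans hpow).add (hone p)
  refine ⟨p * q, ?_, ?_⟩
  · convert dvd_add (hp.mul_right Q) (hq.mul_left (p : ℝ⟦X⟧)) using 1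
    push_cast
    ring
  · have hfq := hf₁.mul hgq
    have hpq := hfp.mul (hone q)
    simp only [one_mul, mul_one] at hfq hpq
    refine (hfq.add hpq).congr_left fun w => ?_
    rw [Polynomial.eval_mul]
    ring

theorem rescale (hf : HasAsymptoticSeries f P) {c : ℝ} (hc : 0 < c) :
    HasAsymptoticSeries (fun w => f (c * w)) (PowerSeries.rescale c P) := fun N => by
  obtain ⟨p, hp, hfp⟩ := hf N
  refine ⟨p.comp (Polynomial.C c * Polynomial.X), ?_, ?_⟩
  · refine PowerSeries.X_pow_dvd_iff.mpr fun i hi => ?_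
    have := PowerSeries.X_pow_dvd_iff.mp hp i hi
    rw [map_sub, Polynomial.coeff_coe, sub_eq_zero] at this
    rw [map_sub, PowerSeries.coeff_rescale, Polynomial.coeff_coe,
      Polynomial.comp_C_mul_X_coeff, this]
    ring
  · have hlim : Tendsto (fun w => c * w) (𝓝[>] 0) (𝓝[>] 0) := by
      refine tendsto_nhdsWithin_iff.mpr ⟨?_, ?_⟩
      · simpa using (tendsto_id.const_mul c).mono_left (nhdsWithin_le_nhds (a := (0 : ℝ)))
      · filter_upwards [self_mem_nhdsWithin] with w hw using mul_pos hc hw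
    have h := hfp.comp_tendsto hlim
    simp only [Function.comp_def, mul_pow] at h
    simpa using h.trans (isBigO_const_mul_self (c ^ N) _ _)

theorem eq_zero (h : HasAsymptoticSeries (fun _ => 0) P) : P = 0 := by
  ext k
  induction k using Nat.strong_induction_on with
  | _ k ih =>
    obtain ⟨p, hp, hO⟩ := h (k + 1)
    have hcoeff (i : ℕ) (hi : i < k + 1) : p.coeff i = coeff i P := by
      have := PowerSeries.X_pow_dvd_iff.mp hp i hi
      rw [map_sub, Polynomial.coeff_coe, sub_eq_zero] at this
      exact this.symm
    obtain ⟨q, rfl⟩ := Polynomial.X_pow_dvd_iff.mpr fun i hi =>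
      (hcoeff i (hi.trans k.lt_succ_self)).trans (ih i hi)
    have hq : (fun w => q.eval w) =O[𝓝[>] 0] fun w : ℝ => w := by
      refine (hO.neg_left.mul (isBigO_refl (fun w : ℝ => (w ^ k)⁻¹) _)).congr' ?_ ?_ <;>
        filter_upwards [self_mem_nhdsWithin] with w (hw : 0 < w)
      · rw [zero_sub, neg_neg, Polynomial.eval_mul, Polynomial.eval_pow, Polynomial.eval_X]
        field_simp
      · rw [pow_succ]
        field_simp
    have hlim := hq.trans_tendsto (tendsto_id.mono_left nhdsWithin_le_nhds)
    have hzero := tendsto_nhds_unique hlim ((q.continuous.tendsto 0).mono_left nhdsWithin_le_nhds)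
    rw [← hcoeff k k.lt_succ_self, Polynomial.coeff_X_pow_mul', if_pos le_rfl, Nat.sub_self,
      Polynomial.coeff_zero_eq_eval_zero, ← hzero, map_zero]

end HasAsymptoticSeries

section Watson

theorem integral_exp_neg_mul_pow_Ioi (j : ℕ) {s : ℝ} (hs : 0 < s) :
    ∫ x in Set.Ioi 0, s * Real.exp (-s * x) * x ^ j = j ! * s⁻¹ ^ j := by
  have h := Real.integral_rpow_mul_exp_neg_mul_Ioi (a := j + 1) (by positivity) hs
  simp only [add_sub_cancel_right, Real.rpow_natCast, Real.Gamma_nat_eq_factorial] at h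
  calc ∫ x in Set.Ioi 0, s * Real.exp (-s * x) * x ^ j
      = s * ∫ x in Set.Ioi 0, x ^ j * Real.exp (-(s * x)) := by
        rw [← integral_const_mul]
        congr 1 with x
        rw [neg_mul]
        ring
    _ = j ! * s⁻¹ ^ j := by
        rw [h, ← Nat.cast_succ, Real.rpow_natCast, pow_succ, one_div]
        field_simp

theorem integrableOn_exp_neg_mul_pow_Ioi (j : ℕ) {s : ℝ} (hs : 0 < s) :
    IntegrableOn (fun x => s * Real.exp (-s * x) * x ^ j) (Set.Ioi 0) :=
  .of_integral_ne_zero (by rw [integral_exp_neg_mul_pow_Ioi j hs]; positivity)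

variable {ρ : Measure ℝ} [IsProbabilityMeasure ρ] {P : ℝ⟦X⟧}

theorem integral_exp_neg_mul_trunc (P : ℝ⟦X⟧) (N : ℕ) {s : ℝ} (hs : 0 < s) :
    IntegrableOn (fun x => s * Real.exp (-s * x) * (P.trunc N).eval x) (Set.Ioi 0) ∧
    ∫ x in Set.Ioi 0, s * Real.exp (-s * x) * (P.trunc N).eval x =
      ((formalLaplace ℝ P).trunc N).eval s⁻¹ := by
  have hInt (i : ℕ) : IntegrableOn (fun x => coeff i P * (s * Real.exp (-s * x) * x ^ i))
      (Set.Ioi 0) := (integrableOn_exp_neg_mul_pow_Ioi i hs).const_mul _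
  have hsum (x : ℝ) : s * Real.exp (-s * x) * (P.trunc N).eval x =
      ∑ i ∈ Finset.range N, coeff i P * (s * Real.exp (-s * x) * x ^ i) := by
    rw [show (P.trunc N).eval x = _ from PowerSeries.eval₂_trunc_eq_sum_range x (RingHom.id ℝ) N P,
      Finset.mul_sum]
    refine Finset.sum_congr rfl fun i _ => ?_
    rw [RingHom.id_apply]
    ring
  simp only [hsum]
  refine ⟨integrable_finsetSum _ fun i _ => hInt i, ?_⟩
  rw [integral_finsetSum _ fun i _ => hInt i, show ((formalLaplace ℝ P).trunc N).eval s⁻¹ = _ from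
    PowerSeries.eval₂_trunc_eq_sum_range s⁻¹ (RingHom.id ℝ) N _]
  refine Finset.sum_congr rfl fun i _ => ?_
  rw [integral_const_mul, integral_exp_neg_mul_pow_Ioi i hs, coeff_formalLaplace, RingHom.id_apply]
  ring

theorem HasExpansion.hasAsymptoticSeries_mgf (hP : HasExpansion (cdf ρ) P) (h : cdf ρ 0 = 0) :
    HasAsymptoticSeries (fun w => mgf id ρ (-w⁻¹)) (formalLaplace ℝ P) := fun N => by
  refine ⟨(formalLaplace ℝ P).trunc N, PowerSeries.X_pow_dvd_iff.mpr fun i hi => ?_, ?_⟩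
  · rw [map_sub, Polynomial.coeff_coe, PowerSeries.coeff_trunc, if_pos hi, sub_self]
  obtain ⟨K, hK⟩ := hP.exists_abs_sub_le (abs_cdf_le_one ρ) N
  refine .of_bound (K * N !) ?_
  filter_upwards [self_mem_nhdsWithin] with w (hw : 0 < w)
  have hs := inv_pos.mpr hw
  obtain ⟨hInt, htrunc⟩ := integral_exp_neg_mul_trunc P N hs
  have hcdf : IntegrableOn (fun x => w⁻¹ * Real.exp (-w⁻¹ * x) * cdf ρ x) (Set.Ioi 0) :=
    integrableOn_exp_neg_mul_cdf ρ hs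
  rw [inv_inv] at htrunc
  rw [mgf_neg_eq_integral_cdf h hs, ← htrunc, ← integral_sub hcdf hInt]
  calc _ ≤ ∫ x in Set.Ioi 0, K * (w⁻¹ * Real.exp (-w⁻¹ * x) * x ^ N) := by
        refine norm_integral_le_of_norm_le ((integrableOn_exp_neg_mul_pow_Ioi N hs).const_mul K) ?_
        filter_upwards [ae_restrict_mem measurableSet_Ioi] with x hx
        rw [← mul_sub, norm_mul, Real.norm_of_nonneg (by positivity), mul_left_comm]
        gcongr
        exact hK x hx
    _ = K * N ! * ‖w ^ N‖ := by
        rw [integral_const_mul, integral_exp_neg_mul_pow_Ioi N hs, inv_inv, norm_pow,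
          Real.norm_of_nonneg hw.le, mul_assoc]

theorem eval_zero_binomTail {R : Type*} [CommRing R] {k n : ℕ} (hk : 0 < k) :
    (binomTail R k n).eval 0 = 0 := by
  rw [← Polynomial.coeff_zero_eq_eval_zero]
  exact Polynomial.X_pow_dvd_iff.mp (X_pow_dvd_binomTail k n) 0 hk

theorem laplaceDefect_eq_zero_of_mgf {r l : ℕ} {γ κ : Measure ℝ} [IsProbabilityMeasure γ]
    [IsProbabilityMeasure κ] (hr : 0 < r) (hP : HasExpansion (cdf ρ) P) (h : cdf ρ 0 = 0)
    (hγ : ∀ x, cdf γ x = (binomTail ℝ r l).eval (cdf ρ x))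
    (hκ : ∀ x, cdf κ x = (binomTail ℝ (r + 1) (l + 1)).eval (cdf ρ x))
    (hmgf : ∀ s, mgf id κ s = mgf id γ s * mgf id ρ (s / (l + 1))) :
    laplaceDefect r l P = 0 := by
  have hρs := (hP.hasAsymptoticSeries_mgf h).rescale (c := l + 1) (by positivity)
  have hγs := HasExpansion.hasAsymptoticSeries_mgf (ρ := γ)
    (P := Polynomial.aeval P (binomTail ℝ r l))
    (by simpa only [← hγ] using! hP.aeval (binomTail ℝ r l))
    (by rw [hγ, h, eval_zero_binomTail hr])
  have hκs := HasExpansion.hasAsymptoticSeries_mgf (ρ := κ)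
    (P := Polynomial.aeval P (binomTail ℝ (r + 1) (l + 1)))
    (by simpa only [← hκ] using! hP.aeval (binomTail ℝ (r + 1) (l + 1)))
    (by rw [hκ, h, eval_zero_binomTail r.succ_pos])
  have hzero (w : ℝ) : mgf id γ (-w⁻¹) * mgf id ρ (-((l + 1) * w)⁻¹) - mgf id κ (-w⁻¹) = 0 := by
    rw [hmgf, mul_inv, neg_div, div_eq_inv_mul, sub_self]
  exact HasAsymptoticSeries.eq_zero (by simpa only [hzero] using! (hγs.mul hρs).sub hκs)

end Watson

/-! ### Convergent Laplace coefficients -/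

section LaplaceSum

/-- The sum of the formal Laplace transform of `P` at a complex number `w`. Where the series
converges and `P` expands a distribution function, it continues the Laplace–Stieltjes transform
of the latter at `1 / w`. -/
noncomputable def laplaceSum (P : ℝ⟦X⟧) (w : ℂ) : ℂ :=
  ∑' j, ((coeff j (formalLaplace ℝ P) : ℝ) : ℂ) * w ^ j

variable {ρ : Measure ℝ} [IsProbabilityMeasure ρ] {P : ℝ⟦X⟧} {C A : ℝ}

theorem summable_formalLaplace_mul_pow (hA : 0 < A)
    (hP : ∀ j, |coeff j (formalLaplace ℝ P)| ≤ C * A ^ j) {s : ℝ} (hs : 0 ≤ s) (hsA : s < A⁻¹) :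
    Summable fun j => |coeff j (formalLaplace ℝ P)| * s ^ j := by
  have hgeom := (summable_geometric_of_lt_one (mul_nonneg hA.le hs)
    ((lt_inv_mul_iff₀ hA).mp (by simpa using hsA))).mul_left C
  refine .of_nonneg_of_le (fun j => by positivity) (fun j => ?_) hgeom
  rw [mul_pow, ← mul_assoc]
  gcongr
  exact hP j

theorem analyticOnNhd_laplaceSum (hA : 0 < A)
    (hP : ∀ j, |coeff j (formalLaplace ℝ P)| ≤ C * A ^ j) :
    AnalyticOnNhd ℂ (laplaceSum P) (Metric.ball 0 A⁻¹) := by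
  set p := FormalMultilinearSeries.ofScalars ℂ fun j => ((coeff j (formalLaplace ℝ P) : ℝ) : ℂ)
  have hsum : laplaceSum P = p.sum := by
    ext w
    simp only [laplaceSum, FormalMultilinearSeries.sum, p,
      FormalMultilinearSeries.ofScalars_apply_eq, smul_eq_mul]
  have hradius : (A⁻¹.toNNReal : ENNReal) ≤ p.radius := by
    refine p.le_radius_of_bound C fun j => ?_
    rw [FormalMultilinearSeries.ofScalars_norm, Complex.norm_real, Real.norm_eq_abs,
      Real.coe_toNNReal _ (by positivity), inv_pow, ← div_eq_mul_inv, div_le_iff₀ (by positivity)]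
    exact hP j
  have hpos : 0 < p.radius := (ENNReal.coe_pos.mpr (by simpa using hA)).trans_le hradius
  rw [hsum]
  refine (p.hasFPowerSeriesOnBall hpos).analyticOnNhd.mono fun w hw => ?_
  refine Metric.eball_subset_eball hradius ?_
  simpa [Metric.eball_coe, hA.le] using hw

theorem integral_norm_exp_neg_mul_pow_Ioi (a : ℝ) (j : ℕ) {s : ℝ} (hs : 0 < s) :
    ∫ x in Set.Ioi 0, ‖s * Real.exp (-s * x) * (a * x ^ j)‖ = |j ! * a| * s⁻¹ ^ j := by
  calc _ = ∫ x in Set.Ioi 0, |a| * (s * Real.exp (-s * x) * x ^ j) := by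
        refine setIntegral_congr_fun measurableSet_Ioi fun x hx => ?_
        have hx : 0 < x := hx
        simp only [norm_mul, Real.norm_eq_abs, abs_pow, abs_of_pos hx, abs_of_pos hs, Real.abs_exp]
        ring
    _ = |j ! * a| * s⁻¹ ^ j := by
        rw [integral_const_mul, integral_exp_neg_mul_pow_Ioi j hs, abs_mul, Nat.abs_cast]
        ring

theorem HasExpansion.mgf_eq_laplaceSum (hF : HasExpansion (cdf ρ) P) (h : cdf ρ 0 = 0) (hA : 0 < A)
    (hP : ∀ j, |coeff j (formalLaplace ℝ P)| ≤ C * A ^ j) {s : ℝ} (hs : A < s) :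
    (mgf id ρ (-s) : ℂ) = laplaceSum P (s⁻¹ : ℝ) := by
  have hs₀ := hA.trans hs
  have hcoeff (j : ℕ) : ∫ x in Set.Ioi 0, s * Real.exp (-s * x) * (coeff j P * x ^ j) =
      coeff j (formalLaplace ℝ P) * s⁻¹ ^ j := by
    simp_rw [mul_left_comm _ (coeff j P)]
    rw [integral_const_mul, integral_exp_neg_mul_pow_Ioi j hs₀, coeff_formalLaplace]
    ring
  have hterm (j : ℕ) : IntegrableOn (fun x => s * Real.exp (-s * x) * (coeff j P * x ^ j))
      (Set.Ioi 0) := by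
    simpa only [mul_left_comm _ (coeff j P)] using!
      (integrableOn_exp_neg_mul_pow_Ioi j hs₀).const_mul (coeff j P)
  have hsum := hasSum_integral_of_summable_integral_norm hterm <| by
    simp_rw [integral_norm_exp_neg_mul_pow_Ioi _ _ hs₀, ← coeff_formalLaplace]
    exact summable_formalLaplace_mul_pow hA hP (inv_nonneg.mpr hs₀.le) (inv_strictAnti₀ hA hs)
  have hcdf : ∫ x in Set.Ioi 0, ∑' j, s * Real.exp (-s * x) * (coeff j P * x ^ j) =
      mgf id ρ (-s) := by
    rw [mgf_neg_eq_integral_cdf h hs₀]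
    refine setIntegral_congr_fun measurableSet_Ioi fun x hx => ?_
    rw [tsum_mul_left, (hF x hx).tsum_eq]
  rw [hcdf] at hsum
  simp only [hcoeff] at hsum
  rw [laplaceSum, ← hsum.tsum_eq, Complex.ofReal_tsum]
  simp only [Complex.ofReal_mul, Complex.ofReal_pow]

theorem analyticOnNhd_complexMGF_neg_inv (h : cdf ρ 0 = 0) :
    AnalyticOnNhd ℂ (fun w => complexMGF id ρ (-w⁻¹)) {w | 0 < w.re} := fun w hw => by
  have hne : w ≠ 0 := by rintro rfl; simp at hw
  refine (analyticOnNhd_complexMGF _ ?_).comp (analyticAt_inv hne).neg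
  have hsub : Set.Iio 0 ⊆ interior (integrableExpSet id ρ) :=
    isOpen_Iio.subset_interior_iff.mpr fun s hs => by
      simpa using! integrable_exp_neg_mul h (neg_pos.mpr hs).le
  refine hsub ?_
  simp only [Complex.neg_re, Complex.inv_re, Set.mem_Iio, Left.neg_neg_iff]
  exact div_pos hw (Complex.normSq_pos.mpr hne)

theorem HasExpansion.complexMGF_eqOn_laplaceSum (hF : HasExpansion (cdf ρ) P) (h : cdf ρ 0 = 0)
    (hA : 0 < A) (hP : ∀ j, |coeff j (formalLaplace ℝ P)| ≤ C * A ^ j) :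
    Set.EqOn (fun w => complexMGF id ρ (-w⁻¹)) (laplaceSum P)
      ({w | 0 < w.re} ∩ Metric.ball 0 A⁻¹) := by
  have hconvex : Convex ℝ ({w : ℂ | 0 < w.re} ∩ Metric.ball 0 A⁻¹) :=
    (convex_halfSpace_re_gt 0).inter (convex_ball 0 _)
  have hmem : ((2 * A)⁻¹ : ℝ) ∈ Set.Ioo 0 A⁻¹ :=
    ⟨by positivity, inv_strictAnti₀ hA (by linarith)⟩
  have hreal : ∀ᶠ w : ℝ in 𝓝[≠] (2 * A)⁻¹,
      complexMGF id ρ (-(w : ℂ)⁻¹) = laplaceSum P w := by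
    filter_upwards [nhdsWithin_le_nhds (isOpen_Ioo.mem_nhds hmem)] with w hw
    rw [← Complex.ofReal_inv, ← Complex.ofReal_neg, complexMGF_ofReal,
      hF.mgf_eq_laplaceSum h hA hP ((lt_inv_comm₀ hA hw.1).mpr hw.2), inv_inv]
  have hmap : Tendsto ((↑) : ℝ → ℂ) (𝓝[≠] (2 * A)⁻¹) (𝓝[≠] ((2 * A)⁻¹ : ℝ)) :=
    Complex.continuous_ofReal.continuousWithinAt.tendsto_nhdsWithin fun w hw =>
      Complex.ofReal_injective.ne hw
  refine AnalyticOnNhd.eqOn_of_preconnected_of_frequently_eq (𝕜 := ℂ) (z₀ := ((2 * A)⁻¹ : ℝ))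
    ((analyticOnNhd_complexMGF_neg_inv h).mono Set.inter_subset_left)
    ((analyticOnNhd_laplaceSum hA hP).mono Set.inter_subset_right) hconvex.isPreconnected ?_
    (hmap.frequently hreal.frequently)
  simpa [abs_of_pos hA, hA] using hmem

theorem tendsto_complexMGF_charFun (h : cdf ρ 0 = 0) (t : ℝ) :
    Tendsto (fun ε : ℝ => complexMGF id ρ (t * Complex.I - ε)) (𝓝[>] 0) (𝓝 (charFun ρ t)) := by
  rw [← complexMGF_id_mul_I]
  refine tendsto_integral_filter_of_dominated_convergence (fun _ => 1)
    (.of_forall fun ε => by fun_prop) ?_ (integrable_const 1) (.of_forall fun x => ?_)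
  · filter_upwards [self_mem_nhdsWithin] with ε (hε : 0 < ε)
    filter_upwards [ae_pos_of_cdf_zero h] with x hx
    rw [Complex.norm_exp, Real.exp_le_one_iff]
    simp only [id_eq, Complex.mul_re, Complex.sub_re, Complex.ofReal_re, Complex.I_re, mul_zero,
      Complex.ofReal_im, Complex.I_im, mul_one, sub_self, zero_sub, neg_mul, Complex.sub_im,
      Complex.mul_im, add_zero, sub_zero, Left.neg_nonpos_iff]
    positivity
  · refine Tendsto.mono_left ?_ nhdsWithin_le_nhds
    refine Continuous.tendsto' (by fun_prop) _ _ (by simp)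

theorem HasExpansion.charFun_eq_laplaceSum (hF : HasExpansion (cdf ρ) P) (h : cdf ρ 0 = 0)
    (hA : 0 < A) (hP : ∀ j, |coeff j (formalLaplace ℝ P)| ≤ C * A ^ j) {t : ℝ} (ht : A < |t|) :
    charFun ρ t = laplaceSum P (Complex.I / t) := by
  have ht₀ : (t : ℂ) ≠ 0 := by
    rintro ht₀
    simp_all
    linarith
  have hball : Complex.I / t ∈ Metric.ball (0 : ℂ) A⁻¹ := by
    rw [mem_ball_zero_iff, norm_div, Complex.norm_I, Complex.norm_real, Real.norm_eq_abs, one_div]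
    exact inv_strictAnti₀ hA ht
  have hcont : ContinuousAt (fun ε : ℝ => (ε - t * Complex.I : ℂ)⁻¹) 0 :=
    ContinuousAt.inv₀ (by fun_prop) (by simpa using ht₀)
  have hzero : ((0 : ℝ) - t * Complex.I : ℂ)⁻¹ = Complex.I / t := by
    rw [Complex.ofReal_zero, zero_sub, inv_eq_iff_eq_inv, inv_div, Complex.div_I]
  rw [ContinuousAt, hzero] at hcont
  refine tendsto_nhds_unique (tendsto_complexMGF_charFun h t) ?_
  refine Tendsto.congr' ?_ (((analyticOnNhd_laplaceSum hA hP _ hball).continuousAt.tendsto.comp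
    hcont).mono_left nhdsWithin_le_nhds)
  filter_upwards [self_mem_nhdsWithin, nhdsWithin_le_nhds
    (hcont.eventually_mem (Metric.isOpen_ball.mem_nhds hball))] with ε (hε : 0 < ε) hεball
  have hre : 0 < (ε - t * Complex.I : ℂ)⁻¹.re := by
    rw [Complex.inv_re]
    refine div_pos (by simpa) (Complex.normSq_pos.mpr fun h0 => hε.ne' ?_)
    simpa using congrArg Complex.re h0
  have := hF.complexMGF_eqOn_laplaceSum h hA hP ⟨hre, hεball⟩
  simpa using this.symm

end LaplaceSum

section EvenExpansion

variable {ρ : Measure ℝ} [IsProbabilityMeasure ρ] {P : ℝ⟦X⟧} {C A : ℝ} {m : ℕ}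

theorem laplaceSum_neg (heven : ∀ i, ¬2 ∣ i → coeff i P = 0) (w : ℂ) :
    laplaceSum P (-w) = laplaceSum P w := tsum_congr fun j => by
  by_cases hj : 2 ∣ j
  · rw [(even_iff_two_dvd.mpr hj).neg_pow]
  · rw [coeff_formalLaplace, heven j hj]
    simp

theorem HasExpansion.charFun_neg_eq (hF : HasExpansion (cdf ρ) P) (h : cdf ρ 0 = 0) (hA : 0 < A)
    (hP : ∀ j, |coeff j (formalLaplace ℝ P)| ≤ C * A ^ j) (heven : ∀ i, ¬2 ∣ i → coeff i P = 0)
    {t : ℝ} (ht : A < |t|) : charFun ρ (-t) = charFun ρ t := by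
  rw [hF.charFun_eq_laplaceSum h hA hP ht, hF.charFun_eq_laplaceSum h hA hP (by rwa [abs_neg]),
    Complex.ofReal_neg, div_neg, laplaceSum_neg heven]

theorem not_forall_charFun_neg_eq (h : cdf ρ 0 = 0) : ¬∀ t, charFun ρ (-t) = charFun ρ t := by
  intro hsymm
  have hmap : ρ.map (-1 * ·) = ρ := Measure.ext_of_charFun <| funext fun t => by
    rw [charFun_map_mul, neg_one_mul, hsymm]
  have hpos := ae_pos_of_cdf_zero h
  have hneg : ∀ᵐ x ∂ρ, 0 < -1 * x := by
    rw [← hmap] at hpos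
    exact ae_of_ae_map (by fun_prop) hpos
  obtain ⟨x, hx, hx'⟩ := (hpos.and hneg).exists
  linarith

theorem cdf_map_rpow (h : cdf ρ 0 = 0) {a : ℝ} (ha : 0 < a) {x : ℝ} (hx : 0 ≤ x) :
    cdf (ρ.map (· ^ a)) x = cdf ρ (x ^ a⁻¹) := by
  have hmeas : Measurable fun y : ℝ => y ^ a := by fun_prop
  have := Measure.isProbabilityMeasure_map (μ := ρ) hmeas.aemeasurable
  rw [cdf_eq_real, cdf_eq_real, map_measureReal_apply hmeas measurableSet_Iic]
  refine measureReal_congr ?_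
  filter_upwards [ae_pos_of_cdf_zero h] with y hy
  exact propext (Real.le_rpow_inv_iff_of_pos hy.le hx ha).symm

theorem hasSum_mul_iff (hm : 0 < m) {f : ℕ → ℝ} (hf : ∀ i, ¬m ∣ i → f i = 0) {a : ℝ} :
    HasSum (fun j => f (m * j)) a ↔ HasSum f a :=
  (mul_right_injective₀ hm.ne').hasSum_iff fun i hi =>
    hf i fun ⟨j, hj⟩ => hi ⟨j, hj.symm⟩

theorem factorial_two_mul_mul_factorial_le (hm : 3 ≤ m) (j : ℕ) : (2 * j)! * j ! ≤ (m * j)! :=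
  (Nat.le_of_dvd (Nat.factorial_pos _)
    (Nat.factorial_mul_factorial_dvd_factorial_add (2 * j) j)).trans
    (Nat.factorial_le (by nlinarith))

/-- The series in `y = x ^ (m / 2)` obtained from a series `P` in `x ^ m`. -/
noncomputable def regrade (m : ℕ) (P : ℝ⟦X⟧) : ℝ⟦X⟧ :=
  .mk fun i => if 2 ∣ i then coeff (m * (i / 2)) P else 0

theorem HasExpansion.map_rpow (hF : HasExpansion (cdf ρ) P) (h : cdf ρ 0 = 0) (hm : 0 < m)
    (hP : ∀ i, ¬m ∣ i → coeff i P = 0) :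
    HasExpansion (cdf (ρ.map (· ^ (m / 2 : ℝ)))) (regrade m P) := fun x hx => by
  rw [cdf_map_rpow h (by positivity) hx.le, ← hasSum_mul_iff two_pos fun i hi => by
    simp [regrade, hi]]
  have hsum := hF (x ^ (m / 2 : ℝ)⁻¹) (by positivity)
  rw [← hasSum_mul_iff hm fun i hi => by simp [hP i hi]] at hsum
  convert hsum using 3 with j
  · simp [regrade]
  · rw [← Real.rpow_mul_natCast hx.le, ← Real.rpow_natCast]
    congr 1
    push_cast
    field_simp

/-- Since `(m j)! ≥ (2j)! j!` for `3 ≤ m`, regrading turns a finite radius of convergence into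
an infinite one. -/
theorem exists_abs_coeff_formalLaplace_regrade_le (hm : 3 ≤ m) (hA : 0 < A)
    (hP : ∀ j, |coeff j (formalLaplace ℝ P)| ≤ A ^ j) {B : ℝ} (hB : 0 < B) :
    ∃ C, ∀ j, |coeff j (formalLaplace ℝ (regrade m P))| ≤ C * B ^ j := by
  refine ⟨Real.exp (A ^ m / B ^ 2), fun i => ?_⟩
  rw [coeff_formalLaplace, regrade, PowerSeries.coeff_mk]
  split_ifs with hi
  · obtain ⟨j, rfl⟩ := hi
    rw [Nat.mul_div_cancel_left j two_pos, abs_mul, Nat.abs_cast]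
    have hj := hP (m * j)
    rw [coeff_formalLaplace, abs_mul, Nat.abs_cast] at hj
    have hfact : ((2 * j)! * j ! : ℝ) ≤ (m * j)! := mod_cast factorial_two_mul_mul_factorial_le hm j
    calc (2 * j)! * |coeff (m * j) P| = (2 * j)! * j ! * |coeff (m * j) P| / j ! := by field_simp
      _ ≤ (m * j)! * |coeff (m * j) P| / j ! := by gcongr
      _ ≤ A ^ (m * j) / j ! := by gcongr
      _ = (A ^ m / B ^ 2) ^ j / j ! * B ^ (2 * j) := by
        rw [div_pow, ← pow_mul, ← pow_mul]
        field_simp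
      _ ≤ Real.exp (A ^ m / B ^ 2) * B ^ (2 * j) := by
        gcongr
        exact Real.pow_div_factorial_le_exp _ (by positivity) j
  · rw [mul_zero, abs_zero]
    positivity

theorem HasExpansion.false_of_three_le (hF : HasExpansion (cdf ρ) P) (h : cdf ρ 0 = 0)
    (hm : 3 ≤ m) (hP : ∀ i, ¬m ∣ i → coeff i P = 0) (hA : 0 < A)
    (hPA : ∀ j, |coeff j (formalLaplace ℝ P)| ≤ A ^ j) : False := by
  have hmeas : Measurable fun y : ℝ => y ^ (m / 2 : ℝ) := by fun_prop
  have := Measure.isProbabilityMeasure_map (μ := ρ) hmeas.aemeasurable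
  have hzero : cdf (ρ.map (· ^ (m / 2 : ℝ))) 0 = 0 := by
    rw [cdf_map_rpow h (by positivity) le_rfl, Real.zero_rpow (by positivity), h]
  refine not_forall_charFun_neg_eq hzero fun t => ?_
  rcases eq_or_ne t 0 with rfl | ht
  · rw [neg_zero]
  have hB : 0 < |t| / 2 := by positivity
  obtain ⟨C, hC⟩ := exists_abs_coeff_formalLaplace_regrade_le hm hA hPA hB
  exact (hF.map_rpow h (by positivity) hP).charFun_neg_eq hzero hB hC
    (fun i hi => by rw [regrade, PowerSeries.coeff_mk, if_neg hi]) (by linarith)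

end EvenExpansion

/-! ### Band-limited functions -/

open scoped FourierTransform Convolution

section BandLimited

theorem continuous_fourier {f : ℝ → ℂ} (hf : Integrable f) : Continuous (𝓕 f) :=
  VectorFourier.fourierIntegral_continuous Real.continuous_fourierChar
    (innerSL ℝ).continuous₂ hf

theorem fourier_const_mul (c : ℂ) (f : ℝ → ℂ) (ξ : ℝ) :
    𝓕 (fun x => c * f x) ξ = c * 𝓕 f ξ := by
  simp only [Real.fourier_real_eq, Circle.smul_def, smul_eq_mul, mul_left_comm _ c,
    integral_const_mul]

theorem fourier_finsetSum {ι : Type*} (s : Finset ι) {f : ι → ℝ → ℂ}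
    (hf : ∀ i ∈ s, Integrable (f i)) (ξ : ℝ) :
    𝓕 (fun x => ∑ i ∈ s, f i x) ξ = ∑ i ∈ s, 𝓕 (f i) ξ := by
  simp only [Real.fourier_eq, Finset.smul_sum]
  exact integral_finsetSum s fun i hi => (Real.fourierIntegral_convergent_iff ξ).mpr (hf i hi)

theorem fourierInv_convolution {F G : ℝ → ℂ} (hF : Integrable F) (hG : Integrable G) :
    𝓕⁻ (F ⋆[ContinuousLinearMap.mul ℂ ℂ] G) = 𝓕⁻ F * 𝓕⁻ G := by
  ext x
  simp only [Pi.mul_apply, Real.fourierInv_eq_fourier_neg,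
    Real.fourier_mul_convolution_eq hF hG]

/-- An integrable continuous function whose Fourier transform vanishes off `(-R, R)`. -/
structure IsBandLimited (f : ℝ → ℂ) (R : ℝ) : Prop where
  continuous : Continuous f
  integrable : Integrable f
  fourier_eq_zero : ∀ ξ, R ≤ |ξ| → 𝓕 f ξ = 0

namespace IsBandLimited

variable {f g : ℝ → ℂ} {R S : ℝ}

theorem hasCompactSupport_fourier (hf : IsBandLimited f R) : HasCompactSupport (𝓕 f) :=
  .intro (isCompact_Icc (a := -R) (b := R)) fun ξ hξ => hf.fourier_eq_zero ξ <| by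
    contrapose! hξ
    exact abs_le.mp hξ.le

theorem integrable_fourier (hf : IsBandLimited f R) : Integrable (𝓕 f) :=
  (continuous_fourier hf.integrable).integrable_of_hasCompactSupport hf.hasCompactSupport_fourier

theorem fourierInv_fourier (hf : IsBandLimited f R) : 𝓕⁻ (𝓕 f) = f :=
  hf.continuous.fourierInv_fourier_eq hf.integrable hf.integrable_fourier

theorem norm_le (hf : IsBandLimited f R) (x : ℝ) : ‖f x‖ ≤ ∫ ξ, ‖𝓕 f ξ‖ := by
  conv_lhs => rw [← hf.fourierInv_fourier, Real.fourierInv_eq_fourier_neg]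
  exact VectorFourier.norm_fourierIntegral_le_integral_norm ..

theorem integrable_mul (hf : IsBandLimited f R) (hg : IsBandLimited g S) : Integrable (f * g) :=
  hf.integrable.mul_bdd hg.continuous.aestronglyMeasurable (.of_forall hg.norm_le)

theorem fourier_mul_eq_convolution (hf : IsBandLimited f R) (hg : IsBandLimited g S) :
    𝓕 (f * g) = 𝓕 f ⋆[ContinuousLinearMap.mul ℂ ℂ] 𝓕 g := by
  have hinv : 𝓕⁻ (𝓕 f ⋆[ContinuousLinearMap.mul ℂ ℂ] 𝓕 g) = f * g := by
    rw [fourierInv_convolution hf.integrable_fourier hg.integrable_fourier,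
      hf.fourierInv_fourier, hg.fourierInv_fourier]
  have hcont : Continuous (𝓕 f ⋆[ContinuousLinearMap.mul ℂ ℂ] 𝓕 g) :=
    hg.hasCompactSupport_fourier.continuous_convolution_right _
      hf.integrable_fourier.locallyIntegrable (continuous_fourier hg.integrable)
  rw [← hinv]
  refine hcont.fourier_fourierInv_eq
    (hf.integrable_fourier.integrable_convolution _ hg.integrable_fourier) ?_
  have hneg : 𝓕 (𝓕 f ⋆[ContinuousLinearMap.mul ℂ ℂ] 𝓕 g) = fun x => (f * g) (-x) := by
    ext x
    rw [← hinv, Real.fourierInv_eq_fourier_neg, neg_neg]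
  rw [hneg]
  exact (hf.integrable_mul hg).comp_neg

theorem fourier_mul_apply (hf : IsBandLimited f R) (hg : IsBandLimited g S) (ξ : ℝ) :
    𝓕 (f * g) ξ = ∫ u, 𝓕 f u * 𝓕 g (ξ - u) := by
  rw [hf.fourier_mul_eq_convolution hg]
  rfl

theorem mul (hf : IsBandLimited f R) (hg : IsBandLimited g S) : IsBandLimited (f * g) (R + S) where
  continuous := hf.continuous.mul hg.continuous
  integrable := hf.integrable_mul hg
  fourier_eq_zero ξ hξ := by
    rw [hf.fourier_mul_apply hg]
    refine integral_eq_zero_of_ae (.of_forall fun u => ?_)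
    rcases le_or_gt R |u| with hu | hu
    · simp [hf.fourier_eq_zero u hu]
    · simp [hg.fourier_eq_zero (ξ - u) (by linarith [abs_sub_abs_le_abs_sub ξ u])]

theorem pow_succ (hf : IsBandLimited f R) : ∀ p : ℕ, IsBandLimited (f ^ (p + 1)) ((p + 1) * R)
  | 0 => by simpa using hf
  | p + 1 => by
    convert! (hf.pow_succ p).mul hf using 1
    push_cast
    ring

theorem integrable_coeff_mul_pow (hf : IsBandLimited f R) {p : ℂ[X]} (hp : p.coeff 0 = 0) (j : ℕ) :
    Integrable fun x => p.coeff j * f x ^ j := by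
  cases j with
  | zero => simp [hp]
  | succ j => exact (hf.pow_succ j).integrable.const_mul _

theorem fourier_eval (hf : IsBandLimited f R) {p : ℂ[X]} (hp : p.coeff 0 = 0) {d : ℕ}
    (hd : p.natDegree ≤ d) (ξ : ℝ) :
    𝓕 (fun x => p.eval (f x)) ξ = ∑ j ∈ Finset.range (d + 1), p.coeff j * 𝓕 (f ^ j) ξ := by
  simp_rw [Polynomial.eval_eq_sum_range' (Nat.lt_succ_of_le hd)]
  rw [fourier_finsetSum _ fun j _ => hf.integrable_coeff_mul_pow hp j]
  exact Finset.sum_congr rfl fun j _ => fourier_const_mul (p.coeff j) (f ^ j) ξ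

theorem coeff_mul_fourier_pow_eq_zero (hf : IsBandLimited f R) (hR : 0 ≤ R) {p : ℂ[X]}
    (hp : p.coeff 0 = 0) {d j : ℕ} (hj : j ≤ d) {ξ : ℝ} (hξ : d * R ≤ |ξ|) :
    p.coeff j * 𝓕 (f ^ j) ξ = 0 := by
  cases j with
  | zero => simp [hp]
  | succ j =>
    rw [(hf.pow_succ j).fourier_eq_zero ξ (le_trans (by gcongr; exact_mod_cast hj) hξ), mul_zero]

theorem eval (hf : IsBandLimited f R) (hR : 0 ≤ R) {p : ℂ[X]} (hp : p.coeff 0 = 0) {d : ℕ}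
    (hd : p.natDegree ≤ d) : IsBandLimited (fun x => p.eval (f x)) (d * R) where
  continuous := p.continuous.comp hf.continuous
  integrable := by
    simp_rw [Polynomial.eval_eq_sum_range]
    exact integrable_finsetSum _ fun j _ => hf.integrable_coeff_mul_pow hp j
  fourier_eq_zero ξ hξ := by
    rw [hf.fourier_eval hp hd]
    exact Finset.sum_eq_zero fun j hj =>
      hf.coeff_mul_fourier_pow_eq_zero hR hp (Finset.mem_range_succ_iff.mp hj) hξ

theorem fourier_eval_of_le (hf : IsBandLimited f R) (hR : 0 ≤ R) {p : ℂ[X]} (hp : p.coeff 0 = 0)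
    {d : ℕ} (hd : p.natDegree ≤ d + 1) {ξ : ℝ} (hξ : d * R ≤ |ξ|) :
    𝓕 (fun x => p.eval (f x)) ξ = p.coeff (d + 1) * 𝓕 (f ^ (d + 1)) ξ := by
  rw [hf.fourier_eval hp hd, Finset.sum_range_succ, Finset.sum_eq_zero, zero_add]
  exact fun j hj => hf.coeff_mul_fourier_pow_eq_zero hR hp (Finset.mem_range_succ_iff.mp hj) hξ

end IsBandLimited

end BandLimited

open scoped ContDiff

namespace IsBandLimited

variable {f g : ℝ → ℂ} {R S : ℝ}

theorem norm_fourier_mul_le (hf : IsBandLimited f R) (hg : IsBandLimited g S) {c ε : ℝ}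
    (hε : 0 ≤ ε) (hε₁ : ε ≤ 1)
    (hc : ∀ t ∈ Set.Icc 0 ε, ‖𝓕 f (R - t)‖ * ‖𝓕 g (S - (ε - t))‖ ≤ c) :
    ‖𝓕 (f * g) (R + S - ε)‖ ≤ c := by
  have hc₀ : 0 ≤ c := le_trans (by positivity) (hc 0 ⟨le_rfl, hε⟩)
  have hsupp : ∀ u ∉ Set.Icc (R - ε) R, 𝓕 f u * 𝓕 g (R + S - ε - u) = 0 := fun u hu => by
    rcases le_or_gt R u with hRu | hRu
    · rw [hf.fourier_eq_zero u (hRu.trans (le_abs_self u)), zero_mul]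
    · have : S ≤ R + S - ε - u := by
        by_contra! h
        exact hu ⟨by linarith, hRu.le⟩
      rw [hg.fourier_eq_zero _ (this.trans (le_abs_self _)), mul_zero]
  rw [hf.fourier_mul_apply hg, ← setIntegral_eq_integral_of_forall_compl_eq_zero hsupp]
  calc _ ≤ c * volume.real (Set.Icc (R - ε) R) :=
        norm_setIntegral_le_of_norm_le_const (by simp) fun u ⟨hu, hu'⟩ => by
          have := hc (R - u) ⟨by linarith, by linarith⟩
          rw [norm_mul]
          convert! this using 4 <;> ring
    _ = c * ε := by rw [Real.volume_real_Icc_of_le (by linarith), sub_sub_cancel]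
    _ ≤ c := mul_le_of_le_one_right hc₀ hε₁

theorem norm_fourier_pow_le (hf : IsBandLimited f R) {b d : ℝ} (hd₁ : d ≤ 1)
    (hb : ∀ t ∈ Set.Icc 0 d, ‖𝓕 f (R - t)‖ ≤ b) (p : ℕ) :
    ∀ t ∈ Set.Icc 0 d, ‖𝓕 (f ^ (p + 1)) ((p + 1) * R - t)‖ ≤ b ^ (p + 1) := by
  induction p with
  | zero => simpa using hb
  | succ p ih =>
    intro ε ⟨hε, hεd⟩
    have := (hf.pow_succ p).norm_fourier_mul_le hf hε (hεd.trans hd₁) (c := b ^ (p + 1) * b)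
      fun t ⟨ht, htε⟩ => mul_le_mul (ih t ⟨ht, htε.trans hεd⟩)
        (hb _ ⟨by linarith, by linarith⟩) (norm_nonneg _)
        ((norm_nonneg _).trans (ih t ⟨ht, htε.trans hεd⟩))
    rw [← _root_.pow_succ, ← _root_.pow_succ] at this
    convert! this using 3
    push_cast
    ring

/-- If `ε ≤ (p + 1) τ` is split as `t + (ε - t)`, then `t ≤ p τ` or `ε - t ≤ τ`, so one factor of
the convolution always inherits the better bound `a`. -/
theorem norm_fourier_pow_le_mul (hf : IsBandLimited f R) {a b τ : ℝ} {N : ℕ} (hτ : 0 ≤ τ)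
    (hτ₁ : N * τ ≤ 1) (ha : ∀ t ∈ Set.Icc 0 τ, ‖𝓕 f (R - t)‖ ≤ a)
    (hb : ∀ t ∈ Set.Icc 0 (N * τ), ‖𝓕 f (R - t)‖ ≤ b) (p : ℕ) (hp : p + 1 ≤ N) :
    ∀ t ∈ Set.Icc 0 ((p + 1) * τ), ‖𝓕 (f ^ (p + 1)) ((p + 1) * R - t)‖ ≤ a * b ^ p := by
  have hb₀ : 0 ≤ b := (norm_nonneg _).trans (hb 0 ⟨le_rfl, by positivity⟩)
  have ha₀ : 0 ≤ a := (norm_nonneg _).trans (ha 0 ⟨le_rfl, hτ⟩)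
  induction p with
  | zero => simpa using ha
  | succ p ih =>
    intro ε ⟨hε, hετ⟩
    have hεN : ε ≤ N * τ := hετ.trans (by gcongr; exact_mod_cast hp)
    have := (hf.pow_succ p).norm_fourier_mul_le hf hε (hεN.trans hτ₁) (c := a * b ^ (p + 1))
      fun t ⟨ht, htε⟩ => by
        rcases le_or_gt t ((p + 1) * τ) with htτ | htτ
        · calc _ ≤ a * b ^ p * b := mul_le_mul (ih (by lia) t ⟨ht, htτ⟩)
                (hb _ ⟨by linarith, by linarith⟩) (norm_nonneg _) (by positivity)
            _ = _ := by ring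
        · have hετ' : ε - t ≤ τ := by push_cast at hετ; linarith
          calc _ ≤ b ^ (p + 1) * a := mul_le_mul (hf.norm_fourier_pow_le hτ₁ hb p t
                ⟨ht, htε.trans hεN⟩) (ha _ ⟨by linarith, hετ'⟩) (norm_nonneg _) (by positivity)
            _ = _ := mul_comm ..
    rw [← _root_.pow_succ] at this
    convert! this using 3
    push_cast
    ring

end IsBandLimited

theorem exists_norm_le_mul_pow_of_eq_zero {E : Type*} [NormedAddCommGroup E] [NormedSpace ℝ E]
    {w : ℝ → E} (hw : ContDiff ℝ ∞ w) (hzero : ∀ t ≤ 0, w t = 0) (N : ℕ) :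
    ∃ D, ∀ t ∈ Set.Icc 0 1, ‖w t‖ ≤ D * t ^ N := by
  induction N generalizing w with
  | zero =>
    obtain ⟨D, hD⟩ := isCompact_Icc.exists_bound_of_continuousOn (s := Set.Icc 0 1)
      hw.continuous.continuousOn
    exact ⟨D, by simpa using hD⟩
  | succ N ih =>
    obtain ⟨hdiff, hderiv⟩ := contDiff_infty_iff_deriv.mp hw
    have hzero' : ∀ t ≤ 0, deriv w t = 0 := by
      have hIio : Set.Iio 0 ⊆ {t | deriv w t = 0} := fun t ht => by
        rw [Set.mem_ofPred_eq, EventuallyEq.deriv_eq (f := 0), Pi.zero_def, deriv_const]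
        filter_upwards [Iio_mem_nhds ht] with u hu using hzero u hu.le
      have hIic := closure_minimal hIio (isClosed_eq hderiv.continuous continuous_const)
      rw [closure_Iio] at hIic
      exact hIic
    obtain ⟨D, hD⟩ := ih hderiv hzero'
    refine ⟨D, fun t ht01 => ?_⟩
    obtain ⟨ht, ht₁⟩ := ht01
    have hD₀ : 0 ≤ D := by simpa using (norm_nonneg _).trans (hD 1 ⟨zero_le_one, le_rfl⟩)
    have hmean := (convex_Icc 0 t).norm_image_sub_le_of_norm_deriv_le (f := w) (C := D * t ^ N)
      (fun u _ => hdiff u) (fun u hu => (hD u ⟨hu.1, hu.2.trans ht₁⟩).trans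
        (by gcongr; exacts [hu.1, hu.2]))
      ⟨le_rfl, ht⟩ ⟨ht, le_rfl⟩
    rwa [hzero 0 le_rfl, sub_zero, sub_zero, Real.norm_of_nonneg ht, mul_assoc, ← pow_succ] at hmean

/-! ### Even tails -/

section EvenTail

theorem one_sub_binomTail_comp {R : Type*} [CommRing R] {k n : ℕ} (hkn : k ≤ n) :
    1 - (binomTail R k n).comp (1 - Polynomial.X) = binomTail R (n + 1 - k) n := by
  have hsum := congr_arg (Polynomial.comp · (1 - Polynomial.X)) (bernsteinPolynomial.sum R n)
  rw [Finset.range_eq_Ico, ← Finset.sum_Ico_consecutive _ k.zero_le (by lia : k ≤ n + 1),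
    Finset.Ico_add_one_right_eq_Icc] at hsum
  rw [Polynomial.add_comp, Polynomial.one_comp, Polynomial.sum_comp] at hsum
  rw [binomTail, sub_eq_of_eq_add hsum.symm, binomTail]
  refine Finset.sum_nbij' (n - ·) (n - ·) ?_ ?_ ?_ ?_ fun j hj =>
    bernsteinPolynomial.flip R n j (by have := Finset.mem_Ico.mp hj; lia)
  all_goals
    intro j hj
    simp only [Finset.mem_Ico, Finset.mem_Icc] at hj ⊢
    lia

theorem one_sub_eval_binomTail {R : Type*} [CommRing R] {k n : ℕ} (hkn : k ≤ n) (u : R) :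
    1 - (binomTail R k n).eval u = (binomTail R (n + 1 - k) n).eval (1 - u) := by
  rw [← one_sub_binomTail_comp hkn]
  simp [Polynomial.eval_comp]

theorem exists_eval_le_mul_sq {p : ℝ[X]} (hp : Polynomial.X ^ 2 ∣ p) :
    ∃ K, ∀ u ∈ Set.Icc (0 : ℝ) 1, p.eval u ≤ K * u ^ 2 := by
  obtain ⟨q, rfl⟩ := hp
  obtain ⟨K, hK⟩ := isCompact_Icc.exists_bound_of_continuousOn (s := Set.Icc (0 : ℝ) 1)
    q.continuousOn
  refine ⟨K, fun u hu => ?_⟩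
  rw [Polynomial.eval_mul, Polynomial.eval_pow, Polynomial.eval_X, mul_comm]
  exact mul_le_mul_of_nonneg_right ((le_abs_self _).trans (hK u hu)) (sq_nonneg u)

theorem le_of_forall_mul_le {g : ℝ → ℝ} {a x₀ C : ℝ} (ha : 1 < a) (hx₀ : 0 < x₀)
    (hstep : ∀ x, x₀ ≤ x → g (a * x) ≤ g x) (hC : ∀ x, 0 < x → x ≤ a * x₀ → g x ≤ C) {x : ℝ}
    (hx : 0 < x) : g x ≤ C := by
  have ha₀ : 0 < a := by linarith
  obtain ⟨i, hi⟩ := pow_unbounded_of_one_lt (x / (a * x₀)) ha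
  replace hi := ((div_lt_iff₀ (by positivity)).mp hi).le
  induction i generalizing x with
  | zero => exact hC x hx (by simpa using hi)
  | succ i ih =>
    rcases le_total x (a * x₀) with h | h
    · exact hC x hx h
    · rw [show x = a * (x / a) by field_simp]
      refine (hstep _ ((le_div_iff₀' ha₀).mpr h)).trans (ih (by positivity) ?_)
      rw [div_le_iff₀ ha₀]
      exact hi.trans_eq (by ring)

theorem exists_pow_mul_le_of_mul_le_sq {T : ℝ → ℝ} (hT : ∀ x, T x ∈ Set.Icc 0 1)
    (hlim : Tendsto T atTop (𝓝 0)) {a K : ℝ} (ha : 1 < a)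
    (hquad : ∀ x, T (a * x) ≤ K * T x ^ 2) (N : ℕ) : ∃ C, ∀ x, 0 < x → x ^ N * T x ≤ C := by
  have hsmall : ∀ᶠ x in atTop, a ^ N * K * T x < 1 :=
    (hlim.const_mul (a ^ N * K)).eventually_lt_const (by simp)
  obtain ⟨x₁, hx₁⟩ := eventually_atTop.mp hsmall
  set x₀ := max x₁ 1
  have hx₀ : 0 < x₀ := lt_max_of_lt_right one_pos
  refine ⟨(a * x₀) ^ N, fun x hx =>
    le_of_forall_mul_le (g := fun x => x ^ N * T x) ha hx₀ (fun y hy => ?_)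
    (fun y hy hya => ?_) hx⟩
  · have hy₀ : 0 ≤ y := hx₀.le.trans hy
    have hT₀ := (hT y).1
    calc (a * y) ^ N * T (a * y) ≤ (a * y) ^ N * (K * T y ^ 2) := by
          gcongr
          exact hquad y
      _ = y ^ N * T y * (a ^ N * K * T y) := by ring
      _ ≤ y ^ N * T y :=
        mul_le_of_le_one_right (by positivity) (hx₁ y ((le_max_left _ _).trans hy)).le
  · calc y ^ N * T y ≤ y ^ N := mul_le_of_le_one_right (by positivity) (hT y).2
      _ ≤ _ := by gcongr

variable {ρ : Measure ℝ}

/-- The even extension of the tail `1 - F` of a distribution function from the positive half-line,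
complex-valued so that its Fourier transform is defined. -/
noncomputable def evenTail (ρ : Measure ℝ) (x : ℝ) : ℂ :=
  ((1 - cdf ρ |x| : ℝ) : ℂ)

theorem norm_evenTail (x : ℝ) : ‖evenTail ρ x‖ = 1 - cdf ρ |x| := by
  rw [evenTail, Complex.norm_real, Real.norm_of_nonneg (sub_nonneg.mpr (cdf_le_one ρ _))]

theorem evenTail_neg (x : ℝ) : evenTail ρ (-x) = evenTail ρ x := by
  rw [evenTail, evenTail, abs_neg]

theorem continuous_evenTail (hρ : Continuous (cdf ρ)) : Continuous (evenTail ρ) := by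
  unfold evenTail
  fun_prop

theorem integrable_pow_mul_norm_evenTail (hρ : Continuous (cdf ρ))
    (hdecay : ∀ N : ℕ, ∃ C, ∀ x, 0 < x → x ^ N * (1 - cdf ρ x) ≤ C) (N : ℕ) :
    Integrable fun x => ‖x‖ ^ N * ‖evenTail ρ x‖ := by
  obtain ⟨C, hC⟩ := hdecay (N + (volume : Measure ℝ).integrablePower)
  refine integrable_of_le_of_pow_mul_le (C₁ := 1) (C₂ := max C 1) (fun x => ?_) (fun x => ?_)
    (continuous_evenTail hρ).aestronglyMeasurable
  · linarith [norm_evenTail (ρ := ρ) x, cdf_nonneg ρ |x|]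
  · rw [norm_evenTail, Real.norm_eq_abs]
    rcases (abs_nonneg x).eq_or_lt with hx | hx
    · rw [← hx]
      refine le_max_of_le_right (mul_le_one₀ (pow_le_one₀ le_rfl zero_le_one)
        (sub_nonneg.mpr (cdf_le_one ρ 0)) ?_)
      linarith [cdf_nonneg ρ 0]
    · exact le_max_of_le_left (hC _ hx)

theorem integrable_evenTail (hρ : Continuous (cdf ρ))
    (hdecay : ∀ N : ℕ, ∃ C, ∀ x, 0 < x → x ^ N * (1 - cdf ρ x) ≤ C) : Integrable (evenTail ρ) := by
  have := integrable_pow_mul_norm_evenTail hρ hdecay 0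
  simp only [pow_zero, one_mul] at this
  exact (integrable_norm_iff (continuous_evenTail hρ).aestronglyMeasurable).mp this

theorem contDiff_fourier_evenTail (hρ : Continuous (cdf ρ))
    (hdecay : ∀ N : ℕ, ∃ C, ∀ x, 0 < x → x ^ N * (1 - cdf ρ x) ≤ C) :
    ContDiff ℝ ∞ (𝓕 (evenTail ρ)) :=
  Real.contDiff_fourier fun N _ => integrable_pow_mul_norm_evenTail hρ hdecay N

theorem fourier_evenTail_neg (ξ : ℝ) : 𝓕 (evenTail ρ) (-ξ) = 𝓕 (evenTail ρ) ξ := by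
  rw [← Real.fourierInv_eq_fourier_neg, Real.fourierInv_eq_fourier_comp_neg]
  simp only [evenTail_neg]

theorem fourier_evenTail_eq_integral_Ioi (hρ : Integrable (evenTail ρ)) (ξ : ℝ) :
    𝓕 (evenTail ρ) ξ = ∫ x in Set.Ioi 0, (1 - cdf ρ x) •
      (Complex.exp (2 * Real.pi * ξ * x * Complex.I) +
        Complex.exp (-(2 * Real.pi * ξ * x * Complex.I))) := by
  set e : ℝ → ℂ := fun x => Complex.exp (↑(-2 * Real.pi * x * ξ) * Complex.I) • evenTail ρ x
  have he : Integrable e := by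
    convert! (Real.fourierIntegral_convergent_iff ξ).mpr hρ using 2 with x
    rw [Circle.smul_def, Real.fourierChar_apply, RCLike.inner_apply, conj_trivial,
      show 2 * Real.pi * -(ξ * x) = -2 * Real.pi * x * ξ by ring]
  rw [Real.fourier_real_eq_integral_exp_smul,
    ← intervalIntegral.integral_Iic_add_Ioi (b := 0) he.integrableOn he.integrableOn,
    ← neg_zero, ← integral_comp_neg_Ioi, neg_zero,
    ← integral_add he.comp_neg.integrableOn he.integrableOn]
  refine setIntegral_congr_fun measurableSet_Ioi fun x (hx : 0 < x) => ?_
  simp only [e, evenTail, abs_neg, abs_of_pos hx, smul_eq_mul, Complex.real_smul]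
  rw [← add_mul, mul_comm]
  push_cast
  ring_nf

theorem charFun_sub_charFun_neg [IsProbabilityMeasure ρ] (hρ : Integrable (evenTail ρ))
    (h : cdf ρ 0 = 0) (ξ : ℝ) :
    charFun ρ (2 * Real.pi * ξ) - charFun ρ (-(2 * Real.pi * ξ)) =
      2 * Real.pi * ξ * Complex.I * 𝓕 (evenTail ρ) ξ := by
  set c : ℂ := 2 * Real.pi * ξ * Complex.I
  have hInt (t : ℝ) : Integrable (fun x : ℝ => Complex.exp (t * x * Complex.I)) ρ := by
    refine .of_bound (by fun_prop) 1 (.of_forall fun x => ?_)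
    rw [← Complex.ofReal_mul, Complex.norm_exp_ofReal_mul_I]
  have hderiv (x : ℝ) : HasDerivAt (fun x : ℝ => Complex.exp (c * x) - Complex.exp (-(c * x)))
      (c * (Complex.exp (c * x) + Complex.exp (-(c * x)))) x := by
    have hlin : HasDerivAt (fun x : ℝ => c * x) c x := by
      simpa using ((hasDerivAt_id x).ofReal_comp).const_mul c
    convert! hlin.cexp.sub hlin.neg.cexp using 1
    simp only [Pi.neg_apply]
    ring
  have hbound (x : ℝ) : ‖c * (Complex.exp (c * x) + Complex.exp (-(c * x)))‖ ≤ ‖c‖ * (1 + 1) := by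
    rw [norm_mul]
    gcongr
    refine (norm_add_le _ _).trans_eq ?_
    simp [Complex.norm_exp, c]
  have htail : IntegrableOn (fun x : ℝ => (1 - cdf ρ x) •
      (c * (Complex.exp (c * x) + Complex.exp (-(c * x))))) (Set.Ioi 0) := by
    refine (hρ.mul_bdd (by fun_prop) (.of_forall hbound)).integrableOn.congr_fun
      (fun x (hx : 0 < x) => ?_) measurableSet_Ioi
    simp [evenTail, abs_of_pos hx]
  have := integral_sub_eq_integral_one_sub_cdf_smul h hderiv (by fun_prop) htail
  have hcexp (x : ℝ) : c * x = ((2 * Real.pi * ξ : ℝ) : ℂ) * x * Complex.I := by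
    push_cast
    ring
  rw [fourier_evenTail_eq_integral_Ioi hρ, ← integral_const_mul, charFun_apply_real,
    charFun_apply_real, ← integral_sub (hInt _) (hInt _)]
  convert! this using 3 with x
  · simp [hcexp]
  · simp only [mul_smul_comm, hcexp]
    push_cast
    rfl

end EvenTail

namespace IsBandLimited

variable {f : ℝ → ℂ} {R : ℝ}

theorem exists_sharp (hf : IsBandLimited f R) (heven : ∀ ξ, 𝓕 f (-ξ) = 𝓕 f ξ) (hne : f ≠ 0) :
    ∃ R > 0, IsBandLimited f R ∧ ∀ δ > 0, ∃ τ ∈ Set.Icc 0 δ, 𝓕 f (R - τ) ≠ 0 := by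
  set s := {ξ | 𝓕 f ξ ≠ 0}
  have hne' : s.Nonempty := by
    by_contra! hempty
    refine hne ?_
    rw [← hf.fourierInv_fourier, show 𝓕 f = 0 from funext fun ξ => ?_]
    · ext x
      simp [Real.fourierInv_eq]
    · exact not_not.mp fun hξ => (Set.eq_empty_iff_forall_notMem.mp hempty ξ) hξ
  have hbdd : BddAbove s := ⟨R, fun ξ hξ => by
    contrapose! hξ
    simpa [s] using hf.fourier_eq_zero ξ (hξ.le.trans (le_abs_self ξ))⟩
  have hnear : ∀ δ > 0, ∃ ξ ∈ s, sSup s - δ < ξ := fun δ hδ =>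
    exists_lt_of_lt_csSup hne' (sub_lt_self _ hδ)
  have hopen : IsOpen s := isOpen_ne_fun (continuous_fourier hf.integrable) continuous_const
  have hzero (ξ : ℝ) (hξ : sSup s ≤ |ξ|) : 𝓕 f ξ = 0 := by
    by_contra hξs
    have habs : |ξ| ∈ s := by
      rcases abs_choice ξ with h | h <;> rw [h]
      · exact hξs
      · simpa [s, heven] using hξs
    obtain ⟨ε, hε, hball⟩ := Metric.isOpen_iff.mp hopen _ habs
    have : |ξ| + ε / 2 ∈ s := hball (by simp [abs_of_pos hε, hε])
    linarith [le_csSup hbdd this]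
  refine ⟨sSup s, ?_, ⟨hf.continuous, hf.integrable, hzero⟩, fun δ hδ => ?_⟩
  · obtain ⟨ξ, hξ⟩ := hne'
    by_contra! hR
    exact hξ (hzero ξ (hR.trans (abs_nonneg ξ)))
  · obtain ⟨ξ, hξ, hδξ⟩ := hnear δ hδ
    exact ⟨sSup s - ξ, ⟨sub_nonneg.mpr (le_csSup hbdd hξ), by linarith⟩, by rwa [sub_sub_cancel]⟩

theorem integrable_fourier_mul_pow (hf : IsBandLimited f R) (j : ℕ) :
    Integrable fun ξ : ℝ => 𝓕 f ξ * (2 * Real.pi * Complex.I * ξ) ^ j := by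
  have := continuous_fourier hf.integrable
  exact Continuous.integrable_of_hasCompactSupport (by fun_prop)
    hf.hasCompactSupport_fourier.mul_right

theorem integral_norm_fourier_mul_pow_le (hf : IsBandLimited f R) (j : ℕ) :
    ∫ ξ : ℝ, ‖𝓕 f ξ * (2 * Real.pi * Complex.I * ξ) ^ j‖ ≤
      (∫ ξ, ‖𝓕 f ξ‖) * (2 * Real.pi * R) ^ j := by
  rw [← integral_mul_const]
  refine integral_mono (hf.integrable_fourier_mul_pow j).norm
    (hf.integrable_fourier.norm.mul_const _) fun ξ => ?_
  rcases le_or_gt R |ξ| with hξ | hξ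
  · simp [hf.fourier_eq_zero ξ hξ]
  · dsimp only
    rw [norm_mul, norm_pow, norm_mul, Complex.norm_real, Real.norm_eq_abs,
      show ‖(2 * Real.pi * Complex.I : ℂ)‖ = 2 * Real.pi by simp [Real.pi_pos.le]]
    gcongr

theorem exists_hasSum (hf : IsBandLimited f R) : ∃ (c : ℕ → ℂ) (C : ℝ),
    (∀ x : ℝ, HasSum (fun j => c j * x ^ j) (f x)) ∧
      ∀ j, ‖j ! * c j‖ ≤ C * (2 * Real.pi * R) ^ j := by
  set m : ℕ → ℂ := fun j => ∫ ξ : ℝ, 𝓕 f ξ * (2 * Real.pi * Complex.I * ξ) ^ j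
  refine ⟨fun j => m j / j !, ∫ ξ, ‖𝓕 f ξ‖, fun x => ?_, fun j => ?_⟩
  · have hterm (j : ℕ) (ξ : ℝ) : 𝓕 f ξ * (2 * Real.pi * Complex.I * ξ * x) ^ j / j ! =
        𝓕 f ξ * (2 * Real.pi * Complex.I * ξ) ^ j * (x ^ j / j !) := by
      rw [mul_pow]
      ring
    have hexp (ξ : ℝ) : ∑' j : ℕ, 𝓕 f ξ * (2 * Real.pi * Complex.I * ξ * x) ^ j / j ! =
        Complex.exp (↑(2 * Real.pi * ξ * x) * Complex.I) • 𝓕 f ξ := by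
      have := (NormedSpace.expSeries_div_hasSum_exp
        (2 * Real.pi * Complex.I * ξ * x : ℂ)).mul_left (𝓕 f ξ)
      simp only [← mul_div_assoc] at this
      rw [this.tsum_eq, ← Complex.exp_eq_exp_ℂ, smul_eq_mul, mul_comm]
      push_cast
      ring_nf
    have := hasSum_integral_of_summable_integral_norm (μ := volume)
      (F := fun j (ξ : ℝ) => 𝓕 f ξ * (2 * Real.pi * Complex.I * ξ * x) ^ j / j !)
      (fun j => by simpa only [hterm] using (hf.integrable_fourier_mul_pow j).mul_const _) ?_
    · convert! this using 1
      · ext j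
        simp_rw [hterm, integral_mul_const, m]
        ring
      · simp_rw [hexp]
        rw [← congr_fun hf.fourierInv_fourier x, Real.fourierInv_eq']
        simp only [RCLike.inner_apply, conj_trivial, mul_comm x, mul_assoc]
    · refine .of_nonneg_of_le (fun j => integral_nonneg fun ξ => norm_nonneg _) (fun j => ?_)
        ((Real.summable_pow_div_factorial (2 * Real.pi * R * |x|)).mul_left (∫ ξ, ‖𝓕 f ξ‖))
      simp_rw [hterm, norm_mul _ (_ / _ : ℂ), integral_mul_const]
      refine (mul_le_mul_of_nonneg_right (hf.integral_norm_fourier_mul_pow_le j)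
        (norm_nonneg _)).trans_eq ?_
      simp [mul_pow]
      ring
  · rw [mul_div_cancel₀ _ (Nat.cast_ne_zero.mpr j.factorial_ne_zero)]
    exact (norm_integral_le_integral_norm _).trans (hf.integral_norm_fourier_mul_pow_le j)

theorem not_forall_mul_le_norm_fourier_pow (hf : IsBandLimited f R)
    (hsmooth : ContDiff ℝ ∞ (𝓕 f)) (hsharp : ∀ δ > 0, ∃ τ ∈ Set.Icc 0 δ, 𝓕 f (R - τ) ≠ 0)
    {l : ℕ} (hl : 0 < l) {c C : ℝ} (hc : 0 < c) (hC : 0 ≤ C) (q : ℕ) :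
    ¬∀ᶠ τ in 𝓝[≥] 0, c * τ ^ q * ‖𝓕 f (R - τ)‖ ≤
      C * ‖𝓕 (f ^ (l + 1)) ((l + 1) * (R - τ))‖ := by
  intro hineq
  obtain ⟨D, hD⟩ := exists_norm_le_mul_pow_of_eq_zero (w := fun t => 𝓕 f (R - t))
    (hsmooth.comp (contDiff_const.sub contDiff_id))
    (fun t ht => hf.fourier_eq_zero _ ((by linarith : R ≤ R - t).trans (le_abs_self _))) (q + 1)
  have hD₀ : 0 ≤ D := by simpa using (norm_nonneg _).trans (hD 1 ⟨zero_le_one, le_rfl⟩)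
  have hsmall : ∀ᶠ τ : ℝ in 𝓝[≥] 0, (l + 1) * τ < 1 ∧ D * ((l + 1) * τ) ^ (q + 1) < 1 ∧
      C * (D * (l + 1) ^ (q + 1)) * τ < c := by
    refine nhdsWithin_le_nhds (Filter.Eventually.and ?_ (.and ?_ ?_)) <;>
      refine (Continuous.tendsto' (y := 0) (by fun_prop) _ ?_).eventually_lt_const ?_ <;> simp [hc]
  obtain ⟨δ, hδ, hall⟩ := mem_nhdsGE_iff_exists_Icc_subset.mp (hineq.and hsmall)
  obtain ⟨τ, ⟨hτ, hτδ⟩, hmax⟩ := isCompact_Icc.exists_isMaxOn (Set.nonempty_Icc.mpr hδ.le)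
    (f := fun t => ‖𝓕 f (R - t)‖) (Continuous.continuousOn (by
      have := continuous_fourier hf.integrable
      fun_prop))
  obtain ⟨hineq, hτ₁, hb₁, hτc⟩ := hall ⟨hτ, hτδ⟩
  obtain ⟨t, ht, hWt⟩ := hsharp δ hδ
  have ha : 0 < ‖𝓕 f (R - τ)‖ := (norm_pos_iff.mpr hWt).trans_le (hmax ht)
  have hτ₀ : 0 < τ := hτ.lt_of_ne' fun h₀ => by
    rw [h₀, sub_zero, hf.fourier_eq_zero R (le_abs_self R), norm_zero] at ha
    exact ha.false
  set b := D * ((l + 1) * τ) ^ (q + 1) with hb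
  have hpow := hf.norm_fourier_pow_le_mul (N := l + 1) (b := b) hτ (by exact_mod_cast hτ₁.le)
    (fun t ht => hmax ⟨ht.1, ht.2.trans hτδ⟩)
    (fun t ht => (hD t ⟨ht.1, ht.2.trans (by exact_mod_cast hτ₁.le)⟩).trans (by
      obtain ⟨ht₀, ht⟩ := ht
      rw [hb]
      push_cast at ht
      gcongr)) l le_rfl ((l + 1) * τ) ⟨by positivity, le_rfl⟩
  rw [← mul_sub] at hpow
  have hbl : b ^ l ≤ b := pow_le_of_le_one (by positivity) hb₁.le hl.ne'
  have : c * τ ^ q * ‖𝓕 f (R - τ)‖ ≤ C * (D * (l + 1) ^ (q + 1)) * τ * τ ^ q * ‖𝓕 f (R - τ)‖ :=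
    calc _ ≤ C * (‖𝓕 f (R - τ)‖ * b) := hineq.trans (by gcongr; exact hpow.trans (by gcongr))
      _ = _ := by rw [hb, mul_pow, _root_.pow_succ τ]; ring
  exact hτc.not_ge (le_of_mul_le_mul_right (le_of_mul_le_mul_right this ha) (by positivity))

end IsBandLimited

section EvenSeries

theorem exists_mul_pow_le_norm_of_analyticOnNhd {f : ℂ → ℂ} {U : Set ℂ}
    (hf : AnalyticOnNhd ℂ f U) (hU : IsPreconnected U) {w z₀ : ℂ} (hw : w ∈ U) (hfw : f w ≠ 0)
    (hz₀ : z₀ ∈ U) : ∃ c > 0, ∃ q : ℕ, ∀ᶠ z in 𝓝 z₀, c * ‖z - z₀‖ ^ q ≤ ‖f z‖ := by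
  have hne : ¬∀ᶠ z in 𝓝 z₀, f z = 0 := fun h =>
    hfw (hf.eqOn_zero_of_preconnected_of_eventuallyEq_zero hU hz₀ h hw)
  obtain ⟨q, g, hg, hg₀, hfg⟩ := (hf z₀ hz₀).exists_eventuallyEq_pow_smul_nonzero_iff.mpr hne
  refine ⟨‖g z₀‖ / 2, by positivity, q, ?_⟩
  filter_upwards [hfg, hg.continuousAt.norm.eventually_const_le
    (half_lt_self (norm_pos_iff.mpr hg₀))] with z hz hgz
  rw [hz, norm_smul, norm_pow, mul_comm]
  gcongr

variable {ρ : Measure ℝ} {A C R : ℝ} {P : ℝ⟦X⟧}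

theorem HasExpansion.exists_mul_pow_le_norm_charFun [IsProbabilityMeasure ρ]
    (hF : HasExpansion (cdf ρ) P) (h : cdf ρ 0 = 0) (hA : 0 < A)
    (hP : ∀ j, |coeff j (formalLaplace ℝ P)| ≤ C * A ^ j) {t₀ : ℝ} (ht₀ : A < t₀) :
    ∃ c > 0, ∃ q : ℕ, ∀ᶠ t in 𝓝 t₀, c * |t - t₀| ^ q ≤ ‖charFun ρ t‖ := by
  have ht₀' : 0 < t₀ := hA.trans ht₀
  have hball {t : ℝ} (ht : A < t) : ‖(t : ℂ)⁻¹‖ < A⁻¹ := by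
    rw [norm_inv, Complex.norm_real, Real.norm_of_nonneg (hA.trans ht).le]
    exact inv_strictAnti₀ hA ht
  have hne : laplaceSum P (t₀ : ℂ)⁻¹ ≠ 0 := by
    rw [← Complex.ofReal_inv, ← hF.mgf_eq_laplaceSum h hA hP ht₀, Complex.ofReal_ne_zero]
    exact (mgf_pos (by simpa using! integrable_exp_neg_mul h ht₀'.le)).ne'
  obtain ⟨c, hc, q, hcq⟩ := exists_mul_pow_le_norm_of_analyticOnNhd
    (analyticOnNhd_laplaceSum hA hP) (convex_ball 0 A⁻¹).isPreconnected
    (w := (t₀ : ℂ)⁻¹) (z₀ := Complex.I / t₀) (by simpa using hball ht₀) hne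
    (by simpa using hball ht₀)
  have hcont : ContinuousAt (fun t : ℝ => Complex.I / t) t₀ :=
    ContinuousAt.div (by fun_prop) (by fun_prop) (Complex.ofReal_ne_zero.mpr ht₀'.ne')
  refine ⟨c / (2 * t₀ * t₀) ^ q, by positivity, q, ?_⟩
  filter_upwards [hcont.eventually hcq, eventually_gt_nhds ht₀,
    eventually_lt_nhds (lt_two_mul_self ht₀')] with t ht hAt ht2
  have ht' : 0 < t := hA.trans hAt
  have hdist : ‖Complex.I / t - Complex.I / t₀‖ = |t - t₀| / (t * t₀) := by
    rw [div_sub_div _ _ (by exact_mod_cast ht'.ne') (by exact_mod_cast ht₀'.ne'),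
      mul_comm _ Complex.I, ← mul_sub, ← Complex.ofReal_sub, ← Complex.ofReal_mul, norm_div,
      norm_mul, Complex.norm_I, one_mul, Complex.norm_real, Complex.norm_real, Real.norm_eq_abs,
      abs_sub_comm, Real.norm_of_nonneg (by positivity)]
  rw [hF.charFun_eq_laplaceSum h hA hP (hAt.trans_le (le_abs_self t))]
  refine le_trans ?_ ht
  rw [hdist, div_mul_eq_mul_div, mul_div_assoc, ← div_pow]
  gcongr

theorem evenTail_eq_eval {γ : Measure ℝ} {k n : ℕ} (hkn : k ≤ n)
    (hγ : ∀ x, cdf γ x = (binomTail ℝ k n).eval (cdf ρ x)) :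
    evenTail γ = fun x => (binomTail ℂ (n + 1 - k) n).eval (evenTail ρ x) := by
  ext x
  rw [evenTail, evenTail, hγ, one_sub_eval_binomTail hkn, ← map_binomTail Complex.ofRealHom,
    Polynomial.eval_map]
  exact (Polynomial.eval₂_at_apply Complex.ofRealHom _).symm

theorem exists_pow_mul_one_sub_cdf_le {κ : Measure ℝ} {r l : ℕ} (hrl : r < l)
    (hκ : ∀ x, cdf κ x = (binomTail ℝ (r + 1) (l + 1)).eval (cdf ρ x))
    (htail : ∀ x, 1 - cdf ρ ((l + 1) * x) ≤ 1 - cdf κ x) (N : ℕ) :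
    ∃ C, ∀ x, 0 < x → x ^ N * (1 - cdf ρ x) ≤ C := by
  obtain ⟨K, hK⟩ := exists_eval_le_mul_sq <|
    (pow_dvd_pow _ (by lia)).trans (X_pow_dvd_binomTail (R := ℝ) (l + 1 + 1 - (r + 1)) (l + 1))
  have hT (x : ℝ) : 1 - cdf ρ x ∈ Set.Icc 0 1 := by
    constructor <;> linarith [cdf_nonneg ρ x, cdf_le_one ρ x]
  refine exists_pow_mul_le_of_mul_le_sq hT ?_ (a := l + 1) (K := K) (by norm_cast; lia)
    (fun x => (htail x).trans ?_) N
  · simpa using (tendsto_cdf_atTop ρ).const_sub 1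
  · rw [hκ, one_sub_eval_binomTail (by lia)]
    exact hK _ (hT x)

theorem isBandLimited_evenTail [IsProbabilityMeasure ρ] (hρ : Continuous (cdf ρ))
    (hInt : Integrable (evenTail ρ)) (h : cdf ρ 0 = 0) (hA : 0 < A)
    (hsymm : ∀ t, A < |t| → charFun ρ (-t) = charFun ρ t) : IsBandLimited (evenTail ρ) A where
  continuous := continuous_evenTail hρ
  integrable := hInt
  fourier_eq_zero ξ hξ := by
    have hξ₀ : ξ ≠ 0 := abs_pos.mp (hA.trans_le hξ)
    have := charFun_sub_charFun_neg hInt h ξ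
    rw [hsymm, sub_self, zero_eq_mul] at this
    · refine this.resolve_left ?_
      simp [hξ₀, Real.pi_ne_zero]
    · rw [abs_mul, abs_of_pos Real.two_pi_pos]
      nlinarith [Real.pi_gt_three]

theorem IsBandLimited.exists_hasExpansion_cdf (hT : IsBandLimited (evenTail ρ) R) (hR : 0 ≤ R) :
    ∃ (P : ℝ⟦X⟧) (C : ℝ), HasExpansion (cdf ρ) P ∧
      ∀ j, |coeff j (formalLaplace ℝ P)| ≤ C * (2 * Real.pi * R) ^ j := by
  obtain ⟨c, C, hc, hC⟩ := hT.exists_hasSum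
  refine ⟨1 - .mk fun j => (c j).re, 1 + C, fun x hx => ?_, fun j => ?_⟩
  · have hre := Complex.hasSum_re (hc x)
    have hone : HasSum (fun j => coeff j (1 : ℝ⟦X⟧) * x ^ j) 1 := by
      convert! hasSum_ite_eq 0 (1 : ℝ) using 2 with j
      rw [PowerSeries.coeff_one]
      split_ifs with hj <;> simp [hj]
    convert! hone.sub hre using 1
    · ext j
      rw [map_sub, PowerSeries.coeff_mk, sub_mul, ← Complex.ofReal_pow, Complex.re_mul_ofReal]
    · simp [evenTail, abs_of_pos hx]
  · have hre : |j ! * (c j).re| ≤ C * (2 * Real.pi * R) ^ j := by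
      refine le_trans ?_ (hC j)
      rw [← Complex.ofReal_natCast, ← Complex.re_ofReal_mul]
      exact Complex.abs_re_le_norm _
    rw [coeff_formalLaplace, map_sub, PowerSeries.coeff_mk, mul_sub, add_mul]
    refine (abs_sub _ _).trans (add_le_add ?_ hre)
    rcases j.eq_zero_or_pos with rfl | hj
    · simp
    · simp only [PowerSeries.coeff_one, hj.ne', if_false, mul_zero, abs_zero, one_mul]
      have := Real.pi_pos
      positivity

theorem mul_fourier_evenTail_eq {γ κ : Measure ℝ} [IsProbabilityMeasure ρ]
    [IsProbabilityMeasure κ] (hρ : Integrable (evenTail ρ)) (hκ : Integrable (evenTail κ))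
    (hρ₀ : cdf ρ 0 = 0) (hκ₀ : cdf κ 0 = 0) {a : ℝ}
    (hchar : ∀ t, charFun κ t = charFun γ t * charFun ρ (t / a)) {ξ : ℝ} (hξ : ξ ≠ 0)
    (hsymm : charFun γ (-(2 * Real.pi * (a * ξ))) = charFun γ (2 * Real.pi * (a * ξ)))
    (ha : a ≠ 0) :
    a * 𝓕 (evenTail κ) (a * ξ) = charFun γ (2 * Real.pi * (a * ξ)) * 𝓕 (evenTail ρ) ξ := by
  have hκdiff := charFun_sub_charFun_neg hκ hκ₀ (a * ξ)
  have hdiv : 2 * Real.pi * (a * ξ) / a = 2 * Real.pi * ξ := by field_simp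
  rw [hchar, hchar, hsymm, neg_div, hdiv, ← mul_sub, charFun_sub_charFun_neg hρ hρ₀] at hκdiff
  have hne : (2 * Real.pi * ξ * Complex.I : ℂ) ≠ 0 := by simp [hξ, Real.pi_ne_zero]
  refine mul_left_cancel₀ hne ?_
  rw [mul_left_comm _ (charFun γ _), hκdiff]
  push_cast
  ring

theorem coeff_zero_binomTail {k n : ℕ} (hk : 0 < k) : (binomTail ℂ k n).coeff 0 = 0 := by
  rw [Polynomial.coeff_zero_eq_eval_zero, eval_zero_binomTail hk]

theorem IsBandLimited.evenTail_of_binomTail {γ : Measure ℝ} {r l : ℕ}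
    (hT : IsBandLimited (evenTail ρ) R) (hR : 0 ≤ R) (hrl : r ≤ l)
    (hγ : ∀ x, cdf γ x = (binomTail ℝ r l).eval (cdf ρ x)) :
    IsBandLimited (evenTail γ) (l * R) := by
  rw [evenTail_eq_eval hrl hγ]
  exact hT.eval hR (coeff_zero_binomTail (by lia)) (natDegree_binomTail_le _ _)

variable [IsProbabilityMeasure ρ] {γ κ : Measure ℝ} [IsProbabilityMeasure γ]
  [IsProbabilityMeasure κ] {r l : ℕ}

theorem IsBandLimited.mul_fourier_evenTail_eq_mul_fourier_pow
    (hT : IsBandLimited (evenTail ρ) R) (hR : 0 ≤ R) (hr : 0 < r) (hrl : r ≤ l) (h : cdf ρ 0 = 0)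
    (hγ : ∀ x, cdf γ x = (binomTail ℝ r l).eval (cdf ρ x))
    (hκ : ∀ x, cdf κ x = (binomTail ℝ (r + 1) (l + 1)).eval (cdf ρ x))
    (hchar : ∀ t, charFun κ t = charFun γ t * charFun ρ (t / (l + 1))) {ξ : ℝ} (hξ : 0 < ξ)
    (hlξ : l * R ≤ (l + 1) * ξ) :
    charFun γ (2 * Real.pi * ((l + 1) * ξ)) * 𝓕 (evenTail ρ) ξ =
      (l + 1) * (binomTail ℂ (l + 1 - r) (l + 1)).coeff (l + 1) *
        𝓕 (evenTail ρ ^ (l + 1)) ((l + 1) * ξ) := by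
  have hγT := hT.evenTail_of_binomTail hR hrl hγ
  have hκT := hT.evenTail_of_binomTail hR (by lia) hκ
  have habs : l * R ≤ |(l + 1) * ξ| := hlξ.trans (le_abs_self _)
  have hsymm := charFun_sub_charFun_neg hγT.integrable
    (by rw [hγ, h, eval_zero_binomTail hr]) ((l + 1) * ξ)
  rw [hγT.fourier_eq_zero _ habs, mul_zero, sub_eq_zero] at hsymm
  have hκξ := mul_fourier_evenTail_eq hT.integrable hκT.integrable h
    (by rw [hκ, h, eval_zero_binomTail r.succ_pos]) hchar hξ.ne' hsymm.symm (by positivity)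
  rw [← hκξ, evenTail_eq_eval (by lia) hκ, Nat.add_sub_add_right,
    hT.fourier_eval_of_le hR (coeff_zero_binomTail (by lia)) (natDegree_binomTail_le _ _) habs]
  push_cast
  ring

theorem IsBandLimited.exists_mul_pow_le_norm_fourier_pow
    (hT : IsBandLimited (evenTail ρ) R) (hR : 0 < R) (hr : 0 < r) (hrl : r ≤ l) (h : cdf ρ 0 = 0)
    (hγ : ∀ x, cdf γ x = (binomTail ℝ r l).eval (cdf ρ x))
    (hκ : ∀ x, cdf κ x = (binomTail ℝ (r + 1) (l + 1)).eval (cdf ρ x))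
    (hchar : ∀ t, charFun κ t = charFun γ t * charFun ρ (t / (l + 1))) :
    ∃ c > 0, ∃ C ≥ 0, ∃ q : ℕ, ∀ᶠ τ in 𝓝[≥] 0, c * τ ^ q * ‖𝓕 (evenTail ρ) (R - τ)‖ ≤
      C * ‖𝓕 (evenTail ρ ^ (l + 1)) ((l + 1) * (R - τ))‖ := by
  have hl : 0 < (l : ℝ) := by exact_mod_cast hr.trans_le hrl
  obtain ⟨Q, B, hQ, hB⟩ := (hT.evenTail_of_binomTail hR.le hrl hγ).exists_hasExpansion_cdf
    (by positivity)
  obtain ⟨c, hc, q, hcq⟩ := hQ.exists_mul_pow_le_norm_charFun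
    (by rw [hγ, h, eval_zero_binomTail hr]) (by positivity) hB
    (t₀ := 2 * Real.pi * ((l + 1) * R)) (by gcongr; linarith)
  set d : ℂ := (l + 1) * (binomTail ℂ (l + 1 - r) (l + 1)).coeff (l + 1)
  refine ⟨c * (2 * Real.pi * (l + 1)) ^ q, by positivity, ‖d‖, norm_nonneg d, q, ?_⟩
  have hlim : Tendsto (fun τ : ℝ => 2 * Real.pi * ((l + 1) * (R - τ))) (𝓝[≥] 0)
      (𝓝 (2 * Real.pi * ((l + 1) * R))) :=
    (Continuous.tendsto' (by fun_prop) _ _ (by simp)).mono_left nhdsWithin_le_nhds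
  have hsmall : ∀ᶠ τ : ℝ in 𝓝[≥] 0, (l + 1) * τ < R :=
    nhdsWithin_le_nhds <|
      (Continuous.tendsto' (y := 0) (by fun_prop) _ (by simp)).eventually_lt_const hR
  filter_upwards [hlim.eventually hcq, hsmall, self_mem_nhdsWithin] with τ hτ hτR (hτ₀ : 0 ≤ τ)
  have hdist : |2 * Real.pi * ((l + 1) * (R - τ)) - 2 * Real.pi * ((l + 1) * R)| =
      2 * Real.pi * (l + 1) * τ := by
    rw [show _ - _ = -(2 * Real.pi * (l + 1) * τ) by ring, abs_neg, abs_of_nonneg (by positivity)]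
  rw [hdist, mul_pow, ← mul_assoc] at hτ
  rw [← norm_mul, ← hT.mul_fourier_evenTail_eq_mul_fourier_pow hR.le hr hrl h hγ hκ hchar
    (by nlinarith) (by linarith), norm_mul]
  gcongr

theorem HasExpansion.false_of_even (hF : HasExpansion (cdf ρ) P) (hρ : Continuous (cdf ρ))
    (h : cdf ρ 0 = 0) (heven : ∀ i, ¬2 ∣ i → coeff i P = 0) (hA : 0 < A)
    (hPA : ∀ j, |coeff j (formalLaplace ℝ P)| ≤ A ^ j) (hr : 0 < r) (hrl : r < l)
    (hγ : ∀ x, cdf γ x = (binomTail ℝ r l).eval (cdf ρ x))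
    (hκ : ∀ x, cdf κ x = (binomTail ℝ (r + 1) (l + 1)).eval (cdf ρ x))
    (hchar : ∀ t, charFun κ t = charFun γ t * charFun ρ (t / (l + 1)))
    (htail : ∀ x, 1 - cdf ρ ((l + 1) * x) ≤ 1 - cdf κ x) : False := by
  have hdecay := exists_pow_mul_one_sub_cdf_le hrl hκ htail
  have hband := isBandLimited_evenTail hρ (integrable_evenTail hρ hdecay) h hA fun t =>
    hF.charFun_neg_eq h hA (C := 1) (by simpa only [one_mul] using hPA) heven
  have hne : evenTail ρ ≠ 0 := fun h₀ => by simpa [evenTail, h] using congr_fun h₀ 0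
  obtain ⟨R, hR, hT, hsharp⟩ := hband.exists_sharp fourier_evenTail_neg hne
  obtain ⟨c, hc, C, hC, q, hineq⟩ :=
    hT.exists_mul_pow_le_norm_fourier_pow hR hr hrl.le h hγ hκ hchar
  exact hT.not_forall_mul_le_norm_fourier_pow (contDiff_fourier_evenTail hρ hdecay) hsharp
    (hr.trans hrl) hc hC q hineq

end EvenSeries

/-! ### Distributions with a Maclaurin density -/

section DensityExpansion

variable {f : ℝ → ℝ} {P : ℝ⟦X⟧}

theorem HasExpansion.setIntegral (hf : HasExpansion f P) :
    HasExpansion (fun x => ∫ t in Set.Ioc 0 x, f t)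
      (PowerSeries.X * .mk fun i => coeff i P / (i + 1)) := fun x hx => by
  have hterm (i : ℕ) : ∫ t in Set.Ioc 0 x, t ^ i = x ^ (i + 1) / (i + 1) := by
    rw [← intervalIntegral.integral_of_le hx.le, integral_pow]
    simp
  have hInt (i : ℕ) : IntegrableOn (fun t => coeff i P * t ^ i) (Set.Ioc 0 x) :=
    (continuous_const.mul (continuous_pow i)).integrableOn_Ioc
  have hnorm (i : ℕ) : ∫ t in Set.Ioc 0 x, ‖coeff i P * t ^ i‖ ≤ ‖coeff i P * x ^ i‖ * x := by
    have hle : ∀ t ∈ Set.Ioc 0 x, ‖coeff i P * t ^ i‖ ≤ ‖coeff i P * x ^ i‖ := fun t ht => by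
      simp only [norm_mul, norm_pow, Real.norm_of_nonneg ht.1.le, Real.norm_of_nonneg hx.le]
      gcongr
      exacts [ht.1.le, ht.2]
    calc ∫ t in Set.Ioc 0 x, ‖coeff i P * t ^ i‖ ≤ ∫ _ in Set.Ioc 0 x, ‖coeff i P * x ^ i‖ :=
          setIntegral_mono_on (hInt i).norm continuous_const.integrableOn_Ioc measurableSet_Ioc hle
      _ = ‖coeff i P * x ^ i‖ * x := by simp [hx.le, mul_comm]
  have hsum := hasSum_integral_of_summable_integral_norm hInt (Summable.of_nonneg_of_le
    (fun i => integral_nonneg fun t => norm_nonneg _) hnorm ((hf x hx).summable.norm.mul_right x))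
  rw [setIntegral_congr_fun measurableSet_Ioc fun t ht => (hf t ht.1).tsum_eq] at hsum
  rw [← hasSum_nat_add_iff' 1]
  simpa [integral_const_mul, hterm, mul_div_assoc, div_mul_eq_mul_div,
    PowerSeries.coeff_succ_X_mul] using! hsum

theorem cdf_eq_setIntegral {ν : Measure ℝ} [IsProbabilityMeasure ν] (h : cdf ν 0 = 0)
    (hf : Measurable f) (hf₀ : ∀ x, 0 ≤ f x)
    (hν : ν = volume.withDensity fun x => ENNReal.ofReal (f x)) (x : ℝ) :
    cdf ν x = ∫ t in Set.Ioc 0 x, f t := by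
  have hIoc := (cdf ν).measure_Ioc 0 x
  rw [measure_cdf, h, sub_zero] at hIoc
  rw [integral_eq_lintegral_of_nonneg_ae (.of_forall hf₀) hf.aestronglyMeasurable,
    ← withDensity_apply _ measurableSet_Ioc, ← hν, hIoc, ENNReal.toReal_ofReal (cdf_nonneg ν x)]

theorem InClassF.exists_hasExpansion {ν : Measure ℝ} [IsProbabilityMeasure ν] (hν : InClassF ν) :
    ∃ P : ℝ⟦X⟧, constantCoeff P = 0 ∧ HasExpansion (cdf ν) P := by
  obtain ⟨f, hf, hf₀, hνf, hfM⟩ := hν.exists_density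
  have hfQ : HasExpansion f (.mk fun q => iteratedDerivWithin q f (Set.Ici 0) 0 / q !) :=
    fun x hx => by simpa only [PowerSeries.coeff_mk] using hfM x hx
  have hcdf := funext (cdf_eq_setIntegral hν.cdf_zero hf hf₀ hνf)
  exact ⟨_, by rw [map_mul, PowerSeries.constantCoeff_X, zero_mul], hcdf ▸ hfQ.setIntegral⟩

theorem HasLeadingTerm.eval_trunc {R : Type*} [CommRing R] {P : R⟦X⟧} {m : ℕ} {e : R}
    (hP : HasLeadingTerm P m e) (x : R) : (P.trunc (m + 1)).eval x = e * x ^ m := by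
  rw [show (P.trunc (m + 1)).eval x = _ from
    PowerSeries.eval₂_trunc_eq_sum_range x (RingHom.id R) (m + 1) P, Finset.sum_range_succ,
    Finset.sum_eq_zero, zero_add, RingHom.id_apply, hP.2]
  intro i hi
  rw [PowerSeries.X_pow_dvd_iff.mp hP.1 i (Finset.mem_range.mp hi), map_zero, zero_mul]

theorem HasExpansion.leadingCoeff_nonneg (hf : HasExpansion f P) (hf₀ : ∀ x, 0 ≤ f x)
    (hf₁ : ∀ x, f x ≤ 1) {m : ℕ} {e : ℝ} (hP : HasLeadingTerm P m e) : 0 ≤ e := by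
  obtain ⟨K, hK⟩ := hf.exists_abs_sub_le (fun x => abs_le.mpr ⟨by linarith [hf₀ x], hf₁ x⟩) (m + 1)
  have hlim : Tendsto (fun x => e + K * x) (𝓝[>] 0) (𝓝 e) := by
    simpa using ((tendsto_id.const_mul K).const_add e).mono_left
      (nhdsWithin_le_nhds (a := (0 : ℝ)) (s := Set.Ioi 0))
  refine ge_of_tendsto hlim ?_
  filter_upwards [self_mem_nhdsWithin] with x (hx : 0 < x)
  have hle := (abs_le.mp (hK x hx)).2
  rw [hP.eval_trunc] at hle
  refine nonneg_of_mul_nonneg_left ?_ (pow_pos hx m)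
  rw [pow_succ] at hle
  linarith [hf₀ x]

theorem HasExpansion.exists_hasLeadingTerm {ν : Measure ℝ} (hP : HasExpansion (cdf ν) P)
    (hP₀ : constantCoeff P = 0) : ∃ m e, 0 < m ∧ 0 < e ∧ HasLeadingTerm P m e := by
  have hne : P ≠ 0 := by
    rintro rfl
    obtain ⟨x, hx, hx₀⟩ := ((tendsto_cdf_atTop ν).eventually_ne one_ne_zero |>.and
      (eventually_gt_atTop 0)).exists
    exact hx ((hP x hx₀).unique (by simp))
  have hlead : HasLeadingTerm P P.order.toNat (coeff P.order.toNat P) :=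
    ⟨PowerSeries.X_pow_order_dvd, rfl⟩
  have hcoeff : coeff P.order.toNat P ≠ 0 := PowerSeries.coeff_order hne
  refine ⟨_, _, Nat.pos_of_ne_zero fun h₀ => hcoeff ?_, lt_of_le_of_ne
    (hP.leadingCoeff_nonneg (cdf_nonneg ν) (cdf_le_one ν) hlead) hcoeff.symm, hlead⟩
  rwa [h₀, PowerSeries.coeff_zero_eq_constantCoeff_apply]

end DensityExpansion

section ExponentialLaw

variable {ν : Measure ℝ} {c a : ℝ}

theorem hasSum_mul_coeff_expSeries (c a x : ℝ) :
    HasSum (fun i => a * (coeff i (expSeries c a) * x ^ i)) (c * (1 - Real.exp (-(a * x)))) := by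
  have hexp := NormedSpace.expSeries_div_hasSum_exp (-(a * x))
  rw [← Real.exp_eq_exp_ℝ] at hexp
  have h := (((hasSum_nat_add_iff' 1).mpr hexp).mul_left (-c))
  rw [← hasSum_nat_add_iff' 1]
  convert! h using 1
  · ext i
    rw [coeff_expSeries_succ]
    ring
  · simp [(hasLeadingTerm_expSeries c a).constantCoeff_eq_zero one_pos]
    ring

theorem HasExpansion.rate_pos (h : HasExpansion (cdf ν) (expSeries c a)) (hc : 0 < c) : 0 < a := by
  by_contra! ha
  have hnonneg (i : ℕ) : 0 ≤ coeff i (expSeries c a) := by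
    cases i with
    | zero => simp [(hasLeadingTerm_expSeries c a).constantCoeff_eq_zero one_pos]
    | succ i =>
      rw [coeff_expSeries_succ]
      have := neg_nonneg.mpr ha
      positivity
  have hlinear (x : ℝ) (hx : 0 < x) : c * x ≤ cdf ν x := by
    simpa [coeff_expSeries_succ c a 0] using le_hasSum (h x hx) 1 fun i _ =>
      mul_nonneg (hnonneg i) (pow_nonneg hx.le i)
  have htwo : c * (2 / c) = 2 := by field_simp
  linarith [hlinear (2 / c) (by positivity), cdf_le_one ν (2 / c)]

theorem HasExpansion.exists_eq_expMeasure [IsProbabilityMeasure ν]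
    (h : HasExpansion (cdf ν) (expSeries c a)) (hν : cdf ν 0 = 0) (hc : 0 < c) :
    ∃ s : ℝ, 0 < s ∧ ν = expMeasure s := by
  have ha := h.rate_pos hc
  have hcdf (x : ℝ) (hx : 0 < x) : a * cdf ν x = c * (1 - Real.exp (-(a * x))) :=
    ((h x hx).mul_left a).unique (hasSum_mul_coeff_expSeries c a x)
  have hexp : Tendsto (fun x => c * (1 - Real.exp (-(a * x)))) atTop (𝓝 (c * (1 - 0))) :=
    ((Real.tendsto_exp_neg_atTop_nhds_zero.comp
      (tendsto_id.const_mul_atTop ha)).const_sub 1).const_mul c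
  have hac : a = c := by
    have hlim := ((tendsto_cdf_atTop ν).const_mul a).congr'
      ((eventually_gt_atTop 0).mono hcdf)
    simpa using tendsto_nhds_unique hlim hexp
  have := isProbabilityMeasure_expMeasure ha
  refine ⟨a, ha, Measure.eq_of_cdf _ _ (StieltjesFunction.ext fun x => ?_)⟩
  rw [cdf_expMeasure_eq ha]
  split_ifs with hx
  · rcases hx.eq_or_lt with rfl | hx
    · simpa using hν
    · exact mul_left_cancel₀ ha.ne' (by rw [hcdf x hx, hac])
  · exact ((monotone_cdf ν (not_le.mp hx).le).trans hν.le).antisymm (cdf_nonneg ν x)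

end ExponentialLaw

end

/-! ### Order statistics -/

section OrderStatistics

variable {n k : ℕ}

theorem orderStat_le_iff (x : Fin n → ℝ) (hk : 1 ≤ k) (hkn : k ≤ n) (t : ℝ) :
    orderStat x k hk hkn ≤ t ↔ k ≤ (Finset.univ.filter fun i => x i ≤ t).card := by
  have hsort := Tuple.lt_card_le_iff_apply_le_of_monotone (j := (⟨k - 1, by omega⟩ : Fin n))
    (a := t) (Tuple.monotone_sort x)
  have hcard : (Finset.univ.filter fun i => (x ∘ Tuple.sort x) i ≤ t).card =
      (Finset.univ.filter fun i => x i ≤ t).card := Finset.card_equiv (Tuple.sort x) (by simp)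
  rw [orderStat, ← Function.comp_apply (f := x), ← hsort, hcard]
  change k - 1 < _ ↔ k ≤ _
  omega

theorem setOf_filter_le_eq (t : ℝ) (s : Finset (Fin n)) :
    {x : Fin n → ℝ | (Finset.univ.filter fun i => x i ≤ t) = s} =
      Set.univ.pi fun i => if i ∈ s then Set.Iic t else Set.Ioi t := by
  ext x
  simp only [Set.mem_ofPred_eq, Finset.ext_iff, Finset.mem_filter_univ, Set.mem_univ_pi]
  refine forall_congr' fun i => ?_
  split_ifs with hi <;> simp [hi]

theorem measurableSet_setOf_filter_le_eq (t : ℝ) (s : Finset (Fin n)) :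
    MeasurableSet {x : Fin n → ℝ | (Finset.univ.filter fun i => x i ≤ t) = s} := by
  rw [setOf_filter_le_eq]
  refine .univ_pi fun i => ?_
  split_ifs
  exacts [measurableSet_Iic, measurableSet_Ioi]

theorem setOf_orderStat_le_eq (hk : 1 ≤ k) (hkn : k ≤ n) (t : ℝ) :
    {x : Fin n → ℝ | orderStat x k hk hkn ≤ t} = ⋃ s ∈ Finset.univ.filter fun s => k ≤ s.card,
      {x : Fin n → ℝ | (Finset.univ.filter fun i => x i ≤ t) = s} := by
  ext x
  simp [orderStat_le_iff]

theorem measurable_orderStat (hk : 1 ≤ k) (hkn : k ≤ n) :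
    Measurable fun x : Fin n → ℝ => orderStat x k hk hkn := by
  refine measurable_of_Iic fun t => ?_
  change MeasurableSet {x : Fin n → ℝ | orderStat x k hk hkn ≤ t}
  rw [setOf_orderStat_le_eq]
  exact Finset.measurableSet_biUnion _ fun s _ => measurableSet_setOf_filter_le_eq t s

variable (ν : Measure ℝ) [IsProbabilityMeasure ν]

theorem measureReal_pi_filter_le_eq (t : ℝ) (s : Finset (Fin n)) :
    (Measure.pi fun _ => ν).real {x : Fin n → ℝ | (Finset.univ.filter fun i => x i ≤ t) = s} =
      cdf ν t ^ s.card * (1 - cdf ν t) ^ (n - s.card) := by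
  have hfactor (i : Fin n) : ν.real (if i ∈ s then Set.Iic t else Set.Ioi t) =
      if i ∈ s then cdf ν t else 1 - cdf ν t := by
    split_ifs
    exacts [(cdf_eq_real ν t).symm, measureReal_Ioi_eq_one_sub_cdf ν t]
  rw [setOf_filter_le_eq, measureReal_def, Measure.pi_pi, ENNReal.toReal_prod]
  simp only [← measureReal_def, hfactor, Finset.prod_ite, Finset.prod_const, Finset.filter_univ_mem,
    Finset.filter_notMem_eq_sdiff, ← Finset.compl_eq_univ_sdiff, Finset.card_compl,
    Fintype.card_fin]

theorem sum_pow_card_mul_pow_eq_eval_binomTail (k n : ℕ) (u : ℝ) :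
    ∑ s : Finset (Fin n) with k ≤ s.card, u ^ s.card * (1 - u) ^ (n - s.card) =
      (binomTail ℝ k n).eval u := by
  have hsum := Finset.sum_powerset_apply_card (x := (Finset.univ : Finset (Fin n)))
    fun j => if k ≤ j then u ^ j * (1 - u) ^ (n - j) else 0
  have hIcc : Finset.Icc k n = (Finset.range (n + 1)).filter fun j => k ≤ j := by
    ext j
    simp only [Finset.mem_Icc, Finset.mem_filter, Finset.mem_range]
    omega
  rw [Finset.powerset_univ, Finset.card_univ, Fintype.card_fin] at hsum
  rw [Finset.sum_filter, hsum, binomTail, Polynomial.eval_finsetSum, hIcc, Finset.sum_filter]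
  refine Finset.sum_congr rfl fun j _ => ?_
  split_ifs <;> simp [bernsteinPolynomial, mul_assoc]

theorem measureReal_pi_orderStat_le (hk : 1 ≤ k) (hkn : k ≤ n) (t : ℝ) :
    (Measure.pi fun _ => ν).real {x : Fin n → ℝ | orderStat x k hk hkn ≤ t} =
      (binomTail ℝ k n).eval (cdf ν t) := by
  have hdisj : ((Finset.univ.filter fun s : Finset (Fin n) => k ≤ s.card) : Set _).PairwiseDisjoint
      fun s => {x : Fin n → ℝ | (Finset.univ.filter fun i => x i ≤ t) = s} :=
    Set.pairwiseDisjoint_fiber _ _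
  rw [setOf_orderStat_le_eq, measureReal_biUnion_finset hdisj
    fun s _ => measurableSet_setOf_filter_le_eq t s, ← sum_pow_card_mul_pow_eq_eval_binomTail]
  exact Finset.sum_congr rfl fun s _ => measureReal_pi_filter_le_eq ν t s

variable {Ω : Type*} [MeasurableSpace Ω] {μ : Measure Ω} {ν}

theorem cdf_map_orderStat {X : Fin n → Ω → ℝ} (hlaw : ∀ i, HasLaw (X i) ν μ)
    (hindep : iIndepFun X μ) (hk : 1 ≤ k) (hkn : k ≤ n) (t : ℝ) :
    cdf (μ.map fun ω => orderStat (fun i => X i ω) k hk hkn) t =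
      (binomTail ℝ k n).eval (cdf ν t) := by
  have hX : AEMeasurable (fun ω i => X i ω) μ := aemeasurable_pi_lambda _ fun i =>
    (hlaw i).aemeasurable
  have hord := measurable_orderStat hk hkn
  have := Measure.isProbabilityMeasure_map (μ := Measure.pi fun _ => ν) hord.aemeasurable
  have hjoint : μ.map (fun ω i => X i ω) = Measure.pi fun _ => ν := by
    rw [hindep.map_fun_eq_pi_map fun i => (hlaw i).aemeasurable]
    simp only [fun i => (hlaw i).map_eq]
  have hmap : μ.map (fun ω => orderStat (fun i => X i ω) k hk hkn) =
      (Measure.pi fun _ => ν).map fun x => orderStat x k hk hkn := by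
    rw [← hjoint, AEMeasurable.map_map_of_aemeasurable hord.aemeasurable hX]
    rfl
  rw [hmap, cdf_eq_real, map_measureReal_apply hord measurableSet_Iic]
  exact measureReal_pi_orderStat_le ν hk hkn t

theorem indepFun_orderStat_last {l : ℕ} {X : Fin (l + 1) → Ω → ℝ}
    (hX : ∀ i, AEMeasurable (X i) μ) (hindep : iIndepFun X μ) (hk : 1 ≤ k) (hkl : k ≤ l) :
    IndepFun (fun ω => orderStat (fun i : Fin l => X i.castSucc ω) k hk hkl)
      (X (Fin.last l)) μ := by
  have hsplit := hindep.indepFun_finset₀ {Fin.last l}ᶜ {Fin.last l} disjoint_compl_left hX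
  have hproj : Measurable fun (x : ({Fin.last l}ᶜ : Finset (Fin (l + 1))) → ℝ) (i : Fin l) =>
      x ⟨i.castSucc, by simp⟩ := measurable_pi_lambda _ fun i => measurable_pi_apply _
  have hlast : Measurable fun x : ({Fin.last l} : Finset (Fin (l + 1))) → ℝ =>
      x ⟨Fin.last l, Finset.mem_singleton_self _⟩ := measurable_pi_apply _
  exact hsplit.comp ((measurable_orderStat hk hkl).comp hproj) hlast

end OrderStatistics

/-! ### The characterization -/

section Characterization

variable {Ω : Type*} [MeasurableSpace Ω] {μ : Measure Ω} {U V : Ω → ℝ} {a : ℝ}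

theorem mgf_map_add_const_mul (hU : AEMeasurable U μ) (hV : AEMeasurable V μ)
    (hUV : IndepFun U V μ) (a s : ℝ) :
    mgf id (μ.map fun ω => U ω + a * V ω) s = mgf id (μ.map U) s * mgf id (μ.map V) (a * s) := by
  rw [mgf_id_map (hU.fun_add (hV.const_mul a)), mgf_id_map hU, mgf_id_map hV, ← mgf_const_mul]
  exact (hUV.comp measurable_id (measurable_const_mul a)).mgf_add'
    hU.aestronglyMeasurable (hV.const_mul a).aestronglyMeasurable

theorem charFun_map_add_const_mul [IsFiniteMeasure μ] (hU : AEMeasurable U μ)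
    (hV : AEMeasurable V μ) (hUV : IndepFun U V μ) (a t : ℝ) :
    charFun (μ.map fun ω => U ω + a * V ω) t =
      charFun (μ.map U) t * charFun (μ.map V) (a * t) := by
  rw [← charFun_map_mul_comp hV]
  exact congr_fun ((hUV.comp measurable_id (measurable_const_mul a)).charFun_map_fun_add_eq_mul
    hU (hV.const_mul a)) t

theorem cdf_map_add_const_mul_le [IsProbabilityMeasure μ] (hU : AEMeasurable U μ)
    (hV : AEMeasurable V μ) (hU₀ : cdf (μ.map U) 0 = 0) (ha : 0 < a) (x : ℝ) :
    cdf (μ.map fun ω => U ω + a * V ω) (a * x) ≤ cdf (μ.map V) x := by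
  have hUV := hU.fun_add (hV.const_mul a)
  have := Measure.isProbabilityMeasure_map hU
  have := Measure.isProbabilityMeasure_map hV
  have := Measure.isProbabilityMeasure_map hUV
  rw [cdf_eq_real, cdf_eq_real, map_measureReal_apply_of_aemeasurable hUV measurableSet_Iic,
    map_measureReal_apply_of_aemeasurable hV measurableSet_Iic]
  refine ENNReal.toReal_mono (measure_ne_top _ _) (measure_mono_ae ?_)
  filter_upwards [ae_of_ae_map hU (ae_pos_of_cdf_zero hU₀)] with ω hω (hle : U ω + a * V ω ≤ a * x)
  exact le_of_mul_le_mul_left (by linarith : a * V ω ≤ a * x) ha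

theorem exists_eq_expMeasure_of_indepFun [IsProbabilityMeasure μ] {ν : Measure ℝ}
    [IsProbabilityMeasure ν] (hν : InClassF ν) {r l : ℕ} (hr : 0 < r) (hrl : r ≤ l)
    (hU : AEMeasurable U μ) (hV : HasLaw V ν μ) (hUV : IndepFun U V μ)
    (hγ : ∀ x, cdf (μ.map U) x = (binomTail ℝ r l).eval (cdf ν x))
    (hκ : ∀ x, cdf (μ.map fun ω => U ω + 1 / ((l + 1 : ℕ) : ℝ) * V ω) x =
      (binomTail ℝ (r + 1) (l + 1)).eval (cdf ν x)) :
    ∃ s : ℝ, 0 < s ∧ ν = expMeasure s := by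
  have hV' := hV.aemeasurable
  have := Measure.isProbabilityMeasure_map hU
  have := Measure.isProbabilityMeasure_map (hU.fun_add (hV'.const_mul (1 / ((l + 1 : ℕ) : ℝ))))
  have hscale (t : ℝ) : 1 / ((l + 1 : ℕ) : ℝ) * t = t / (l + 1) := by push_cast; ring
  obtain ⟨P, hP₀, hP⟩ := hν.exists_hasExpansion
  obtain ⟨m, e, hm, he, hlead⟩ := hP.exists_hasLeadingTerm hP₀
  have hdefect : laplaceDefect r l P = 0 :=
    laplaceDefect_eq_zero_of_mgf hr hP hν.cdf_zero hγ hκ fun s => by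
      rw [mgf_map_add_const_mul hU hV' hUV, hV.map_eq, hscale]
  obtain rfl | hm₂ : m = 1 ∨ 2 ≤ m := by omega
  · obtain ⟨a, rfl⟩ := exists_eq_expSeries_of_laplaceDefect_eq_zero hr hrl hlead he.ne' hdefect
    exact hP.exists_eq_expMeasure hν.cdf_zero he
  have hvanish (i : ℕ) (hi : ¬m ∣ i) : PowerSeries.coeff i P = 0 :=
    coeff_eq_zero_of_laplaceDefect_eq_zero hr hrl hm₂ hlead he.ne' hdefect hi
  obtain ⟨A, hA, hPA⟩ := exists_abs_coeff_formalLaplace_le hm hr hrl hlead he hdefect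
  refine False.elim ?_
  rcases hm₂.eq_or_lt with rfl | hm₃
  · have h2r := two_mul_le_of_factorial_eq le_rfl
      (factorial_eq_of_laplaceDefect_eq_zero hm hrl hlead he.ne' hdefect)
    refine hP.false_of_even hν.continuous_cdf hν.cdf_zero hvanish hA hPA hr (by omega) hγ hκ
      (fun t => ?_) fun x => sub_le_sub_left ?_ 1
    · rw [charFun_map_add_const_mul hU hV' hUV, hV.map_eq, hscale]
    · have hle := cdf_map_add_const_mul_le hU hV' (by rw [hγ, hν.cdf_zero, eval_zero_binomTail hr])
        (a := 1 / ((l + 1 : ℕ) : ℝ)) (by positivity) ((l + 1) * x)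
      rwa [hV.map_eq, hscale, mul_div_cancel_left₀ x (by positivity)] at hle
  · exact hP.false_of_three_le hν.cdf_zero hm₃ hvanish hA hPA

end Characterization

theorem theorem1 {Ω : Type*} [MeasurableSpace Ω] (μ : Measure Ω) [IsProbabilityMeasure μ]
    (ν : Measure ℝ) [IsProbabilityMeasure ν] (hν : InClassF ν)
    (n k : ℕ) (hk : 1 < k) (hkn : k ≤ n)
    (X : Fin n → Ω → ℝ) (hlaw : ∀ i, HasLaw (X i) ν μ) (hindep : iIndepFun X μ)
    (heq : IdentDistrib
      (fun ω => orderStat (fun i : Fin (n - 1) => X (Fin.castLE (Nat.sub_le n 1) i) ω)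
          (k - 1) (by omega) (by omega) + (1 / (n : ℝ)) * X ⟨n - 1, by omega⟩ ω)
      (fun ω => orderStat (fun i : Fin n => X i ω) k (by omega) hkn) μ μ) :
    ∃ r : ℝ, 0 < r ∧ ν = expMeasure r := by
  obtain ⟨l, rfl⟩ : ∃ l, n = l + 1 := ⟨n - 1, by omega⟩
  obtain ⟨r, rfl⟩ : ∃ r, k = r + 1 := ⟨k - 1, by omega⟩
  have hX (i) : AEMeasurable (X i) μ := (hlaw i).aemeasurable
  have hr : 1 ≤ r := by omega
  have hrl : r ≤ l := by omega
  have hfirst : iIndepFun (fun i : Fin l => X i.castSucc) μ :=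
    hindep.precomp (Fin.castSucc_injective l)
  exact exists_eq_expMeasure_of_indepFun hν hr hrl
    ((measurable_orderStat hr hrl).comp_aemeasurable
      (aemeasurable_pi_lambda _ fun i => hX i.castSucc))
    (hlaw (Fin.last l)) (indepFun_orderStat_last hX hindep hr hrl)
    (cdf_map_orderStat (fun i => hlaw i.castSucc) hfirst hr hrl)
    fun x => heq.map_eq ▸ cdf_map_orderStat hlaw hindep (by omega) hkn x
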